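/- Let $k$ be an arbitrary field and let $C\subset\mathbb{P}^2_k$ be an anisotropic conic over $k$, i.e. $C=\mathrm{Proj}\bigl(k[x_0,x_1,x_2]/(q)\bigr)$ for a homogeneous polynomial $q\in k[x_0,x_1,x_2]$ of degree $2$ that has no zero in $k^3$ other than the origin. Let $\mathcal{V}$ be a nonzero vector bundle on $C$ (a locally free $\mathcal{O}_C$-module of finite rank). Then $\mathcal{V}$ is isomorphic to a finite direct sum of indecomposable vector bundles on $C$, each of rank at most $2$. In particular, if $\mathcal{V}$ is an indecomposable vector bundle on $C$, then $\mathrm{rank}(\mathcal{V})\leq 2$. -/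

import Mathlib

open CategoryTheory CategoryTheory.Limits AlgebraicGeometry

universe u

noncomputable section

namespace PlaneConic

section Coordinates

variable {k : Type u} [Field k]

/-- A polynomial `q` in three variables `x₀, x₁, x₂` is an anisotropic (ternary) form if it has
no zero in `k³` apart from the origin. For a quadratic form `q` this says that the plane conic
`q = 0` has no `k`-rational point. -/
def IsAnisotropic (q : MvPolynomial (Fin 3) k) : Prop :=
  ∀ v : Fin 3 → k, MvPolynomial.eval v q = 0 → v = 0

/-- The homogeneous coordinate ring `k[x₀, x₁, x₂] / (q)` of the plane curve `q = 0`. -/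
abbrev CoordinateRing (q : MvPolynomial (Fin 3) k) : Type u :=
  MvPolynomial (Fin 3) k ⧸ Ideal.span {q}

/-- The degree `n` part of the homogeneous coordinate ring: the classes of the homogeneous
polynomials of degree `n`. -/
def grading (q : MvPolynomial (Fin 3) k) (n : ℕ) : Submodule k (CoordinateRing q) :=
  (MvPolynomial.homogeneousSubmodule (Fin 3) k n).map
    (Ideal.Quotient.mkₐ k (Ideal.span {q})).toLinearMap

theorem mk_mem_grading (q : MvPolynomial (Fin 3) k) {n : ℕ} {p : MvPolynomial (Fin 3) k}
    (hp : p ∈ MvPolynomial.homogeneousSubmodule (Fin 3) k n) :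
    Ideal.Quotient.mk (Ideal.span {q}) p ∈ grading q n :=
  ⟨p, hp, rfl⟩

instance gradedMonoid (q : MvPolynomial (Fin 3) k) : SetLike.GradedMonoid (grading q) where
  one_mem := mk_mem_grading q (SetLike.GradedOne.one_mem)
  mul_mem := by
    rintro i j _ _ ⟨a, ha, rfl⟩ ⟨b, hb, rfl⟩
    exact ⟨a * b, SetLike.GradedMul.mul_mem ha hb, map_mul (Ideal.Quotient.mkₐ k (Ideal.span {q})) a b⟩

/-- The map sending a homogeneous polynomial to its class, in the same degree. -/
def gradingMap (q : MvPolynomial (Fin 3) k) (n : ℕ) :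
    MvPolynomial.homogeneousSubmodule (Fin 3) k n →ₗ[k] grading q n :=
  (Ideal.Quotient.mkₐ k (Ideal.span {q})).toLinearMap.submoduleMap _

/-- The maps `gradingMap q n`, for all `n`, assembled to a homomorphism of graded algebras. -/
def gradingAlgHom (q : MvPolynomial (Fin 3) k) :
    (DirectSum ℕ fun n => MvPolynomial.homogeneousSubmodule (Fin 3) k n) →ₐ[k]
      DirectSum ℕ fun n => grading q n :=
  DirectSum.toAlgebra k (fun n => MvPolynomial.homogeneousSubmodule (Fin 3) k n)
    (fun n => (DirectSum.lof k ℕ (fun n => grading q n) n).comp (gradingMap q n))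
    (by rfl)
    (by
      intro i j a b
      simp only [LinearMap.comp_apply, DirectSum.lof_eq_of, DirectSum.of_mul_of]
      rfl)

theorem gradingAlgHom_of (q : MvPolynomial (Fin 3) k) (n : ℕ)
    (x : MvPolynomial.homogeneousSubmodule (Fin 3) k n) :
    gradingAlgHom q (DirectSum.of (fun n => MvPolynomial.homogeneousSubmodule (Fin 3) k n) n x) =
      DirectSum.of (fun n => grading q n) n (gradingMap q n x) :=
  DirectSum.toAddMonoid_of _ _ _

/-- The map sending a polynomial to the family of the classes of its homogeneous components. -/
def preDecompose (q : MvPolynomial (Fin 3) k) :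
    MvPolynomial (Fin 3) k →ₐ[k] DirectSum ℕ fun n => grading q n :=
  letI : GradedAlgebra (MvPolynomial.homogeneousSubmodule (Fin 3) k) := MvPolynomial.gradedAlgebra
  (gradingAlgHom q).comp
    (DirectSum.decomposeAlgEquiv (MvPolynomial.homogeneousSubmodule (Fin 3) k)).toAlgHom

theorem preDecompose_of_mem (q : MvPolynomial (Fin 3) k) {n : ℕ} {p : MvPolynomial (Fin 3) k}
    (hp : p ∈ MvPolynomial.homogeneousSubmodule (Fin 3) k n) :
    preDecompose q p = DirectSum.of (fun n => grading q n) n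
      ⟨Ideal.Quotient.mk (Ideal.span {q}) p, mk_mem_grading q hp⟩ := by
  let : GradedAlgebra (MvPolynomial.homogeneousSubmodule (Fin 3) k) := MvPolynomial.gradedAlgebra
  have h : DirectSum.decomposeAlgEquiv (MvPolynomial.homogeneousSubmodule (Fin 3) k) p =
      DirectSum.of (fun n => MvPolynomial.homogeneousSubmodule (Fin 3) k n) n ⟨p, hp⟩ :=
    DirectSum.decompose_of_mem _ hp
  exact (congrArg (gradingAlgHom q) h).trans (gradingAlgHom_of q n ⟨p, hp⟩)

/-- The homogeneous coordinate ring of a plane conic is graded by the degree. -/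
@[reducible]
def gradedAlgebra (q : MvPolynomial (Fin 3) k) (hq : q.IsHomogeneous 2) :
    GradedAlgebra (grading q) :=
  GradedAlgebra.ofAlgHom (grading q)
    (Ideal.Quotient.liftₐ (Ideal.span {q}) (preDecompose q) (by
      intro a ha
      obtain ⟨c, rfl⟩ := Ideal.mem_span_singleton'.mp ha
      have h0 : preDecompose q q = 0 := by
        rw [preDecompose_of_mem q (n := 2) hq]
        have : (⟨Ideal.Quotient.mk (Ideal.span {q}) q, mk_mem_grading q (n := 2) hq⟩ :
            grading q 2) = 0 :=
          Subtype.ext (Ideal.Quotient.eq_zero_iff_mem.mpr (Ideal.mem_span_singleton_self q))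
        rw [this, map_zero]
      rw [map_mul, h0, mul_zero]))
    (by
      apply Ideal.Quotient.algHom_ext
      apply MvPolynomial.algHom_ext
      intro i
      have h := preDecompose_of_mem q (n := 1) (p := MvPolynomial.X i)
        (MvPolynomial.isHomogeneous_X k i)
      change DirectSum.coeAlgHom (grading q) (preDecompose q (MvPolynomial.X i)) = _
      rw [h, DirectSum.coeAlgHom_of]
      rfl)
    (by
      rintro n ⟨_, p, hp, rfl⟩
      exact preDecompose_of_mem q hp)

/-- The plane conic `q = 0` in the projective plane over `k`, as a scheme: `Proj` of its
homogeneous coordinate ring. -/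
def conic (q : MvPolynomial (Fin 3) k) (hq : q.IsHomogeneous 2) : Scheme.{u} :=
  letI := gradedAlgebra q hq
  Proj (grading q)

end Coordinates

section Bundles

/-- The free sheaf of modules `𝒪ⁿ` on a scheme. -/
def freeModule (X : Scheme.{u}) (n : ℕ) : X.Modules :=
  SheafOfModules.free (R := X.ringCatSheaf) (ULift.{u} (Fin n))

/-- Sheaves of modules on a scheme have finite direct sums. -/
instance hasFiniteBiproducts (X : Scheme.{u}) : HasFiniteBiproducts X.Modules :=
  Abelian.hasFiniteBiproducts

variable {X : Scheme.{u}}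

/-- On some open neighbourhood of the point `x`, the sheaf of modules `V` is isomorphic to `𝒪ⁿ`. -/
def IsFreeOfRankNear (V : X.Modules) (n : ℕ) (x : X) : Prop :=
  ∃ U : X.Opens, x ∈ U ∧ Nonempty (V.restrict U.ι ≅ freeModule U.toScheme n)

/-- A vector bundle on `X` is a sheaf of modules that is locally free of finite rank. -/
def IsVectorBundle (V : X.Modules) : Prop :=
  ∀ x : X, ∃ n : ℕ, IsFreeOfRankNear V n x

/-- The sheaf of modules `V` is a vector bundle of constant rank `n`. -/
def HasRank (V : X.Modules) (n : ℕ) : Prop :=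
  ∀ x : X, IsFreeOfRankNear V n x

end Bundles

end PlaneConic

end

/-!
The conic is covered by the charts `x₀ ≠ 0` and `x₁ ≠ 0`: by anisotropy the coefficient of `x₂²` in
`q` does not vanish, so that `(0 : 0 : 1)` is not on the curve. With `x = x₁ / x₀` and
`y = x₂ / x₀` the coordinate rings of the charts are `k[x, y]` and `k[x⁻¹, x⁻¹ y]`, and that of
their intersection is `B = k[x, x⁻¹, y]`, with the basis of the `xⁱ` and `xⁱ y` over `k`. These data
are abstracted in `ConicRing` and `ConicCharts`; all that concerns bundles is derived from them. A
bundle becomes a `B`-module `N` with a lattice `M₀` over `k[x, y]` and a lattice `M₁` over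
`k[x⁻¹, x⁻¹ y]`; its global sections are `M₀ ∩ M₁`, and `N / (x M₀ + M₁)` is the first cohomology
group of its twist by `-D`, where `D` is the divisor `x = ∞`, a point with residue field of degree
two over `k`, and `-D` is a canonical divisor.

A bundle of rank at least three has a nontrivial idempotent endomorphism
(`ConicRing.exists_idempotent`). After a twist by a multiple of `D` it has a nonzero global section
`s`, while its twist by `-D` has none. Consider the class of `y s` in `N / (x M₀ + M₁)`.

* If it does not vanish, a linear form on this space with the value `1` at `y s` is, by Serre
  duality, given by a morphism to the trivial line bundle, and this morphism is a retraction of `s`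
  (`ConicRing.exists_projection_of_notMem`).
* If it vanishes, `s` extends to a morphism from the nonsplit extension of `𝒪(D)` by `𝒪`. The
  endomorphism ring of this bundle of rank two is a quaternion algebra, and a division algebra
  because the conic is anisotropic; with this and a second application of duality one finds a
  retraction of that morphism (`ConicRing.exists_projection_of_mem`).

Serre duality is elementary here: `B` carries the residue form `res`, the coefficient of `y`, for
which the coordinate rings of the charts are their own orthogonal complements up to a twist
(`ConicRing.mem_ring_iff`, `ConicRing.mem_swap_ring_iff`), and linear forms on `N` that vanish on
`x M₀ + M₁` are residues of `B`-linear forms (`ConicRing.exists_res_comp_eq_of_lattice`).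

To pass from sheaves to lattices and back, vector bundles are shown to be quasi-coherent, with
finitely generated torsion-free modules of sections over the charts
(`ConicCharts.isGood_of_isVectorBundle`), and morphisms are glued from the charts
(`TwoCharts.exists_hom`). As the coordinate rings of the charts of an anisotropic conic are
principal ideal rings (`ConicRing.isPrincipalIdealRing`), modules of this kind are free. So direct
summands of bundles are again bundles of constant rank, and a decomposition into indecomposable
bundles exists by induction on the rank.
-/

noncomputable section

namespace PlaneConic

/-! ### Quasi-coherent modules on affine schemes -/

section Affine

theorem map_bijective_of_isIso_counit {C D : Type*} [Category* C] [Category* D] {L : C ⥤ D}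
    {R : D ⥤ C} (adj : L ⊣ R) (F G : D) (hF : IsIso (adj.counit.app F)) :
    Function.Bijective (fun f : F ⟶ G => R.map f) := by
  have h1 : (fun f : F ⟶ G => R.map f) =
      adj.homEquiv _ _ ∘ (fun f => adj.counit.app F ≫ f) := by
    funext f
    simp [Adjunction.homEquiv_unit]
  rw [h1]
  refine (Equiv.bijective _).comp ⟨fun a b hab => ?_, fun b => ⟨inv (adj.counit.app F) ≫ b, by
      simp⟩⟩
  exact (cancel_epi _).1 hab

theorem isIso_app_of_retract {C D : Type*} [Category* C] [Category* D] {H K : C ⥤ D}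
    (τ : H ⟶ K) {F G : C} (r : Retract F G) (hG : IsIso (τ.app G)) : IsIso (τ.app F) := by
  have h : RetractArrow (τ.app F) (τ.app G) :=
  { i := Arrow.homMk (H.map r.i) (K.map r.i) (by simp)
    r := Arrow.homMk (H.map r.r) (K.map r.r) (by simp)
    retract := by ext <;> simp [← Functor.map_comp] }
  exact (MorphismProperty.isomorphisms _).of_retract (h := h) hG

variable {R : CommRingCat.{u}} {F G : (Spec R).Modules}

/-- A morphism out of a module of the form `M^~` is the same as a linear map of global sections. -/
theorem existsUnique_hom_of_linearMap (hF : IsIso F.fromTildeΓ) (e : Γ(F, ⊤) →ₗ[R] Γ(G, ⊤)) :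
    ∃! f : F ⟶ G, ∀ s : Γ(F, ⊤), f.app ⊤ s = e s := by
  have h := map_bijective_of_isIso_counit (tilde.adjunction (R := R)) F G hF
  let e' : (moduleSpecΓFunctor (R := R)).obj F ⟶ (moduleSpecΓFunctor (R := R)).obj G :=
    ModuleCat.ofHom (X := Γ(F, ⊤)) (Y := Γ(G, ⊤)) e
  obtain ⟨f, hf⟩ := h.2 e'
  refine ⟨f, fun s => ?_, fun g hg => h.1 ?_⟩
  · exact congr($hf s)
  · refine Eq.trans ?_ hf.symm
    apply ModuleCat.hom_ext
    apply LinearMap.ext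
    exact hg

theorem hom_ext_top (hF : IsIso F.fromTildeΓ) {f g : F ⟶ G}
    (h : ∀ s : Γ(F, ⊤), f.app ⊤ s = g.app ⊤ s) : f = g := by
  have h' := map_bijective_of_isIso_counit (tilde.adjunction (R := R)) F G hF
  apply h'.1
  apply ModuleCat.hom_ext
  apply LinearMap.ext
  exact h

theorem isIso_fromTildeΓ_of_retract (r : Retract F G) (hG : IsIso G.fromTildeΓ) :
    IsIso F.fromTildeΓ :=
  isIso_app_of_retract (Scheme.Modules.fromTildeΓNatTrans (R := R)) r hG

/-- The free module of rank `n` on an affine scheme. -/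
def tildeFree (n : ℕ) : tilde (ModuleCat.of R (ULift.{u} (Fin n) →₀ R)) ≅ freeModule (Spec R) n :=
  tildeFinsupp (R := R) (ULift.{u} (Fin n))

theorem nonempty_iso_freeModule (hF : IsIso F.fromTildeΓ) [Module.Free R Γ(F, ⊤)]
    [Module.Finite R Γ(F, ⊤)] [Nontrivial R] :
    Nonempty (F ≅ freeModule (Spec R) (Module.finrank R Γ(F, ⊤))) := by
  have b := (Module.finBasis R Γ(F, ⊤)).reindex (Equiv.ulift.{u}).symm
  let e : ModuleCat.of R Γ(F, ⊤) ≅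
    ModuleCat.of R (ULift.{u} (Fin (Module.finrank R Γ(F, ⊤))) →₀ R) :=
    LinearEquiv.toModuleIso b.repr
  exact ⟨(asIso F.fromTildeΓ).symm ≪≫ (tilde.functor R).mapIso e ≪≫ tildeFree _⟩

end Affine

/-! ### Restriction of sections to a smaller chart -/

section Restriction

variable {X : Scheme.{u}} {R B : CommRingCat.{u}} (φ : R ⟶ B) (j : Spec R ⟶ X) (g : Spec B ⟶ X)
  [IsOpenImmersion j] [IsOpenImmersion g]

theorem image_top_le (h : Spec.map φ ≫ j = g) : g ''ᵁ ⊤ ≤ j ''ᵁ ⊤ := by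
  subst h
  rintro _ ⟨x, -, rfl⟩
  exact ⟨Spec.map φ x, trivial, by simp⟩

/-- The restriction of sections of `V` over the chart `j` to sections over a smaller chart `g`. -/
def resTop (h : Spec.map φ ≫ j = g) (V : X.Modules) :
    Γ(V.restrict j, ⊤) →+ Γ(V.restrict g, ⊤) :=
  ((V.restrictAppIso j ⊤).hom ≫ V.presheaf.map (homOfLE (image_top_le φ j g h)).op ≫
    (V.restrictAppIso g ⊤).inv).hom

theorem appIso_inv_map (h : Spec.map φ ≫ j = g) (r : R) :
    X.presheaf.map (homOfLE (image_top_le φ j g h)).op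
        ((j.appIso ⊤).inv ((Scheme.ΓSpecIso R).inv r)) =
      (g.appIso ⊤).inv ((Scheme.ΓSpecIso B).inv (φ r)) := by
  have h1 : (j.appIso ⊤).inv ≫ X.presheaf.map (homOfLE (image_top_le φ j g h)).op ≫
      (g.appIso ⊤).hom = (Spec.map φ).appTop := by
    subst h
    rw [Iso.inv_comp_eq, Scheme.Hom.appIso_hom', Scheme.Hom.appIso_hom', Scheme.Hom.map_appLE]
    simp only [Scheme.Hom.appTop, Scheme.Hom.app_eq_appLE]
    exact (Scheme.Hom.appLE_comp_appLE _ _ _ _ _ _ _).symm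
  have h2 : (Scheme.ΓSpecIso R).inv ≫ (j.appIso ⊤).inv ≫
      X.presheaf.map (homOfLE (image_top_le φ j g h)).op =
        φ ≫ (Scheme.ΓSpecIso B).inv ≫ (g.appIso ⊤).inv := by
    rw [← cancel_mono (g.appIso ⊤).hom]
    simp only [Category.assoc, h1, Iso.inv_hom_id, Category.comp_id]
    exact (Scheme.ΓSpecIso_inv_naturality φ).symm
  exact congr($h2 r)

theorem resTop_smul (h : Spec.map φ ≫ j = g) (V : X.Modules) (r : R) (s : Γ(V.restrict j, ⊤)) :
    resTop φ j g h V (r • s) = φ r • resTop φ j g h V s := by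
  rw [Scheme.Modules.smul_Spec_def, Scheme.Modules.smul_Spec_def]
  have e (A : CommRingCat.{u}) (a : Γ(Spec A, ⊤)) :
      (Spec A).presheaf.map (TopologicalSpace.Opens.leTop ⊤).op a = a :=
    congr($((Spec A).presheaf.map_id _) a)
  rw [e, e]
  refine (V.map_smul (homOfLE (image_top_le φ j g h))
    ((j.appIso ⊤).inv ((Scheme.ΓSpecIso R).inv r)) s).trans ?_
  rw [appIso_inv_map φ j g h]
  rfl

end Restriction

/-! ### Restriction of sections to a basic open subset -/

/-- The basic open subset `D(f)` of `Spec R`, as an open subset of the scheme. -/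
abbrev specBasicOpen {R : CommRingCat.{u}} (f : R) : (Spec R).Opens := PrimeSpectrum.basicOpen f

section Restriction

variable {X : Scheme.{u}} {R B : CommRingCat.{u}} (φ : R ⟶ B) (j : Spec R ⟶ X) (g : Spec B ⟶ X)
  [IsOpenImmersion j] [IsOpenImmersion g]

theorem image_basicOpen_eq (h : Spec.map φ ≫ j = g) (f : R)
    (hf : letI := φ.hom.toAlgebra; IsLocalization.Away f B) :
    j ''ᵁ specBasicOpen f = g ''ᵁ ⊤ := by
  subst h
  let := φ.hom.toAlgebra
  have hr : Set.range (Spec.map φ) = (specBasicOpen f : Set (Spec R)) :=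
    PrimeSpectrum.localization_away_comap_range (R := R) B f
  ext x
  constructor
  · rintro ⟨y, hy, rfl⟩
    have hy' : y ∈ Set.range (Spec.map φ) := hr ▸ hy
    obtain ⟨z, rfl⟩ := hy'
    exact ⟨z, trivial, by simp⟩
  · rintro ⟨z, -, rfl⟩
    exact ⟨Spec.map φ z, hr ▸ ⟨z, rfl⟩, by simp⟩

/-- Restriction of sections from the chart `g` to the basic open subset of the chart `j`
with which it coincides. -/
def toBasicOpen (h : Spec.map φ ≫ j = g) (f : R)
    (hf : letI := φ.hom.toAlgebra; IsLocalization.Away f B) (V : X.Modules) :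
    Γ(V.restrict g, ⊤) →+ Γ(V.restrict j, specBasicOpen f) :=
  ((V.restrictAppIso g ⊤).hom ≫
    V.presheaf.map (homOfLE (image_basicOpen_eq φ j g h f hf).le).op ≫
    (V.restrictAppIso j (specBasicOpen f)).inv).hom

theorem toBasicOpen_injective (h : Spec.map φ ≫ j = g) (f : R)
    (hf : letI := φ.hom.toAlgebra; IsLocalization.Away f B) (V : X.Modules) :
    Function.Injective (toBasicOpen φ j g h f hf V) := by
  have hinj : Function.Injective
      (V.presheaf.map (homOfLE (image_basicOpen_eq φ j g h f hf).le).op) := by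
    have := (image_basicOpen_eq φ j g h f hf)
    have h1 : (homOfLE (image_basicOpen_eq φ j g h f hf).le) = eqToHom this :=
      Subsingleton.elim _ _
    rw [h1]
    exact ConcreteCategory.injective_of_mono_of_preservesPullback _
  exact hinj

theorem toBasicOpen_resTop (h : Spec.map φ ≫ j = g) (f : R)
    (hf : letI := φ.hom.toAlgebra; IsLocalization.Away f B) (V : X.Modules)
    (s : Γ(V.restrict j, ⊤)) :
    toBasicOpen φ j g h f hf V (resTop φ j g h V s) =
      (V.restrict j).presheaf.map (specBasicOpen f).leTop.op s := by
  have := V.presheaf.map_comp (homOfLE (image_top_le φ j g h)).op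
    (homOfLE (image_basicOpen_eq φ j g h f hf).le).op
  exact congr($this.symm s)

theorem toBasicOpen_smul (h : Spec.map φ ≫ j = g) (f : R)
    (hf : letI := φ.hom.toAlgebra; IsLocalization.Away f B) (V : X.Modules) (r : R)
    (s : Γ(V.restrict g, ⊤)) :
    toBasicOpen φ j g h f hf V (φ r • s) = r • toBasicOpen φ j g h f hf V s := by
  rw [Scheme.Modules.smul_Spec_def, Scheme.Modules.smul_Spec_def]
  have e (A : CommRingCat.{u}) (a : Γ(Spec A, ⊤)) :
      (Spec A).presheaf.map (TopologicalSpace.Opens.leTop ⊤).op a = a :=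
    congr($((Spec A).presheaf.map_id _) a)
  rw [e]
  refine (V.map_smul (homOfLE (image_basicOpen_eq φ j g h f hf).le)
    ((g.appIso ⊤).inv ((Scheme.ΓSpecIso B).inv (φ r))) s).trans ?_
  rw [← appIso_inv_map φ j g h]
  have h1 : X.presheaf.map (homOfLE (image_top_le φ j g h)).op ≫
      X.presheaf.map (homOfLE (image_basicOpen_eq φ j g h f hf).le).op =
      X.presheaf.map (j.opensFunctor.op.map (specBasicOpen f).leTop.op) :=
    (X.presheaf.map_comp _ _).symm
  have h2 := Scheme.Hom.appIso_inv_naturality j (specBasicOpen f).leTop.op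
  rw [← h1] at h2
  have h3 := congr($h2 ((Scheme.ΓSpecIso R).inv r))
  refine congrArg (· • _) ?_
  exact h3.symm

theorem exists_resTop_eq (h : Spec.map φ ≫ j = g) (f : R)
    (hf : letI := φ.hom.toAlgebra; IsLocalization.Away f B) (V : X.Modules)
    (hV : IsIso (V.restrict j).fromTildeΓ) (t : Γ(V.restrict g, ⊤)) :
    ∃ (n : ℕ) (s : Γ(V.restrict j, ⊤)), φ (f ^ n) • t = resTop φ j g h V s := by
  rw [isIso_fromTildeΓ_iff_isLocalizing] at hV
  obtain ⟨⟨s, ⟨_, n, rfl⟩⟩, hs⟩ := (hV f).surj (toBasicOpen φ j g h f hf V t)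
  refine ⟨n, s, toBasicOpen_injective φ j g h f hf V ?_⟩
  rw [toBasicOpen_smul]
  exact hs.trans (toBasicOpen_resTop φ j g h f hf V s).symm

theorem exists_smul_eq_zero_of_resTop_eq_zero (h : Spec.map φ ≫ j = g) (f : R)
    (hf : letI := φ.hom.toAlgebra; IsLocalization.Away f B) (V : X.Modules)
    (hV : IsIso (V.restrict j).fromTildeΓ) (s : Γ(V.restrict j, ⊤))
    (hs : resTop φ j g h V s = 0) : ∃ n : ℕ, f ^ n • s = 0 := by
  rw [isIso_fromTildeΓ_iff_isLocalizing] at hV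
  have h1 := congrArg (toBasicOpen φ j g h f hf V) hs
  rw [toBasicOpen_resTop, map_zero] at h1
  have := hV f
  obtain ⟨⟨_, n, rfl⟩, hn⟩ := (IsLocalizedModule.eq_zero_iff (.powers f)
    ((modulesSpecToSheaf.obj (V.restrict j)).obj.map (specBasicOpen f).leTop.op).hom).mp h1
  exact ⟨n, hn⟩

end Restriction

/-- A semilinear map that is a localization in the elementary sense makes its target a localized
module, after restriction of scalars. -/
theorem isLocalizedModule_of_semilinear {R B M N : Type*} [CommRing R] [CommRing B] [Algebra R B]
    (f : R) [IsLocalization.Away f B] [AddCommGroup M] [AddCommGroup N] [Module R M] [Module B N]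
    [Module R N] [IsScalarTower R B N] (ρ : M →ₗ[R] N)
    (h1 : ∀ t : N, ∃ (n : ℕ) (s : M), f ^ n • t = ρ s)
    (h2 : ∀ s : M, ρ s = 0 → ∃ n : ℕ, f ^ n • s = 0) : IsLocalizedModule.Away f ρ := by
  refine IsLocalizedModule.Away.mk_of_addCommGroup ?_ h1 h2
  have h3 : IsUnit (algebraMap R B f) := IsLocalization.Away.algebraMap_isUnit f
  have h4 : algebraMap R (Module.End R N) f =
      (Algebra.lsmul R R N : B →ₐ[R] Module.End R N) (algebraMap R B f) := by
    ext n; simp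
  rw [h4]
  exact h3.map _

/-! ### Vector bundles are quasi-coherent -/

/-- The tautological presentation of a free sheaf of modules, without relations. -/
def freePresentation {C : Type*} [Category* C] {J : GrothendieckTopology C} {R : Sheaf J
    RingCat.{u}}
    [HasWeakSheafify J AddCommGrpCat.{u}] [J.WEqualsLocallyBijective AddCommGrpCat.{u}]
    [HasSheafify J AddCommGrpCat.{u}] (I : Type u) :
    (SheafOfModules.free (R := R) I).Presentation where
  generators := SheafOfModules.free.generatingSections I
  relations :=
    { I := ULift Empty
      s := fun i => Empty.rec _ i.down
      epi := by
        have : Mono (SheafOfModules.free.generatingSections (R := R) I).π := by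
          rw [SheafOfModules.free.generatingSections_π]
          exact inferInstanceAs (Mono (𝟙 (SheafOfModules.free (R := R) I)))
        exact IsZero.epi (IsZero.of_iso (isZero_zero _) (Limits.kernel.ofMono _)) _ }

section Quasicoherent

variable {X : Scheme.{u}}

/-- The equivalence between modules on an open subscheme and modules on the slice site
preserves the structure sheaf. -/
def overEquivUnitIso (U : X.Opens) :
    SheafOfModules.unit (X.ringCatSheaf.over U) ≅
      (Scheme.Modules.overEquiv U).inverse.obj (SheafOfModules.unit U.toScheme.ringCatSheaf) :=
  (Scheme.Modules.overEquiv U).unitIso.app _ ≪≫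
    (Scheme.Modules.overEquiv U).inverse.mapIso
      ((Scheme.Modules.overFunctorEquiv U).app (SheafOfModules.unit X.ringCatSheaf) ≪≫
        Scheme.Modules.restrictUnitIso U.ι)

theorem IsVectorBundle.isQuasicoherent {V : X.Modules} (hV : IsVectorBundle V) :
    V.IsQuasicoherent := by
  choose n U hU e using hV
  have e' (x : X) : SheafOfModules.over V (U x) ≅
      (Scheme.Modules.overEquiv (U x)).inverse.obj (freeModule (U x).toScheme (n x)) :=
    (Scheme.Modules.overEquiv (U x)).unitIso.app _ ≪≫
      (Scheme.Modules.overEquiv (U x)).inverse.mapIso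
        ((Scheme.Modules.overFunctorEquiv (U x)).app V ≪≫ (e x).some)
  refine SheafOfModules.QuasicoherentData.isQuasicoherent (M := V)
    { I := X
      X := U
      coversTop := ?_
      presentation := fun x => ?_ }
  · rw [Opens.coversTop_iff]
    exact eq_top_iff.2 fun x _ => TopologicalSpace.Opens.mem_iSup.2 ⟨x, hU x⟩
  · let F : SheafOfModules.{u} (U x).toScheme.ringCatSheaf ⥤
      SheafOfModules.{u} (X.ringCatSheaf.over (U x)) := (Scheme.Modules.overEquiv (U x)).inverse
    have : PreservesColimitsOfSize.{u, u} F :=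
      (Scheme.Modules.overEquiv (U x)).symm.toAdjunction.leftAdjoint_preservesColimits
    exact SheafOfModules.Presentation.ofIsIso (e' x).inv
      ((freePresentation (ULift.{u} (Fin (n x)))).map F
        (overEquivUnitIso (U x)))

theorem IsVectorBundle.isIso_fromTildeΓ {V : X.Modules} (hV : IsVectorBundle V)
    {R : CommRingCat.{u}} (j : Spec R ⟶ X) [IsOpenImmersion j] :
    IsIso (V.restrict j).fromTildeΓ := by
  have := hV.isQuasicoherent
  infer_instance

end Quasicoherent

section LocallyFree

/-- Open immersions pull free modules back to free modules. -/
def restrictFreeIso {X Y : Scheme.{u}} (f : X ⟶ Y) [IsOpenImmersion f] (n : ℕ) :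
    (freeModule Y n).restrict f ≅ freeModule X n :=
  let F : SheafOfModules.{u} Y.ringCatSheaf ⥤ SheafOfModules.{u} X.ringCatSheaf :=
    Scheme.Modules.restrictFunctor f
  have : PreservesColimitsOfSize.{u, u} F :=
    (Scheme.Modules.restrictAdjunction f).leftAdjoint_preservesColimits
  (SheafOfModules.mapFreeIso F (ULift.{u} (Fin n))
    (Scheme.Modules.restrictUnitIso f).symm).symm

variable {X : Scheme.{u}}

/-- If an open immersion factors through an open subset on which `V` is free,
then the restriction of `V` along it is free. -/
theorem nonempty_restrict_iso {V : X.Modules} {n : ℕ} {U : X.Opens}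
    (e : Nonempty (V.restrict U.ι ≅ freeModule U.toScheme n)) {Y : Scheme.{u}} (g : Y ⟶ X)
    [IsOpenImmersion g] (hg : Set.range g ⊆ U) :
    Nonempty (V.restrict g ≅ freeModule Y n) := by
  let l := IsOpenImmersion.lift U.ι g (by simpa using hg)
  have hl : l ≫ U.ι = g := IsOpenImmersion.lift_fac _ _ _
  have : IsOpenImmersion l := by
    have : IsOpenImmersion (l ≫ U.ι) := hl ▸ inferInstance
    exact IsOpenImmersion.of_comp l U.ι
  exact ⟨(Scheme.Modules.restrictFunctorCongr hl.symm).app V ≪≫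
    (Scheme.Modules.restrictFunctorComp l U.ι).app V ≪≫
    (Scheme.Modules.restrictFunctor l).mapIso e.some ≪≫ restrictFreeIso l n⟩

/-- Isomorphic modules have isomorphic global sections. -/
def globalSectionsEquiv {R : CommRingCat.{u}} {F G : (Spec R).Modules} (e : F ≅ G) :
    Γ(F, ⊤) ≃ₗ[R] Γ(G, ⊤) :=
  ((moduleSpecΓFunctor (R := R)).mapIso e).toLinearEquiv

/-- The global sections of the free sheaf of modules form a free module. -/
def globalSectionsFree (R : CommRingCat.{u}) (n : ℕ) :
    (ULift.{u} (Fin n) →₀ R) ≃ₗ[R] Γ(freeModule (Spec R) n, ⊤) :=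
  (tilde.isoTop (R := R) (ModuleCat.of R (ULift.{u} (Fin n) →₀ R)) ≪≫
    (moduleSpecΓFunctor (R := R)).mapIso (tildeFree n)).toLinearEquiv

end LocallyFree

/-! ### Sections of vector bundles over affine charts -/

section LocallyFree

variable {X : Scheme.{u}}

/-- The localization `R_f`, as an object of the category of rings. -/
def awayRing {R : CommRingCat.{u}} (f : R) : CommRingCat.{u} := .of (Localization.Away f)

instance awayRingAlgebra {R : CommRingCat.{u}} (f : R) : Algebra R (awayRing f) :=
  inferInstanceAs (Algebra R (Localization.Away f))

instance {R : CommRingCat.{u}} (f : R) : IsLocalization.Away f (awayRing f) :=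
  inferInstanceAs (IsLocalization.Away f (Localization.Away f))

/-- The localization map `R ⟶ R_f`, as a morphism in the category of rings. -/
def awayHom {R : CommRingCat.{u}} (f : R) : R ⟶ awayRing f :=
  CommRingCat.ofHom (algebraMap R (Localization.Away f))

instance {R : CommRingCat.{u}} (f : R) : IsOpenImmersion (Spec.map (awayHom f)) :=
  IsOpenImmersion.of_isLocalization f

theorem isLocalization_awayHom {R : CommRingCat.{u}} (f : R) :
    letI := (awayHom f).hom.toAlgebra; IsLocalization.Away f (awayRing f) := by
  have h : (awayHom f).hom.toAlgebra = awayRingAlgebra f :=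
    Algebra.algebra_ext _ _ fun _ => rfl
  rw [h]
  infer_instance

/-- The open immersion `D(f) → X` determined by a chart `Spec R → X` and `f ∈ R`. -/
abbrev awayChart {R : CommRingCat.{u}} (j : Spec R ⟶ X) (f : R) :
    Spec (awayRing f) ⟶ X :=
  Spec.map (awayHom f) ≫ j

/-- The basic open subsets on which a vector bundle is free cover each affine chart. -/
theorem span_awayChart_free {V : X.Modules} (hV : IsVectorBundle V) {R : CommRingCat.{u}}
    (j : Spec R ⟶ X) [IsOpenImmersion j] :
    Ideal.span {f : R | ∃ n, Nonempty (V.restrict (awayChart j f) ≅ freeModule _ n)} = ⊤ := by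
  by_contra hne
  obtain ⟨m, hm, hle⟩ := Ideal.exists_le_maximal _ hne
  let x : PrimeSpectrum R := ⟨m, hm.isPrime⟩
  obtain ⟨n, U, hxU, e⟩ := hV (j x)
  obtain ⟨_, ⟨_, ⟨f, rfl⟩, rfl⟩, hxf, hfU⟩ :=
    PrimeSpectrum.isBasis_basic_opens.exists_subset_of_mem_open (show x ∈ ((j ⁻¹ᵁ U : (Spec
        R).Opens) : Set (Spec R)) from hxU) (j ⁻¹ᵁ U).isOpen
  refine hxf (hle (Ideal.subset_span ⟨n, nonempty_restrict_iso e _ ?_⟩))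
  rintro _ ⟨y, rfl⟩
  have hr : Set.range (Spec.map (awayHom f)) =
      (specBasicOpen f : Set (Spec R)) :=
    PrimeSpectrum.localization_away_comap_range (awayRing f) f
  have hy : Spec.map (awayHom f) y ∈
      (specBasicOpen f : Set (Spec R)) := hr ▸ ⟨y, rfl⟩
  exact hfU hy

theorem finite_and_torsionFree_of_free {R : CommRingCat.{u}} {F : (Spec R).Modules} {n : ℕ}
    (e : Nonempty (F ≅ freeModule _ n)) :
    Module.Finite R Γ(F, ⊤) ∧ Module.IsTorsionFree R Γ(F, ⊤) := by
  obtain ⟨e⟩ := e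
  let l := (globalSectionsEquiv e).trans (globalSectionsFree R n).symm
  have : Module.Free R Γ(F, ⊤) := Module.Free.of_equiv l.symm
  exact ⟨Module.Finite.equiv l.symm, inferInstance⟩

variable {V : X.Modules} {R B : CommRingCat.{u}} (φ : R ⟶ B) (j : Spec R ⟶ X) (g : Spec B ⟶ X)
  [IsOpenImmersion j] [IsOpenImmersion g]

/-- Restriction of sections to a smaller chart, as a semilinear map. -/
def resTopₛₗ (h : Spec.map φ ≫ j = g) (V : X.Modules) :
    Γ(V.restrict j, ⊤) →ₛₗ[φ.hom] Γ(V.restrict g, ⊤) :=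
  { resTop φ j g h V with map_smul' := resTop_smul φ j g h V }

theorem finite_of_isVectorBundle (hV : IsVectorBundle V) : Module.Finite R Γ(V.restrict j, ⊤) := by
  let S := {f : R | ∃ n, Nonempty (V.restrict (awayChart j f) ≅ freeModule _ n)}
  let (f : S) : Module R Γ(V.restrict (awayChart j f.1), ⊤) :=
    Module.compHom _ (algebraMap R (awayRing f.1))
  have (f : S) : IsScalarTower R (awayRing f.1) Γ(V.restrict (awayChart j f.1), ⊤) :=
    IsScalarTower.of_algebraMap_smul fun _ _ => rfl
  let ρ (f : S) : Γ(V.restrict j, ⊤) →ₗ[R] Γ(V.restrict (awayChart j f.1), ⊤) :=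
    { resTop (awayHom f.1) j (awayChart j f.1) rfl V with map_smul' := resTop_smul _ _ _ _ _ }
  have (f : S) : IsLocalizedModule.Away f.1 (ρ f) := by
    have hl := isLocalization_awayHom f.1
    refine isLocalizedModule_of_semilinear (B := awayRing f.1) f.1 (ρ f) (fun t => ?_)
      (fun s hs => ?_)
    · exact exists_resTop_eq (awayHom f.1) j _ rfl f.1 hl V (hV.isIso_fromTildeΓ j) t
    · exact exists_smul_eq_zero_of_resTop_eq_zero (awayHom f.1) j _ rfl f.1 hl V
        (hV.isIso_fromTildeΓ j) s hs
  refine Module.Finite.of_localizationSpan' S (span_awayChart_free hV j)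
    (Rₚ := fun f => awayRing f.1) ρ fun f => ?_
  obtain ⟨n, e⟩ := f.2
  exact (finite_and_torsionFree_of_free e).1

theorem isTorsionFree_of_isVectorBundle (hV : IsVectorBundle V) [IsDomain R] :
    Module.IsTorsionFree R Γ(V.restrict j, ⊤) := by
  rw [Module.isTorsionFree_iff_smul_eq_zero]
  intro r s hrs
  by_contra! hne
  obtain ⟨hr, hs⟩ := hne
  have hs' := span_awayChart_free hV j
  have hle : Ideal.span {f : R | ∃ n, Nonempty (V.restrict (awayChart j f) ≅ freeModule _ n)} ≤
      (Ideal.torsionOf R Γ(V.restrict j, ⊤) s).radical := by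
    rw [Ideal.span_le]
    rintro f ⟨n, e⟩
    by_cases hf0 : f = 0
    · rw [hf0]; exact zero_mem _
    have hdom : IsDomain (awayRing f) :=
      IsLocalization.isDomain_localization (powers_le_nonZeroDivisors_of_noZeroDivisors hf0)
    have ht := (finite_and_torsionFree_of_free e).2
    have h0 : resTop (awayHom f) j (awayChart j f) rfl V s = 0 := by
      have h1 := resTop_smul (awayHom f) j _ rfl V r s
      rw [hrs, map_zero] at h1
      refine ((smul_eq_zero).1 h1.symm).resolve_left ?_
      have : Function.Injective (algebraMap R (awayRing f)) :=
        IsLocalization.injective _ (powers_le_nonZeroDivisors_of_noZeroDivisors hf0)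
      exact fun h => hr (this (h.trans (map_zero _).symm))
    obtain ⟨n, hn⟩ := exists_smul_eq_zero_of_resTop_eq_zero (awayHom f) j _ rfl f
      (isLocalization_awayHom f) V (hV.isIso_fromTildeΓ j) s h0
    exact ⟨n, by simpa using hn⟩
  rw [hs'] at hle
  have h1 : (1 : R) ∈ (Ideal.torsionOf R Γ(V.restrict j, ⊤) s).radical := hle trivial
  obtain ⟨n, hn⟩ := h1
  rw [one_pow] at hn
  exact hs (by simpa using hn)

end LocallyFree

/-! ### Gluing morphisms of sheaves of modules -/

section Gluing

variable {X : Scheme.{u}}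

/-- A morphism of sheaves of modules from a compatible family of additive maps. -/
def homOfApp {V W : X.Modules} (e : ∀ U : X.Opens, Γ(V, U) →+ Γ(W, U))
    (hsmul : ∀ (U : X.Opens) (r : Γ(X, U)) (s : Γ(V, U)), e U (r • s) = r • e U s)
    (hnat : ∀ (U U' : X.Opens) (i : U' ⟶ U) (s : Γ(V, U)),
      e U' (V.presheaf.map i.op s) = W.presheaf.map i.op (e U s)) : V ⟶ W :=
  SheafOfModules.Hom.mk <| PresheafOfModules.homMk
    (M₁ := V.val) (M₂ := W.val)
    { app := fun U => AddCommGrpCat.ofHom (e U.unop)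
      naturality := by
        intro U U' i
        ext s
        exact hnat U.unop U'.unop i.unop s }
    (fun U r s => hsmul U.unop r s)

theorem eq_of_locally_eq {ι : Type u} (W : X.Modules) (D : ι → X.Opens) (hD : ⨆ i, D i = ⊤)
    (U : X.Opens) (a b : Γ(W, U))
    (h : ∀ i, W.presheaf.map (homOfLE (inf_le_left : U ⊓ D i ≤ U)).op a =
      W.presheaf.map (homOfLE (inf_le_left : U ⊓ D i ≤ U)).op b) : a = b := by
  refine TopCat.Sheaf.eq_of_locally_eq' ⟨W.presheaf, W.isSheaf⟩ (fun i => U ⊓ D i) U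
    (fun i => homOfLE inf_le_left) ?_ a b h
  rw [← inf_iSup_eq, hD, inf_top_eq]

/-- Morphisms of sheaves of modules can be glued. -/
theorem exists_hom_of_local {ι : Type u} (V W : X.Modules) (D : ι → X.Opens) (hD : ⨆ i, D i = ⊤)
    (e : ∀ i (O : X.Opens), O ≤ D i → (Γ(V, O) →+ Γ(W, O)))
    (hnat : ∀ i (O O' : X.Opens) (h : O ≤ D i) (h' : O' ≤ O) (s : Γ(V, O)),
      e i O' (h'.trans h) (V.presheaf.map (homOfLE h').op s) =
        W.presheaf.map (homOfLE h').op (e i O h s))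
    (hsmul : ∀ i (O : X.Opens) (h : O ≤ D i) (r : Γ(X, O)) (s : Γ(V, O)),
      e i O h (r • s) = r • e i O h s)
    (hcompat : ∀ i k (O : X.Opens) (hi : O ≤ D i) (hk : O ≤ D k) (s : Γ(V, O)),
      e i O hi s = e k O hk s) :
    ∃ η : V ⟶ W, ∀ i (O : X.Opens) (h : O ≤ D i) (s : Γ(V, O)), η.app O s = e i O h s := by
  have key (U : X.Opens) (s : Γ(V, U)) : ∃ a : Γ(W, U), ∀ i,
      W.presheaf.map (homOfLE (inf_le_left : U ⊓ D i ≤ U)).op a =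
        e i (U ⊓ D i) inf_le_right
          (V.presheaf.map (homOfLE (inf_le_left : U ⊓ D i ≤ U)).op s) := by
    obtain ⟨a, ha, -⟩ := TopCat.Sheaf.existsUnique_gluing' ⟨W.presheaf, W.isSheaf⟩
      (fun i => U ⊓ D i) U (fun i => homOfLE inf_le_left)
      (by rw [← inf_iSup_eq, hD, inf_top_eq])
      (fun i => e i (U ⊓ D i) inf_le_right
          (V.presheaf.map (homOfLE (inf_le_left : U ⊓ D i ≤ U)).op s)) (by
        intro i k
        have h1 := hnat i _ _ inf_le_right (inf_le_left : (U ⊓ D i) ⊓ (U ⊓ D k) ≤ U ⊓ D i)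
          (V.presheaf.map (homOfLE (inf_le_left : U ⊓ D i ≤ U)).op s)
        have h2 := hnat k _ _ inf_le_right (inf_le_right : (U ⊓ D i) ⊓ (U ⊓ D k) ≤ U ⊓ D k)
          (V.presheaf.map (homOfLE (inf_le_left : U ⊓ D k ≤ U)).op s)
        refine h1.symm.trans (Eq.trans ?_ h2)
        rw [hcompat i k _ _ (inf_le_right.trans inf_le_right)]
        congr 1
        have e1 := V.presheaf.map_comp (homOfLE (inf_le_left : U ⊓ D i ≤ U)).op
          (homOfLE (inf_le_left : (U ⊓ D i) ⊓ (U ⊓ D k) ≤ U ⊓ D i)).op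
        have e2 := V.presheaf.map_comp (homOfLE (inf_le_left : U ⊓ D k ≤ U)).op
          (homOfLE (inf_le_right : (U ⊓ D i) ⊓ (U ⊓ D k) ≤ U ⊓ D k)).op
        exact congr($(e1.symm.trans e2) s))
    exact ⟨a, ha⟩
  choose a ha using key
  have huniq := eq_of_locally_eq W D hD
  have hmap (i) (U U' : X.Opens) (h : U' ≤ U) (b : Γ(W, U)) :
      W.presheaf.map (homOfLE (inf_le_left : U' ⊓ D i ≤ U')).op (W.presheaf.map (homOfLE h).op b) =
      W.presheaf.map (homOfLE (inf_le_inf_right (D i) h)).op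
        (W.presheaf.map (homOfLE (inf_le_left : U ⊓ D i ≤ U)).op b) := by
    have e1 := W.presheaf.map_comp (homOfLE h).op (homOfLE (inf_le_left : U' ⊓ D i ≤ U')).op
    have e2 := W.presheaf.map_comp (homOfLE (inf_le_left : U ⊓ D i ≤ U)).op
      (homOfLE (inf_le_inf_right (D i) h)).op
    exact congr($(e1.symm.trans e2) b)
  have hmap' (i) (U U' : X.Opens) (h : U' ≤ U) (b : Γ(V, U)) :
      V.presheaf.map (homOfLE (inf_le_left : U' ⊓ D i ≤ U')).op (V.presheaf.map (homOfLE h).op b) =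
      V.presheaf.map (homOfLE (inf_le_inf_right (D i) h)).op
        (V.presheaf.map (homOfLE (inf_le_left : U ⊓ D i ≤ U)).op b) := by
    have e1 := V.presheaf.map_comp (homOfLE h).op (homOfLE (inf_le_left : U' ⊓ D i ≤ U')).op
    have e2 := V.presheaf.map_comp (homOfLE (inf_le_left : U ⊓ D i ≤ U)).op
      (homOfLE (inf_le_inf_right (D i) h)).op
    exact congr($(e1.symm.trans e2) b)
  refine ⟨homOfApp (fun U => AddMonoidHom.mk' (a U) ?_) ?_ ?_, ?_⟩
  · intro s t
    apply huniq
    intro i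
    simp only [map_add, ha]
  · intro U r s
    apply huniq
    intro i
    change W.presheaf.map _ (a U (r • s)) = W.presheaf.map _ (r • a U s)
    rw [ha, Scheme.Modules.map_smul, Scheme.Modules.map_smul, ha, hsmul]
  · intro U U' i s
    apply huniq
    intro k
    change W.presheaf.map _ (a U' _) = W.presheaf.map _ (W.presheaf.map (homOfLE i.le).op (a U s))
    rw [ha, hmap, ha]
    refine Eq.trans (congrArg _ (hmap' k U U' i.le s)) ?_
    exact hnat _ _ _ _ _ _
  · intro i O h s
    apply huniq
    intro k
    refine (ha O s k).trans ?_
    rw [hcompat k i _ _ (inf_le_left.trans h), hnat i _ _ h]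

end Gluing

/-! ### Morphisms defined on a chart -/

section ChartHom

variable {X Y : Scheme.{u}} (j : Y ⟶ X) [IsOpenImmersion j] {V W : X.Modules}
  (η : V.restrict j ⟶ W.restrict j)

theorem le_image_preimage {O : X.Opens} (hO : O ≤ j.opensRange) : O ≤ j ''ᵁ (j ⁻¹ᵁ O) := by
  rw [Scheme.Hom.image_preimage_eq_opensRange_inf]
  exact le_inf hO le_rfl

/-- The action on sections over small open subsets `O` of `X` of a morphism defined on the
chart `j`. -/
def chartHom (O : X.Opens) (hO : O ≤ j.opensRange) : Γ(V, O) →+ Γ(W, O) :=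
  (V.presheaf.map (homOfLE (j.image_preimage_le O)).op ≫ (V.restrictAppIso j (j ⁻¹ᵁ O)).inv ≫
    η.app (j ⁻¹ᵁ O) ≫ (W.restrictAppIso j (j ⁻¹ᵁ O)).hom ≫
      W.presheaf.map (homOfLE (le_image_preimage j hO)).op).hom

theorem chartHom_map (P : Y.Opens) (O : X.Opens) (hO : O ≤ j.opensRange) (h : O ≤ j ''ᵁ P)
    (s : Γ(V.restrict j, P)) :
    chartHom j η O hO (V.presheaf.map (homOfLE h).op s) =
      W.presheaf.map (homOfLE h).op (η.app P s) := by
  have hP : j ⁻¹ᵁ O ≤ P := by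
    intro x hx
    obtain ⟨y, hy, hxy⟩ := h hx
    rwa [← j.injective hxy]
  have e1 := V.presheaf.map_comp (homOfLE h).op (homOfLE (j.image_preimage_le O)).op
  have e2 := W.presheaf.map_comp
    (homOfLE ((j.image_preimage_le O).trans h)).op (homOfLE (le_image_preimage j hO)).op
  have e3 := η.mapPresheaf.naturality (homOfLE hP).op
  have e4 := congr(W.presheaf.map (homOfLE (le_image_preimage j hO)).op ($e3 s))
  refine Eq.trans ?_ (e4.trans congr($(e2.symm) (η.app P s)))
  refine congrArg (fun t => W.presheaf.map (homOfLE (le_image_preimage j hO)).op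
    (η.app (j ⁻¹ᵁ O) t)) ?_
  exact congr($(e1.symm) s)

theorem chartHom_naturality (O O' : X.Opens) (h : O ≤ j.opensRange) (h' : O' ≤ O) (s : Γ(V, O)) :
    chartHom j η O' (h'.trans h) (V.presheaf.map (homOfLE h').op s) =
      W.presheaf.map (homOfLE h').op (chartHom j η O h s) := by
  have e1 := V.presheaf.map_comp (homOfLE (j.image_preimage_le O)).op
    (homOfLE (h'.trans (le_image_preimage j h))).op
  have h1 := chartHom_map j η (j ⁻¹ᵁ O) O' (h'.trans h) (h'.trans (le_image_preimage j h))
    (V.presheaf.map (homOfLE (j.image_preimage_le O)).op s)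
  have e2 := W.presheaf.map_comp (homOfLE (le_image_preimage j h)).op (homOfLE h').op
  refine Eq.trans ?_ (h1.trans ?_)
  · exact congrArg _ congr($e1 s)
  · exact congr($e2 _)

theorem chartHom_smul (O : X.Opens) (hO : O ≤ j.opensRange) (r : Γ(X, O)) (s : Γ(V, O)) :
    chartHom j η O hO (r • s) = r • chartHom j η O hO s := by
  change W.presheaf.map (homOfLE (le_image_preimage j hO)).op
    ((W.restrictAppIso j (j ⁻¹ᵁ O)).hom (η.app (j ⁻¹ᵁ O) ((V.restrictAppIso j (j ⁻¹ᵁ O)).inv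
      (V.presheaf.map (homOfLE (j.image_preimage_le O)).op (r • s))))) = _
  rw [Scheme.Modules.map_smul, Scheme.Modules.smul_restrictAppIso_inv_apply,
    Scheme.Modules.Hom.app_smul, Scheme.Modules.smul_restrictAppIso_hom_apply,
    Scheme.Modules.map_smul]
  have e1 : (j.appIso (j ⁻¹ᵁ O)).inv ((j.appIso (j ⁻¹ᵁ O)).hom
      (X.presheaf.map (homOfLE (j.image_preimage_le O)).op r)) =
      X.presheaf.map (homOfLE (j.image_preimage_le O)).op r := by
    simp
  have e2 : X.presheaf.map (homOfLE (le_image_preimage j hO)).op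
      (X.presheaf.map (homOfLE (j.image_preimage_le O)).op r) = r := by
    have h1 := X.presheaf.map_comp (homOfLE (j.image_preimage_le O)).op
      (homOfLE (le_image_preimage j hO)).op
    exact (congr($(h1.symm) r)).trans congr($(X.presheaf.map_id _) r)
  rw [e1, e2]
  rfl

theorem map_restrictFunctor_eq (θ : V ⟶ W)
    (h : ∀ (O : X.Opens) (hO : O ≤ j.opensRange) (s : Γ(V, O)), θ.app O s = chartHom j η O hO s) :
    (Scheme.Modules.restrictFunctor j).map θ = η := by
  ext P s
  have h1 := h (j ''ᵁ P) (j.image_le_opensRange P) s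
  have h2 := chartHom_map j η P (j ''ᵁ P) (j.image_le_opensRange P) le_rfl s
  have e1 := V.presheaf.map_id (.op (j ''ᵁ P))
  have e2 := W.presheaf.map_id (.op (j ''ᵁ P))
  refine h1.trans (Eq.trans ?_ (h2.trans ?_))
  · exact congrArg _ congr($e1.symm s)
  · exact congr($e2 (η.app P s))

variable {Z : Scheme.{u}} (g : Z ⟶ X) [IsOpenImmersion g] (hg : g.opensRange ≤ j.opensRange)

/-- The restriction of a morphism defined on the chart `j` to a smaller chart `g`. -/
def restrictHom : V.restrict g ⟶ W.restrict g :=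
  homOfApp (fun P => chartHom j η (g ''ᵁ P) ((g.image_le_opensRange P).trans hg))
    (fun P r s => chartHom_smul j η (g ''ᵁ P) _ ((g.appIso P).inv r) s)
    (fun P P' i s => chartHom_naturality j η (g ''ᵁ P) (g ''ᵁ P') _ (g.image_mono i.le) s)

theorem chartHom_restrictHom (O : X.Opens) (hO : O ≤ g.opensRange) (s : Γ(V, O)) :
    chartHom g (restrictHom j η g hg) O hO s = chartHom j η O (hO.trans hg) s := by
  have h1 := chartHom_naturality j η O (g ''ᵁ g ⁻¹ᵁ O) (hO.trans hg) (g.image_preimage_le O) s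
  have h2 := congrArg (W.presheaf.map (homOfLE (le_image_preimage g hO)).op) h1
  refine h2.trans ?_
  have e1 := W.presheaf.map_comp (homOfLE (g.image_preimage_le O)).op
      (homOfLE (le_image_preimage g hO)).op
  exact (congr($(e1.symm) _)).trans congr($(W.presheaf.map_id _) _)

end ChartHom

/-! ### Schemes covered by two affine charts -/

/-- A covering of the scheme `X` by two affine charts `Spec R₀` and `Spec R₁`, indexed by `Bool`,
whose intersection is an affine chart `Spec B` that is a basic open subset of both. -/
structure TwoCharts (X : Scheme.{u}) where
  /-- the coordinate rings of the two charts -/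
  R : Bool → CommRingCat.{u}
  /-- the coordinate ring of the intersection -/
  B : CommRingCat.{u}
  /-- the restriction maps to the intersection -/
  φ : ∀ b, R b ⟶ B
  /-- the inclusions of the charts -/
  j : ∀ b, Spec (R b) ⟶ X
  /-- the inclusion of the intersection -/
  g : Spec B ⟶ X
  open_j : ∀ b, IsOpenImmersion (j b)
  open_g : IsOpenImmersion g
  comp_eq : ∀ b, Spec.map (φ b) ≫ j b = g
  cover : ⨆ b, (j b).opensRange = ⊤
  inter : (j false).opensRange ⊓ (j true).opensRange ≤ g.opensRange
  /-- the functions that become invertible on the intersection -/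
  f : ∀ b, R b
  loc : ∀ b, letI := (φ b).hom.toAlgebra; IsLocalization.Away (f b) B

attribute [instance] TwoCharts.open_j TwoCharts.open_g

section SecMap

variable {X : Scheme.{u}} {R : CommRingCat.{u}} (j : Spec R ⟶ X) [IsOpenImmersion j]
  {U V W : X.Modules}

/-- The action of a morphism of sheaves of modules on the sections over a chart. -/
def secMap (η : V ⟶ W) : Γ(V.restrict j, ⊤) →ₗ[R] Γ(W.restrict j, ⊤) :=
  ((moduleSpecΓFunctor (R := R)).map ((Scheme.Modules.restrictFunctor j).map η)).hom

theorem secMap_apply (η : V ⟶ W) (s : Γ(V.restrict j, ⊤)) :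
    secMap j η s = ((Scheme.Modules.restrictFunctor j).map η).app ⊤ s := rfl

theorem secMap_id : secMap j (𝟙 V) = LinearMap.id := rfl

theorem secMap_comp (η : U ⟶ V) (θ : V ⟶ W) : secMap j (η ≫ θ) = secMap j θ ∘ₗ secMap j η := rfl

theorem secMap_add (η θ : V ⟶ W) : secMap j (η + θ) = secMap j η + secMap j θ := rfl

theorem secMap_zero : secMap j (0 : V ⟶ W) = 0 := rfl

end SecMap

theorem isIso_fromTildeΓ_restrict {X : Scheme.{u}} {R B : CommRingCat.{u}} (φ : R ⟶ B)
    (j : Spec R ⟶ X) (g : Spec B ⟶ X) [IsOpenImmersion j] [IsOpenImmersion g]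
    (h : Spec.map φ ≫ j = g) {V : X.Modules} (hV : IsIso (V.restrict j).fromTildeΓ) :
    IsIso (V.restrict g).fromTildeΓ := by
  subst h
  have : IsOpenImmersion (Spec.map φ) := IsOpenImmersion.of_comp (Spec.map φ) j
  have h1 : (V.restrict j).IsQuasicoherent := (isQuasicoherent_iff_isIso_fromTildeΓ _).2 hV
  have h2 : IsIso ((V.restrict j).restrict (Spec.map φ)).fromTildeΓ := inferInstance
  have e : V.restrict (Spec.map φ ≫ j) ≅ (V.restrict j).restrict (Spec.map φ) :=
    (Scheme.Modules.restrictFunctorComp (Spec.map φ) j).app V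
  exact isIso_fromTildeΓ_of_retract (Retract.ofIso e) h2

namespace TwoCharts

variable {X : Scheme.{u}} (T : TwoCharts X)

/-- A sheaf of modules that is quasi-coherent on both charts, with finitely generated and
torsion-free modules of sections. -/
def IsGood (V : X.Modules) : Prop :=
  ∀ b, IsIso (V.restrict (T.j b)).fromTildeΓ ∧ Module.Finite (T.R b) Γ(V.restrict (T.j b), ⊤) ∧
    Module.IsTorsionFree (T.R b) Γ(V.restrict (T.j b), ⊤)

theorem opensRange_g_le (b : Bool) : T.g.opensRange ≤ (T.j b).opensRange := by
  rintro _ ⟨x, rfl⟩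
  exact ⟨Spec.map (T.φ b) x, congr($(T.comp_eq b) x)⟩

theorem isUnit_φ_f (b : Bool) (n : ℕ) : IsUnit (T.φ b (T.f b ^ n)) := by
  let := (T.φ b).hom.toAlgebra
  have := T.loc b
  rw [map_pow]
  exact (IsLocalization.Away.algebraMap_isUnit (S := T.B) (T.f b)).pow n

variable {T}

/-- Two morphisms agree if they agree on the sections over both charts. -/
theorem hom_ext {V W : X.Modules} (hV : T.IsGood V) {η θ : V ⟶ W}
    (h : ∀ b, secMap (T.j b) η = secMap (T.j b) θ) : η = θ := by
  have h1 (b : Bool) : (Scheme.Modules.restrictFunctor (T.j b)).map η =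
      (Scheme.Modules.restrictFunctor (T.j b)).map θ :=
    hom_ext_top (hV b).1 fun s => LinearMap.congr_fun (h b) s
  ext U s
  refine eq_of_locally_eq W (fun b : ULift.{u} Bool => (T.j b.down).opensRange)
    (by rw [← T.cover]; exact Equiv.ulift.iSup_comp (g := fun b => (T.j b).opensRange)) U _ _
    fun b => ?_
  have h2 (ζ : V ⟶ W) : W.presheaf.map (homOfLE (inf_le_left : U ⊓ (T.j b.down).opensRange ≤ U)).op
      (ζ.app U s) =
      ζ.app (U ⊓ (T.j b.down).opensRange) (V.presheaf.map (homOfLE (inf_le_left)).op s) :=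
    (congr($(ζ.mapPresheaf.naturality (homOfLE (inf_le_left)).op) s) :).symm
  refine (h2 η).trans (Eq.trans ?_ (h2 θ).symm)
  have h3 : U ⊓ (T.j b.down).opensRange = T.j b.down ''ᵁ (T.j b.down ⁻¹ᵁ U) := by
    rw [Scheme.Hom.image_preimage_eq_opensRange_inf, inf_comm]
  have h4 : ∀ (O : X.Opens) (_ : O = T.j b.down ''ᵁ (T.j b.down ⁻¹ᵁ U)) (t : Γ(V, O)),
      η.app O t = θ.app O t := by
    rintro O rfl t
    exact congr(($(h1 b.down)).app (T.j b.down ⁻¹ᵁ U) t)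
  exact h4 _ h3 _

/-- A pair of linear maps on the sections over the two charts that are compatible with a linear
map on the sections over the intersection comes from a morphism of sheaves. -/
theorem exists_hom {V W : X.Modules} (hV : T.IsGood V)
    (e : ∀ b, Γ(V.restrict (T.j b), ⊤) →ₗ[T.R b] Γ(W.restrict (T.j b), ⊤))
    (eB : Γ(V.restrict T.g, ⊤) →ₗ[T.B] Γ(W.restrict T.g, ⊤))
    (h : ∀ b s, eB (resTop (T.φ b) (T.j b) T.g (T.comp_eq b) V s) =
      resTop (T.φ b) (T.j b) T.g (T.comp_eq b) W (e b s)) :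
    ∃ η : V ⟶ W, ∀ b, secMap (T.j b) η = e b := by
  choose η hη using fun b => (existsUnique_hom_of_linearMap (hV b).1 (e b)).exists
  have hg : IsIso (V.restrict T.g).fromTildeΓ :=
    isIso_fromTildeΓ_restrict _ _ _ (T.comp_eq true) (hV true).1
  have hθ (b : Bool) (s : Γ(V.restrict T.g, ⊤)) :
      (restrictHom (T.j b) (η b) T.g (T.opensRange_g_le b)).app ⊤ s = eB s := by
    let θ := ((moduleSpecΓFunctor (R := T.B)).map
      (restrictHom (T.j b) (η b) T.g (T.opensRange_g_le b))).hom
    let θ' : Γ(V.restrict T.g, ⊤) →ₗ[T.B] Γ(W.restrict T.g, ⊤) := θ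
    change θ' s = eB s
    obtain ⟨n, t, ht⟩ := exists_resTop_eq (T.φ b) (T.j b) T.g (T.comp_eq b) (T.f b) (T.loc b) V
      (hV b).1 s
    have h1 : θ' (resTop (T.φ b) (T.j b) T.g (T.comp_eq b) V t) =
        eB (resTop (T.φ b) (T.j b) T.g (T.comp_eq b) V t) := by
      rw [h, ← hη]
      exact chartHom_map (T.j b) (η b) ⊤ (T.g ''ᵁ ⊤)
        ((T.g.image_le_opensRange ⊤).trans (T.opensRange_g_le b)) (image_top_le _ _ _ (T.comp_eq
            b)) t
    rw [← ht, map_smul, map_smul] at h1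
    exact (T.isUnit_φ_f b n).smul_left_cancel.1 h1
  have hθ' : restrictHom (T.j false) (η false) T.g (T.opensRange_g_le false) =
      restrictHom (T.j true) (η true) T.g (T.opensRange_g_le true) :=
    hom_ext_top hg fun s => (hθ false s).trans (hθ true s).symm
  have hcompat (O : X.Opens) (h0 : O ≤ (T.j false).opensRange) (h1 : O ≤ (T.j true).opensRange)
      (s : Γ(V, O)) :
      chartHom (T.j false) (η false) O h0 s = chartHom (T.j true) (η true) O h1 s := by
    have hO : O ≤ T.g.opensRange := (le_inf h0 h1).trans T.inter
    rw [← chartHom_restrictHom (T.j false) (η false) T.g (T.opensRange_g_le false) O hO,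
      ← chartHom_restrictHom (T.j true) (η true) T.g (T.opensRange_g_le true) O hO, hθ']
  obtain ⟨θ, hθ⟩ := exists_hom_of_local V W (fun b : ULift.{u} Bool => (T.j b.down).opensRange)
    (by rw [← T.cover]; exact Equiv.ulift.iSup_comp (g := fun b => (T.j b).opensRange))
    (fun b O hO => chartHom (T.j b.down) (η b.down) O hO)
    (fun b O O' h h' s => chartHom_naturality _ _ O O' h h' s)
    (fun b O h r s => chartHom_smul _ _ O h r s)
    (by
      rintro ⟨_ | _⟩ ⟨_ | _⟩ O hi hk s
      · rfl
      · exact hcompat O hi hk s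
      · exact (hcompat O hk hi s).symm
      · rfl)
  refine ⟨θ, fun b => LinearMap.ext fun s => ?_⟩
  rw [secMap_apply, map_restrictFunctor_eq (T.j b) (η b) θ (fun O hO s => hθ ⟨b⟩ O hO s)]
  exact hη b s

end TwoCharts

/-! ### The coordinate rings of the charts of a conic -/

/-- A presentation of the commutative `k`-algebra `B` as `k[x, x⁻¹, y]` modulo an anisotropic
quadratic relation `y² + (l₀ + l₁ x) y + (b₀ + b₁ x + b₂ x²) = 0`. That the `x ^ i` and the
`x ^ i y`, for `i : ℤ`, form a basis of `B` over `k` is expressed by `span_eq_top` and by the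
linear form `res`, the coefficient of `y`. -/
structure ConicRing (k : Type u) [Field k] (B : Type u) [CommRing B] [Algebra k B] where
  /-- the invertible coordinate -/
  x : Bˣ
  /-- the other coordinate -/
  y : B
  /-- coefficient of `y` -/
  l₀ : k
  /-- coefficient of `x y` -/
  l₁ : k
  /-- constant coefficient -/
  b₀ : k
  /-- coefficient of `x` -/
  b₁ : k
  /-- coefficient of `x ^ 2` -/
  b₂ : k
  rel : y ^ 2 + (algebraMap k B l₀ + algebraMap k B l₁ * x) * y +
    (algebraMap k B b₀ + algebraMap k B b₁ * x + algebraMap k B b₂ * x ^ 2) = 0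
  /-- the coefficient of `y` -/
  res : B →ₗ[k] k
  res_zpow : ∀ i : ℤ, res ↑(x ^ i) = 0
  res_zpow_mul_y : ∀ i : ℤ, res (↑(x ^ i) * y) = if i = 0 then 1 else 0
  span_eq_top : Submodule.span k
    (Set.range (fun i : ℤ => (↑(x ^ i) : B)) ∪ Set.range (fun i : ℤ => (↑(x ^ i) : B) * y)) = ⊤
  anisotropic : ∀ u v t : k,
    t ^ 2 + (l₀ * u + l₁ * v) * t + (b₀ * u ^ 2 + b₁ * u * v + b₂ * v ^ 2) = 0 →
      u = 0 ∧ v = 0 ∧ t = 0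

namespace ConicRing

variable {k : Type u} [Field k] {B : Type u} [CommRing B] [Algebra k B] (D : ConicRing k B)

theorem zpow_mul_zpow (i j : ℤ) : (↑(D.x ^ i) : B) * ↑(D.x ^ j) = ↑(D.x ^ (i + j)) := by
  rw [← Units.val_mul, zpow_add]

/-- The same algebra, with the roles of the points `x = 0` and `x = ∞` exchanged. -/
def swap : ConicRing k B where
  x := D.x⁻¹
  y := ↑D.x⁻¹ * D.y
  l₀ := D.l₁
  l₁ := D.l₀
  b₀ := D.b₂
  b₁ := D.b₁
  b₂ := D.b₀
  rel := by
    have h : (D.x : B) * ↑D.x⁻¹ = 1 := D.x.mul_inv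
    linear_combination (exp := 1) (↑D.x⁻¹ ^ 2 : B) * D.rel +
      (-(algebraMap k B D.l₁) * ↑D.x⁻¹ * D.y - algebraMap k B D.b₁ * ↑D.x⁻¹ -
        algebraMap k B D.b₂ * (1 + D.x * ↑D.x⁻¹)) * h
  res := D.res ∘ₗ LinearMap.mulLeft k (D.x : B)
  res_zpow i := by
    have : (D.x : B) * ↑(D.x⁻¹ ^ i) = ↑(D.x ^ (1 - i)) := by
      rw [← Units.val_mul, inv_zpow', sub_eq_add_neg, zpow_add, zpow_one]
    rw [LinearMap.comp_apply, LinearMap.mulLeft_apply, this, D.res_zpow]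
  res_zpow_mul_y i := by
    have : (D.x : B) * (↑(D.x⁻¹ ^ i) * (↑D.x⁻¹ * D.y)) = ↑(D.x ^ (-i)) * D.y := by
      rw [inv_zpow', mul_left_comm, D.x.mul_inv_cancel_left]
    rw [LinearMap.comp_apply, LinearMap.mulLeft_apply, this, D.res_zpow_mul_y]
    simp
  span_eq_top := by
    rw [← D.span_eq_top]
    congr 2
    · refine (Equiv.neg ℤ).surjective.range_comp (fun i : ℤ => (↑(D.x ^ i) : B)) |>.symm.trans ?_
        |>.symm
      congr 1
      ext i
      simp
    · refine (((Equiv.neg ℤ).trans (Equiv.subRight 1)).surjective.range_comp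
        (fun i : ℤ => (↑(D.x ^ i) : B) * D.y)).symm.trans ?_ |>.symm
      congr 1
      ext i
      simp [sub_eq_add_neg, ← D.zpow_mul_zpow, mul_assoc]
  anisotropic u v t h := by
    obtain ⟨h1, h2, h3⟩ := D.anisotropic v u t (by linear_combination h)
    exact ⟨h2, h1, h3⟩

@[elab_as_elim]
theorem induction {P : B → Prop} (b : B) (zpow : ∀ i : ℤ, P ↑(D.x ^ i))
    (zpow_mul_y : ∀ i : ℤ, P (↑(D.x ^ i) * D.y)) (add : ∀ a b, P a → P b → P (a + b))
    (smul : ∀ (c : k) b, P b → P (c • b)) : P b := by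
  have hb : b ∈ Submodule.span k (Set.range (fun i : ℤ => (↑(D.x ^ i) : B)) ∪
      Set.range (fun i : ℤ => (↑(D.x ^ i) : B) * D.y)) := D.span_eq_top ▸ Submodule.mem_top
  induction hb using Submodule.span_induction with
  | mem b hb =>
    rcases hb with ⟨i, rfl⟩ | ⟨i, rfl⟩
    exacts [zpow i, zpow_mul_y i]
  | zero => simpa using smul 0 _ (zpow 0)
  | add a b _ _ ha hb => exact add a b ha hb
  | smul c b _ hb => exact smul c b hb

theorem zpow_mul_y_sq (i : ℤ) : (↑(D.x ^ i) : B) * D.y * D.y =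
    -(D.l₀ • (↑(D.x ^ i) * D.y) + D.l₁ • (↑(D.x ^ (i + 1)) * D.y) + D.b₀ • (↑(D.x ^ i) : B) +
      D.b₁ • (↑(D.x ^ (i + 1)) : B) + D.b₂ • (↑(D.x ^ (i + 2)) : B)) := by
  simp only [← D.zpow_mul_zpow, Algebra.smul_def, zpow_ofNat, Units.val_pow_eq_pow_val]
  linear_combination (↑(D.x ^ i) : B) * D.rel

theorem res_zpow_mul_y_sq (i : ℤ) : D.res (↑(D.x ^ i) * D.y * D.y) =
    -(if i = 0 then D.l₀ else 0) - (if i + 1 = 0 then D.l₁ else 0) := by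
  rw [zpow_mul_y_sq]
  simp only [map_neg, map_add, map_smul, D.res_zpow, D.res_zpow_mul_y, smul_eq_mul, mul_ite,
    mul_one, mul_zero, add_zero]
  ring

/-- The expansion of an element in the basis; the coefficients are residues. -/
theorem exists_expansion (b : B) : ∃ s : Finset ℤ, ∀ t, s ⊆ t → b = ∑ i ∈ t,
      ((D.res (↑(D.x ^ (-i)) * D.y * b) + D.l₀ * D.res (↑(D.x ^ (-i)) * b) +
        D.l₁ * D.res (↑(D.x ^ (1 - i)) * b)) • (↑(D.x ^ i) : B) +
        D.res (↑(D.x ^ (-i)) * b) • (↑(D.x ^ i) * D.y)) := by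
  induction b using D.induction with
  | zpow j =>
    refine ⟨{j}, fun t ht => ?_⟩
    have hc (i : ℤ) : (↑(D.x ^ (-i)) : B) * D.y * ↑(D.x ^ j) = ↑(D.x ^ (j - i)) * D.y := by
      rw [mul_right_comm, D.zpow_mul_zpow, neg_add_eq_sub]
    simp only [D.zpow_mul_zpow, D.res_zpow, hc, D.res_zpow_mul_y, sub_eq_zero]
    simp only [mul_zero, add_zero, ite_smul, one_smul, zero_smul, Finset.sum_ite_eq]
    rw [if_pos (ht (by simp))]
  | zpow_mul_y j =>
    refine ⟨{j}, fun t ht => ?_⟩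
    have hc (i : ℤ) : (↑(D.x ^ (-i)) : B) * D.y * (↑(D.x ^ j) * D.y) =
        ↑(D.x ^ (j - i)) * D.y * D.y := by
      rw [mul_mul_mul_comm, D.zpow_mul_zpow, neg_add_eq_sub, ← mul_assoc]
    simp only [← mul_assoc, D.zpow_mul_zpow, hc, D.res_zpow_mul_y_sq, D.res_zpow_mul_y]
    rw [Finset.sum_eq_single j]
    · simp
    · intro i _ hij
      have h1 : j - i ≠ 0 := sub_ne_zero.2 hij.symm
      have h2 : -i + j ≠ 0 := by omega
      have h3 : (1 - i + j = 0) ↔ (j - i + 1 = 0) := by omega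
      simp only [h1, h2, h3, if_false]
      split_ifs <;> simp
    · exact fun hj => (hj (ht (by simp))).elim
  | add a b ha hb =>
    obtain ⟨s, hs⟩ := ha
    obtain ⟨s', hs'⟩ := hb
    refine ⟨s ∪ s', fun t ht => ?_⟩
    nth_rewrite 1 [hs t (Finset.union_subset_left ht), hs' t (Finset.union_subset_right ht)]
    rw [← Finset.sum_add_distrib]
    refine Finset.sum_congr rfl fun i _ => ?_
    simp only [mul_add, map_add]
    module
  | smul c b hb =>
    obtain ⟨s, hs⟩ := hb
    refine ⟨s, fun t ht => ?_⟩
    nth_rewrite 1 [hs t ht]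
    rw [Finset.smul_sum]
    refine Finset.sum_congr rfl fun i _ => ?_
    simp only [mul_smul_comm, map_smul, smul_eq_mul]
    module

/-- An element is determined by its residues against the basis. -/
theorem eq_zero_of_res {b : B} (h : ∀ i : ℤ, D.res (↑(D.x ^ i) * b) = 0)
    (h' : ∀ i : ℤ, D.res (↑(D.x ^ i) * D.y * b) = 0) : b = 0 := by
  obtain ⟨s, hs⟩ := D.exists_expansion b
  rw [hs s subset_rfl]
  refine Finset.sum_eq_zero fun i _ => ?_
  rw [h, h, h', mul_zero, mul_zero, zero_add, zero_add, zero_smul, zero_smul, zero_add]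

/-- The coordinate ring `k[x, y]` of the affine part `x ≠ ∞` of the conic. -/
def ring : Subalgebra k B := Algebra.adjoin k {(D.x : B), D.y}

theorem x_mem : (D.x : B) ∈ D.ring := Algebra.subset_adjoin (by simp)

theorem y_mem : D.y ∈ D.ring := Algebra.subset_adjoin (by simp)

theorem zpow_mem {i : ℤ} (hi : 0 ≤ i) : (↑(D.x ^ i) : B) ∈ D.ring := by
  lift i to ℕ using hi
  simpa using D.ring.pow_mem D.x_mem i

theorem ring_le_res {b : B} (hb : b ∈ D.ring) : ∀ i : ℤ, 1 ≤ i →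
    D.res (↑(D.x ^ i) * b) = 0 ∧ D.res (↑(D.x ^ i) * D.y * b) = 0 := by
  suffices h : ∀ a : B, (∀ i : ℤ, 1 ≤ i →
      D.res (↑(D.x ^ i) * a) = 0 ∧ D.res (↑(D.x ^ i) * D.y * a) = 0) → ∀ i : ℤ, 1 ≤ i →
      D.res (↑(D.x ^ i) * (a * b)) = 0 ∧ D.res (↑(D.x ^ i) * D.y * (a * b)) = 0 by
    have := h 1 fun i hi => by
      simp only [mul_one, D.res_zpow, D.res_zpow_mul_y, true_and]
      rw [if_neg (by omega)]
    simpa using this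
  induction hb using Algebra.adjoin_induction with
  | mem b hb =>
    intro a ha i hi
    rcases hb with rfl | rfl
    · have h1 : (↑(D.x ^ i) : B) * (a * D.x) = ↑(D.x ^ (i + 1)) * a := by
        rw [← D.zpow_mul_zpow, zpow_one]; ring
      have h2 : (↑(D.x ^ i) : B) * D.y * (a * D.x) = ↑(D.x ^ (i + 1)) * D.y * a := by
        rw [← D.zpow_mul_zpow, zpow_one]; ring
      rw [h1, h2]
      exact ha _ (by omega)
    · have h1 : (↑(D.x ^ i) : B) * (a * D.y) = ↑(D.x ^ i) * D.y * a := by ring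
      have h2 : (↑(D.x ^ i) : B) * D.y * (a * D.y) = ↑(D.x ^ i) * D.y * D.y * a := by ring
      rw [h1, h2, D.zpow_mul_y_sq]
      refine ⟨(ha _ hi).2, ?_⟩
      simp [add_mul, ha i hi, ha (i + 1) (by omega), ha (i + 2) (by omega)]
  | algebraMap r =>
    intro a ha i hi
    rw [← Algebra.commutes, ← Algebra.smul_def]
    simp [ha i hi]
  | add b c _ _ hb hc =>
    intro a ha i hi
    simp [mul_add, hb a ha i hi, hc a ha i hi]
  | mul b c _ _ hb hc =>
    intro a ha i hi
    rw [← mul_assoc a b c]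
    exact hc _ (hb a ha) i hi

/-- The ring `k[x, y]` is its own orthogonal complement, up to a shift, for the residue pairing. -/
theorem mem_ring_iff {b : B} : b ∈ D.ring ↔ ∀ i : ℤ, 1 ≤ i →
    D.res (↑(D.x ^ i) * b) = 0 ∧ D.res (↑(D.x ^ i) * D.y * b) = 0 := by
  refine ⟨D.ring_le_res, fun h => ?_⟩
  obtain ⟨s, hs⟩ := D.exists_expansion b
  rw [hs s subset_rfl]
  refine sum_mem fun i _ => ?_
  rcases le_or_gt 0 i with hi | hi
  · exact add_mem (D.ring.smul_mem (D.zpow_mem hi) _)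
      (D.ring.smul_mem (mul_mem (D.zpow_mem hi) D.y_mem) _)
  · rw [(h (-i) (by omega)).1, (h (-i) (by omega)).2, (h (1 - i) (by omega)).1]
    simp [zero_mem]

theorem mem_swap_ring_iff {b : B} : b ∈ D.swap.ring ↔ (∀ i : ℤ, i ≤ 0 →
    D.res (↑(D.x ^ i) * b) = 0) ∧ ∀ i : ℤ, i < 0 → D.res (↑(D.x ^ i) * D.y * b) = 0 := by
  have h1 (i : ℤ) : (D.x : B) * (↑(D.x⁻¹ ^ i) * b) = ↑(D.x ^ (1 - i)) * b := by
    rw [← mul_assoc, ← Units.val_mul, inv_zpow', sub_eq_add_neg, zpow_add, zpow_one]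
  have h2 (i : ℤ) : (D.x : B) * (↑(D.x⁻¹ ^ i) * (↑D.x⁻¹ * D.y) * b) = ↑(D.x ^ (-i)) * D.y * b := by
    rw [inv_zpow', mul_left_comm (↑(D.x ^ (-i)) : B), mul_assoc (↑D.x⁻¹ : B),
      D.x.mul_inv_cancel_left]
  rw [mem_ring_iff]
  change (∀ i : ℤ, 1 ≤ i → D.res (D.x * (↑(D.x⁻¹ ^ i) * b)) = 0 ∧
    D.res (D.x * (↑(D.x⁻¹ ^ i) * (↑D.x⁻¹ * D.y) * b)) = 0) ↔ _
  simp only [h1, h2]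
  refine ⟨fun h => ⟨fun i hi => ?_, fun i hi => ?_⟩, fun h i hi => ⟨h.1 _ (by omega),
    h.2 _ (by omega)⟩⟩
  · simpa using (h (1 - i) (by omega)).1
  · simpa using (h (-i) (by omega)).2

theorem zpow_mem_swap {i : ℤ} (hi : i ≤ 0) : (↑(D.x ^ i) : B) ∈ D.swap.ring := by
  simpa [swap] using D.swap.zpow_mem (i := -i) (by omega)

theorem inv_mul_y_mem_swap : (↑D.x⁻¹ : B) * D.y ∈ D.swap.ring := D.swap.y_mem

theorem zpow_mul_y_mem_swap {i : ℤ} (hi : i < 0) : (↑(D.x ^ i) : B) * D.y ∈ D.swap.ring := by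
  have := mul_mem (D.zpow_mem_swap (i := i + 1) (by omega)) D.inv_mul_y_mem_swap
  rwa [← mul_assoc, ← Units.val_mul, zpow_add_one, mul_inv_cancel_right] at this

/-- The two coordinate rings intersect in the constants. -/
theorem eq_algebraMap_of_mem_of_mem {b : B} (h₀ : b ∈ D.ring) (h₁ : b ∈ D.swap.ring) :
    b = algebraMap k B (D.res (D.y * b)) := by
  rw [mem_ring_iff] at h₀
  rw [mem_swap_ring_iff] at h₁
  rw [← sub_eq_zero, Algebra.algebraMap_eq_smul_one]
  refine D.eq_zero_of_res (fun i => ?_) fun i => ?_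
  · simp only [mul_sub, map_sub, mul_smul_comm, map_smul, mul_one, D.res_zpow, smul_zero, sub_zero]
    rcases le_or_gt i 0 with hi | hi
    · exact h₁.1 i hi
    · exact (h₀ i hi).1
  · simp only [mul_sub, map_sub, mul_smul_comm, map_smul, mul_one, D.res_zpow_mul_y]
    rcases lt_trichotomy i 0 with hi | rfl | hi
    · simp [h₁.2 i hi, hi.ne]
    · simp
    · simp [(h₀ i hi).2, hi.ne']

/-- If `b ∈ k[x, y]` and `c ∈ k` are such that `x b + c y` is regular at `x = ∞`, then both
vanish. -/
theorem eq_zero_of_mul_add_mem_swap {b : B} {c : k} (h₀ : b ∈ D.ring)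
    (h₁ : D.x * b + c • D.y ∈ D.swap.ring) : b = 0 ∧ c = 0 := by
  rw [mem_ring_iff] at h₀
  rw [mem_swap_ring_iff] at h₁
  have hx (i : ℤ) : (↑(D.x ^ i) : B) * D.x = ↑(D.x ^ (i + 1)) := by
    rw [zpow_add_one, Units.val_mul]
  have hx' (i : ℤ) : (↑(D.x ^ i) : B) * D.y * (D.x * b) = ↑(D.x ^ (i + 1)) * D.y * b := by
    rw [← hx]; ring
  have h1 (i : ℤ) (hi : i ≤ 0) : D.res (↑(D.x ^ (i + 1)) * b) + c * (if i = 0 then 1 else 0) = 0 :=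
      by
    have := h₁.1 i hi
    rwa [mul_add, ← mul_assoc, hx, mul_smul_comm, map_add, map_smul, D.res_zpow_mul_y] at this
  have h2 := (h₀ 1 le_rfl).1
  rw [zpow_one] at h2
  have hc : c = 0 := by simpa [h2] using h1 0 le_rfl
  subst hc
  refine ⟨D.eq_zero_of_res (fun i => ?_) fun i => ?_, rfl⟩
  · rcases le_or_gt 1 i with hi | hi
    · exact (h₀ i hi).1
    · simpa using h1 (i - 1) (by omega)
  · rcases le_or_gt 1 i with hi | hi
    · exact (h₀ i hi).2
    · have := h₁.2 (i - 1) (by omega)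
      simpa [mul_add, hx'] using this

theorem eq_zero_of_mul_mem_swap {b : B} (h₀ : b ∈ D.ring) (h₁ : D.x * b ∈ D.swap.ring) : b = 0 :=
  (D.eq_zero_of_mul_add_mem_swap (c := 0) h₀ (by simpa using h₁)).1

end ConicRing

/-! ### Residue duality -/

namespace ConicRing

variable {k : Type u} [Field k] {B : Type u} [CommRing B] [Algebra k B] (D : ConicRing k B)

section Duality

variable {N : Type u} [AddCommGroup N] [Module k N] [Module B N] [IsScalarTower k B N]

/-- Residue duality: a linear form on a `B`-module which vanishes on `x ^ i • n` and
`x ^ i • y • n` for all but finitely many `i` is the residue of a `B`-linear form. -/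
theorem exists_res_comp_eq (μ : N →ₗ[k] k)
    (hμ : ∀ n, ∃ s : Finset ℤ, ∀ i ∉ s, μ ((↑(D.x ^ i) : B) • n) = 0 ∧
      μ (((↑(D.x ^ i) : B) * D.y) • n) = 0) :
    ∃ ψ : N →ₗ[B] B, ∀ n, D.res (ψ n) = μ n := by
  have key (n : N) : ∃ c : B, ∀ b : B, D.res (b * c) = μ (b • n) := by
    obtain ⟨s, hs⟩ := hμ n
    let d (i : ℤ) : k := μ ((↑(D.x ^ i) : B) • n)
    let e (i : ℤ) : k := μ (((↑(D.x ^ i) : B) * D.y) • n)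
    have hd (i : ℤ) (hi : i ∉ s) : d i = 0 := (hs i hi).1
    have he (i : ℤ) (hi : i ∉ s) : e i = 0 := (hs i hi).2
    let c : B := ∑ i ∈ s, (e i • (↑(D.x ^ (-i)) : B) +
      d i • ((D.l₀ • (↑(D.x ^ (-i)) : B) + D.l₁ • (↑(D.x ^ (1 - i)) : B)) + ↑(D.x ^ (-i)) * D.y))
    refine ⟨c, fun b => ?_⟩
    induction b using D.induction with
    | zpow j =>
      have : D.res (↑(D.x ^ j) * c) = ∑ i ∈ s, if i = j then d i else 0 := by
        simp only [c, Finset.mul_sum, map_sum]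
        refine Finset.sum_congr rfl fun i _ => ?_
        have : (j + -i = 0) ↔ (i = j) := by omega
        simp [mul_add, ← mul_assoc, D.zpow_mul_zpow, D.res_zpow, D.res_zpow_mul_y, this,
          -zpow_neg, -Units.val_zpow_eq_zpow_val]
      rw [this, Finset.sum_ite_eq' s j]
      split_ifs with h
      · rfl
      · exact (hd j h).symm
    | zpow_mul_y j =>
      have : D.res (↑(D.x ^ j) * D.y * c) = ∑ i ∈ s, if i = j then e i else 0 := by
        simp only [c, Finset.mul_sum, map_sum]
        refine Finset.sum_congr rfl fun i _ => ?_
        have h1 : (j + -i = 0) ↔ (i = j) := by omega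
        have h2 : (j + -i + 1 = 0) ↔ (j + (1 - i) = 0) := by omega
        have h3 (m : ℤ) : (↑(D.x ^ j) : B) * D.y * ↑(D.x ^ m) = ↑(D.x ^ (j + m)) * D.y := by
          rw [mul_right_comm, D.zpow_mul_zpow]
        simp only [mul_add, mul_smul_comm, ← mul_assoc, h3, map_add, map_smul, D.res_zpow_mul_y,
          D.res_zpow_mul_y_sq, h1, h2, smul_eq_mul]
        split_ifs <;> ring
      rw [this, Finset.sum_ite_eq' s j]
      split_ifs with h
      · rfl
      · exact (he j h).symm
    | add a b ha hb => rw [add_mul, map_add, ha, hb, add_smul, map_add]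
    | smul r b hb => rw [smul_mul_assoc, map_smul, hb, smul_assoc]; exact (μ.map_smul r _).symm
  have huniq {c c' : B} (h : ∀ b, D.res (b * c) = D.res (b * c')) : c = c' := by
    rw [← sub_eq_zero]
    exact D.eq_zero_of_res (fun i => by rw [mul_sub, map_sub, h, sub_self])
      (fun i => by rw [mul_sub, map_sub, h, sub_self])
  choose ψ hψ using key
  refine ⟨{ toFun := ψ, map_add' := fun m n => huniq fun b => ?_,
            map_smul' := fun a n => huniq fun b => ?_ }, fun n => ?_⟩
  · rw [mul_add, map_add, hψ, hψ, hψ, smul_add, map_add]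
  · rw [RingHom.id_apply, smul_eq_mul, ← mul_assoc, hψ, hψ, smul_smul]
  · change D.res (ψ n) = _
    simpa using hψ n 1

/-- A lattice over `k[x, y]` in a `B`-module, given as a `k`-subspace: it is stable under `x` and
`y`, and absorbs every element after multiplication by a power of `x`. Finite generation is not
part of the definition. -/
structure IsLattice (M : Submodule k N) : Prop where
  x_smul : ∀ m ∈ M, (D.x : B) • m ∈ M
  y_smul : ∀ m ∈ M, D.y • m ∈ M
  absorb : ∀ n : N, ∃ i : ℕ, (↑(D.x ^ i) : B) • n ∈ M

variable {D}

theorem IsLattice.smul_mem {M : Submodule k N} (h : D.IsLattice M) {r : B} (hr : r ∈ D.ring)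
    {m : N} (hm : m ∈ M) : r • m ∈ M := by
  induction hr using Algebra.adjoin_induction generalizing m with
  | mem r hr =>
    rcases hr with rfl | rfl
    exacts [h.x_smul m hm, h.y_smul m hm]
  | algebraMap r => rw [algebraMap_smul]; exact M.smul_mem r hm
  | add r s _ _ hr hs => rw [add_smul]; exact add_mem (hr hm) (hs hm)
  | mul r s _ _ hr hs => rw [mul_smul]; exact hr (hs hm)

theorem IsLattice.exists_forall {M : Submodule k N} (h : D.IsLattice M) (n : N) :
    ∃ i₀ : ℤ, ∀ i, i₀ ≤ i → (↑(D.x ^ i) : B) • n ∈ M := by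
  obtain ⟨i₀, hi₀⟩ := h.absorb n
  refine ⟨i₀, fun i hi => ?_⟩
  have := h.smul_mem (D.zpow_mem (i := i - i₀) (by omega)) hi₀
  rwa [smul_smul, ← zpow_natCast, D.zpow_mul_zpow, sub_add_cancel] at this

theorem IsLattice.exists_forall_swap {M : Submodule k N} (h : D.swap.IsLattice M) (n : N) :
    ∃ i₀ : ℤ, ∀ i, i ≤ i₀ → (↑(D.x ^ i) : B) • n ∈ M := by
  obtain ⟨i₀, hi₀⟩ := h.exists_forall n
  refine ⟨-i₀, fun i hi => ?_⟩
  simpa [swap] using hi₀ (-i) (by omega)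

/-- A linear form that vanishes on `x M₀` and on `M₁` is the residue of a `B`-linear form. -/
theorem exists_res_comp_eq_of_lattice {M₀ M₁ : Submodule k N} (h₀ : D.IsLattice M₀)
    (h₁ : D.swap.IsLattice M₁) (μ : N →ₗ[k] k) (hμ₀ : ∀ m ∈ M₀, μ ((D.x : B) • m) = 0)
    (hμ₁ : ∀ m ∈ M₁, μ m = 0) :
    ∃ ψ : N →ₗ[B] B, ∀ n, D.res (ψ n) = μ n := by
  refine D.exists_res_comp_eq μ fun n => ?_
  obtain ⟨i₁, hi₁⟩ := h₀.exists_forall n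
  obtain ⟨i₂, hi₂⟩ := h₀.exists_forall (D.y • n)
  obtain ⟨i₃, hi₃⟩ := h₁.exists_forall_swap n
  obtain ⟨i₄, hi₄⟩ := h₁.exists_forall_swap (D.y • n)
  have hx (i : ℤ) (n : N) : (↑(D.x ^ i) : B) • n = (D.x : B) • (↑(D.x ^ (i - 1)) : B) • n := by
    rw [smul_smul, ← Units.val_mul, mul_comm, zpow_sub_one, inv_mul_cancel_right]
  refine ⟨Finset.Icc (min i₃ i₄) (max i₁ i₂ + 1), fun i hi => ?_⟩
  rw [Finset.mem_Icc, not_and_or, not_le, not_le] at hi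
  rw [mul_smul]
  rcases hi with hi | hi
  · exact ⟨hμ₁ _ (hi₃ i (by omega)), hμ₁ _ (hi₄ i (by omega))⟩
  · rw [hx, hx i (D.y • n)]
    exact ⟨hμ₀ _ (hi₁ _ (by omega)), hμ₀ _ (hi₂ _ (by omega))⟩

theorem mem_ring_of_res {M₀ : Submodule k N} (h₀ : D.IsLattice M₀) {μ : N →ₗ[k] k}
    (hμ₀ : ∀ m ∈ M₀, μ ((D.x : B) • m) = 0) {ψ : N →ₗ[B] B} (hψ : ∀ n, D.res (ψ n) = μ n)
    {m : N} (hm : m ∈ M₀) : ψ m ∈ D.ring := by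
  have hx (i : ℤ) (n : N) : (↑(D.x ^ i) : B) • n = (D.x : B) • (↑(D.x ^ (i - 1)) : B) • n := by
    rw [smul_smul, ← Units.val_mul, mul_comm, zpow_sub_one, inv_mul_cancel_right]
  rw [mem_ring_iff]
  intro i hi
  rw [mul_assoc, ← smul_eq_mul, ← smul_eq_mul, ← smul_eq_mul, ← map_smul, ← map_smul, ← map_smul,
    hψ, hψ, hx, hx i (D.y • m)]
  exact ⟨hμ₀ _ (h₀.smul_mem (D.zpow_mem (by omega)) hm),
    hμ₀ _ (h₀.smul_mem (D.zpow_mem (by omega)) (h₀.y_smul _ hm))⟩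

theorem mem_swap_ring_of_res {M₁ : Submodule k N} (h₁ : D.swap.IsLattice M₁) {μ : N →ₗ[k] k}
    (hμ₁ : ∀ m ∈ M₁, μ m = 0) {ψ : N →ₗ[B] B} (hψ : ∀ n, D.res (ψ n) = μ n)
    {m : N} (hm : m ∈ M₁) : ψ m ∈ D.swap.ring := by
  rw [mem_swap_ring_iff]
  refine ⟨fun i hi => ?_, fun i hi => ?_⟩ <;> rw [← smul_eq_mul, ← map_smul, hψ]
  · exact hμ₁ _ (h₁.smul_mem (D.zpow_mem_swap hi) hm)
  · exact hμ₁ _ (h₁.smul_mem (D.zpow_mul_y_mem_swap hi) hm)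

end Duality

end ConicRing

/-! ### Retractions onto subbundles of rank one and two -/

namespace ConicRing

variable {k : Type u} [Field k] {B : Type u} [CommRing B] [Algebra k B] {D : ConicRing k B}
variable {N : Type u} [AddCommGroup N] [Module k N] [Module B N] [IsScalarTower k B N]

/-- A section `s` splits off as a trivial line bundle if the class of `y s` in `N / (x M₀ + M₁)`
does not vanish. -/
theorem exists_projection_of_notMem {M₀ M₁ : Submodule k N} (h₀ : D.IsLattice M₀)
    (h₁ : D.swap.IsLattice M₁) {s : N} (hs₀ : s ∈ M₀) (hs₁ : s ∈ M₁)
    (hs : ∀ m₀ ∈ M₀, ∀ m₁ ∈ M₁, D.y • s ≠ (D.x : B) • m₀ + m₁) :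
    ∃ ψ : N →ₗ[B] B, ψ s = 1 ∧ (∀ m ∈ M₀, ψ m • s ∈ M₀) ∧ ∀ m ∈ M₁, ψ m • s ∈ M₁ := by
  let P : Submodule k N := M₀.map (LinearMap.lsmul B N (D.x : B) |>.restrictScalars k) ⊔ M₁
  have hP : D.y • s ∉ P := by
    intro h
    obtain ⟨_, ⟨m₀, hm₀, rfl⟩, m₁, hm₁, h⟩ := Submodule.mem_sup.1 h
    exact hs m₀ hm₀ m₁ hm₁ h.symm
  obtain ⟨ν, hν, hPν⟩ := P.exists_le_ker_of_notMem hP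
  let μ : N →ₗ[k] k := (ν (D.y • s))⁻¹ • ν
  have hμ : μ (D.y • s) = 1 := inv_mul_cancel₀ hν
  have hμP {n : N} (hn : n ∈ P) : μ n = 0 := by
    have : ν n = 0 := hPν hn
    simp [μ, this]
  have hμ₀ (m : N) (hm : m ∈ M₀) : μ ((D.x : B) • m) = 0 :=
    hμP (Submodule.mem_sup_left ⟨m, hm, rfl⟩)
  have hμ₁ (m : N) (hm : m ∈ M₁) : μ m = 0 := hμP (Submodule.mem_sup_right hm)
  obtain ⟨ψ, hψ⟩ := exists_res_comp_eq_of_lattice h₀ h₁ μ hμ₀ hμ₁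
  refine ⟨ψ, ?_, fun m hm => h₀.smul_mem (mem_ring_of_res h₀ hμ₀ hψ hm) hs₀,
    fun m hm => h₁.smul_mem (mem_swap_ring_of_res h₁ hμ₁ hψ hm) hs₁⟩
  rw [D.eq_algebraMap_of_mem_of_mem (mem_ring_of_res h₀ hμ₀ hψ hs₀)
    (mem_swap_ring_of_res h₁ hμ₁ hψ hs₁), ← smul_eq_mul, ← map_smul, hψ, hμ, map_one]

/-- The rank two bundle spanned by `s, e` over `k[x, y]` and by `s, x e + y s` over
`k[x⁻¹, x⁻¹ y]` has a quaternion division algebra of endomorphisms; so a nonzero morphism from it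
has no kernel. The hypothesis `hrel` says that the global section
`y e - l₁ y s - b₂ x s + α e + β (x e + y s) + γ s` is in the kernel. -/
theorem eq_zero_of_relation {M₀ M₁ : Submodule k N} (h₀ : D.IsLattice M₀)
    (h₁ : D.swap.IsLattice M₁) (h : ∀ m ∈ M₀, (D.x : B) • m ∈ M₁ → m = 0) {s e : N}
    (hs₀ : s ∈ M₀) (hs₁ : s ∈ M₁) (he : e ∈ M₀) (hf : (D.x : B) • e + D.y • s ∈ M₁) (α β γ : k)
    (hrel : D.y • e - D.l₁ • D.y • s - D.b₂ • (D.x : B) • s + α • e +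
      β • ((D.x : B) • e + D.y • s) + γ • s = 0) : s = 0 := by
  have hx : (D.x : B) * ↑D.x⁻¹ = 1 := D.x.mul_inv
  have hrel' : (D.y + algebraMap k B α + algebraMap k B β * D.x) • e +
      (algebraMap k B (β - D.l₁) * D.y - algebraMap k B D.b₂ * D.x + algebraMap k B γ) • s = 0 := by
    rw [← hrel]
    simp only [← algebraMap_smul (R := k) B]
    rw [map_sub]
    module
  -- the image of the other generator under the corresponding endomorphism
  let p : B := algebraMap k B D.b₂ * D.y + algebraMap k B (β - D.l₁) *
    (algebraMap k B D.l₁ * D.y + algebraMap k B D.b₁ + algebraMap k B D.b₂ * D.x) -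
      algebraMap k B ((α - D.l₀) * D.b₂)
  let r : B := algebraMap k B D.b₂ * D.x - algebraMap k B (β - D.l₁) * (D.y + algebraMap k B D.l₀) +
    algebraMap k B ((α - D.l₀) * D.l₁ + γ + D.b₁)
  have hzero : p • s + r • e = 0 := by
    refine h _ (add_mem (h₀.smul_mem ?_ hs₀) (h₀.smul_mem ?_ he)) ?_
    · exact sub_mem (add_mem (mul_mem (algebraMap_mem _ _) D.y_mem) (mul_mem (algebraMap_mem _ _)
        (add_mem (add_mem (mul_mem (algebraMap_mem _ _) D.y_mem) (algebraMap_mem _ _))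
          (mul_mem (algebraMap_mem _ _) D.x_mem)))) (algebraMap_mem _ _)
    · exact add_mem (sub_mem (mul_mem (algebraMap_mem _ _) D.x_mem) (mul_mem (algebraMap_mem _ _)
        (add_mem D.y_mem (algebraMap_mem _ _)))) (algebraMap_mem _ _)
    · let z : B := ↑D.x⁻¹ * D.y
      let c₁ : B := algebraMap k B (-(β - D.l₁) * D.b₀) + algebraMap k B D.b₀ * z +
        algebraMap k B (α - D.l₀) *
          (algebraMap k B D.l₀ * z + algebraMap k B D.b₀ * ↑D.x⁻¹ + algebraMap k B D.b₁)
      let c₂ : B := algebraMap k B (α - D.l₀) * z - algebraMap k B D.b₀ * ↑D.x⁻¹ +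
        algebraMap k B (-(β - D.l₁) * D.l₀ + (α - D.l₀) * D.l₁ + γ)
      have hz : z ∈ D.swap.ring := D.inv_mul_y_mem_swap
      have hw : (↑D.x⁻¹ : B) ∈ D.swap.ring := D.swap.x_mem
      have hc₁ : c₁ ∈ D.swap.ring := add_mem (add_mem (algebraMap_mem _ _)
        (mul_mem (algebraMap_mem _ _) hz)) (mul_mem (algebraMap_mem _ _) (add_mem (add_mem
          (mul_mem (algebraMap_mem _ _) hz) (mul_mem (algebraMap_mem _ _) hw))
            (algebraMap_mem _ _)))
      have hc₂ : c₂ ∈ D.swap.ring := add_mem (sub_mem (mul_mem (algebraMap_mem _ _) hz)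
        (mul_mem (algebraMap_mem _ _) hw)) (algebraMap_mem _ _)
      have e₁ : D.x * p + D.y * (algebraMap k B (β - D.l₁) * D.y - algebraMap k B D.b₂ * D.x +
          algebraMap k B γ) = c₁ + c₂ * D.y := by
        simp only [p, c₁, c₂, z, map_add, map_sub, map_mul, map_neg]
        linear_combination (algebraMap k B β - algebraMap k B D.l₁ -
          (algebraMap k B α - algebraMap k B D.l₀) * ↑D.x⁻¹) * D.rel +
          (algebraMap k B α - algebraMap k B D.l₀) * (algebraMap k B D.l₁ * D.y +
            algebraMap k B D.b₁ + algebraMap k B D.b₂ * D.x) * hx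
      have e₂ : D.x * r + D.y * (D.y + algebraMap k B α + algebraMap k B β * D.x) = c₂ * D.x := by
        simp only [r, c₂, z, map_add, map_sub, map_mul, map_neg]
        linear_combination D.rel +
          ((algebraMap k B D.l₀ - algebraMap k B α) * D.y + algebraMap k B D.b₀) * hx
      have : (D.x : B) • (p • s + r • e) = c₁ • s + c₂ • ((D.x : B) • e + D.y • s) := by
        have h3 : (c₁ + c₂ * D.y) • s + (c₂ * D.x) • e =
            c₁ • s + c₂ • ((D.x : B) • e + D.y • s) := by module
        rw [← h3, ← e₁, ← e₂, ← sub_eq_zero, ← smul_zero (-D.y), ← hrel']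
        module
      rw [this]
      exact add_mem (h₁.smul_mem hc₁ hs₁) (h₁.smul_mem hc₂ hf)
  -- the determinant of the endomorphism is a constant, and nonzero by anisotropy
  let n : k := γ * (-(β - D.l₁) * D.l₀ + (α - D.l₀) * D.l₁ + γ + D.b₁) -
    α * ((β - D.l₁) * D.b₁ - (α - D.l₀) * D.b₂) +
      D.b₀ * ((β - D.l₁) ^ 2 + D.b₂ + (β - D.l₁) * D.l₁)
  have hdet : r * (algebraMap k B (β - D.l₁) * D.y - algebraMap k B D.b₂ * D.x +
      algebraMap k B γ) - (D.y + algebraMap k B α + algebraMap k B β * D.x) * p =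
        algebraMap k B n := by
    simp only [p, r, n, map_add, map_sub, map_mul, map_neg, map_pow]
    linear_combination (-(algebraMap k B β - algebraMap k B D.l₁) ^ 2 - algebraMap k B D.b₂ -
      (algebraMap k B β - algebraMap k B D.l₁) * algebraMap k B D.l₁) * D.rel
  have hn : n ≠ 0 := by
    intro hn
    let c : k := D.l₀ - α
    let d : k := γ + D.b₁ - c * β
    let m : k := c ^ 2 - D.l₀ * c + D.b₀
    have h1 := D.anisotropic d (-m) (m * β + d * (c - D.l₀)) (by
      trans m * n
      · simp only [m, d, c, n]; ring
      · rw [hn, mul_zero])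
    have hm : c ^ 2 - D.l₀ * c + D.b₀ = 0 := neg_eq_zero.1 h1.2.1
    have h2 := D.anisotropic (-1) 0 c (by linear_combination hm)
    exact one_ne_zero (neg_eq_zero.1 h2.1)
  have hns : algebraMap k B n • s = 0 := by
    rw [← hdet]
    have := congrArg₂ (fun a b => r • a - (D.y + algebraMap k B α + algebraMap k B β * D.x) • b)
      hrel' hzero
    simp only [smul_zero, sub_zero] at this
    rw [← this]
    module
  rw [algebraMap_smul] at hns
  exact (smul_eq_zero.1 hns).resolve_left hn

/-- If the class of `y s` in `N / (x M₀ + M₁)` vanishes, the section `s` is part of a rank two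
direct summand, spanned by `s, e` over `k[x, y]` and by `s, x e + y s` over `k[x⁻¹, x⁻¹ y]`, which
is an extension of a line bundle of degree two by the trivial one. The retraction `(ψ₂, ψ₃)` is
found by duality for pairs of linear forms; that the required pair exists comes down to
`eq_zero_of_relation`. -/
theorem exists_projection_of_mem {M₀ M₁ : Submodule k N} (h₀ : D.IsLattice M₀)
    (h₁ : D.swap.IsLattice M₁) (h : ∀ m ∈ M₀, (D.x : B) • m ∈ M₁ → m = 0) {s e : N}
    (hs : s ≠ 0) (hs₀ : s ∈ M₀) (hs₁ : s ∈ M₁) (he : e ∈ M₀) (hf : (D.x : B) • e + D.y • s ∈ M₁) :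
    ∃ ψ₂ ψ₃ : N →ₗ[B] B, ψ₂ s = 1 ∧ ψ₃ s = 0 ∧ ψ₂ e = 0 ∧ ψ₃ e = 1 ∧
      (∀ m ∈ M₀, ψ₂ m • s + ψ₃ m • e ∈ M₀) ∧ ∀ m ∈ M₁, ψ₂ m • s + ψ₃ m • e ∈ M₁ := by
  have hx : (D.x : B) * ↑D.x⁻¹ = 1 := D.x.mul_inv
  have hx' : (↑D.x⁻¹ : B) * D.x = 1 := D.x.inv_mul
  set w : B := ↑D.x⁻¹ with hw
  have hwz (m : N) (hm : m ∈ M₁) : w • m ∈ M₁ := h₁.x_smul m hm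
  have hzz (m : N) (hm : m ∈ M₁) : (w * D.y) • m ∈ M₁ := h₁.y_smul m hm
  let X : N →ₗ[k] N := (LinearMap.lsmul B N (D.x : B)).restrictScalars k
  let W : N →ₗ[k] N := (LinearMap.lsmul B N w).restrictScalars k
  let Z : N →ₗ[k] N := (LinearMap.lsmul B N (w * D.y)).restrictScalars k
  -- the pairs of linear forms vanishing on `P` are the residues of the morphisms to the rank two
  -- bundle that send `s` to a multiple of itself
  let P : Submodule k (N × N) := (M₀.map X).prod (M₀.map X) ⊔
    (M₁.map (LinearMap.prod LinearMap.id (-Z)) ⊔ (M₁.map W).map (LinearMap.inr k N N)) ⊔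
    Submodule.span k {(0, s), (0, D.y • s), (0, (w * D.y) • s)}
  have hP : (D.y • s, (0 : N)) ∉ P := by
    intro hmem
    obtain ⟨_, h1, c, hc, hsum⟩ := Submodule.mem_sup.1 hmem
    obtain ⟨⟨_, _⟩, ⟨⟨m, hm, rfl⟩, ⟨m', hm', rfl⟩⟩, _, h2, rfl⟩ := Submodule.mem_sup.1 h1
    obtain ⟨_, ⟨n, hn, rfl⟩, _, ⟨_, ⟨n', hn', rfl⟩, rfl⟩, rfl⟩ := Submodule.mem_sup.1 h2
    obtain ⟨γ, β, α, rfl⟩ := Submodule.mem_span_triple.1 hc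
    have E₁ : (D.x : B) • m + n = D.y • s := by simpa [X, W, Z] using congrArg Prod.fst hsum
    have E₂ : (D.x : B) • m' + (-((w * D.y) • n) + w • n') +
        (γ • s + (β • D.y • s + α • (w * D.y) • s)) = 0 := by
      simpa [X, W, Z, add_assoc] using congrArg Prod.snd hsum
    -- the first equation determines `m` and `n`
    have hme : m + e = 0 := by
      refine h _ (add_mem hm he) ?_
      have : (D.x : B) • (m + e) = ((D.x : B) • e + D.y • s) - n := by rw [← E₁]; module
      rw [this]
      exact sub_mem hf hn
    obtain rfl : m = -e := eq_neg_of_add_eq_zero_left hme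
    obtain rfl : n = (D.x : B) • e + D.y • s := by rw [← E₁]; module
    have E₃ : (D.x : B) • ((D.x : B) • m') + n' + (γ • (D.x : B) • s + β • (D.x : B) • D.y • s +
        α • D.y • s) = D.y • ((D.x : B) • e + D.y • s) := by
      have : (D.x : B) • ((D.x : B) • m') + n' + (γ • (D.x : B) • s + β • (D.x : B) • D.y • s +
          α • D.y • s) - D.y • ((D.x : B) • e + D.y • s) =
          (D.x : B) • ((D.x : B) • m' + (-((w * D.y) • ((D.x : B) • e + D.y • s)) + w • n') +
            (γ • s + (β • D.y • s + α • (w * D.y) • s))) +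
          (1 - D.x * w) • (n' - D.y • ((D.x : B) • e + D.y • s) + α • D.y • s) := by
        simp only [← algebraMap_smul (R := k) B]
        module
      rw [← sub_eq_zero, this, E₂, hx, sub_self, zero_smul, smul_zero, add_zero]
    have hfM₀ : (D.x : B) • e + D.y • s ∈ M₀ := add_mem (h₀.x_smul _ he) (h₀.y_smul _ hs₀)
    have hg (c : B) : (c * D.y ^ 2) • s = -((D.l₀ • (c * D.y) + D.l₁ • (c * D.x * D.y) +
        D.b₀ • c + D.b₁ • (c * D.x) + D.b₂ • (c * D.x ^ 2)) • s) := by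
      rw [← neg_smul]
      congr 1
      simp only [Algebra.smul_def]
      linear_combination c * D.rel
    have hQ : D.y • e + (α + D.l₀) • e - D.l₁ • D.y • s - D.b₂ • (D.x : B) • s -
        (D.b₁ + γ) • s - β • ((D.x : B) • e + D.y • s) + β • (D.x : B) • e - (D.x : B) • m' = 0 :=
            by
      refine h _ ?_ ?_
      · exact sub_mem (add_mem (sub_mem (sub_mem (sub_mem (sub_mem (add_mem (h₀.y_smul _ he)
          (M₀.smul_mem _ he)) (M₀.smul_mem _ (h₀.y_smul _ hs₀)))
          (M₀.smul_mem _ (h₀.x_smul _ hs₀))) (M₀.smul_mem _ hs₀)) (M₀.smul_mem _ hfM₀))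
          (M₀.smul_mem _ (h₀.x_smul _ he))) (h₀.x_smul _ hm')
      · have : n' + (α + D.l₀) • ((D.x : B) • e + D.y • s) + D.b₀ • s ∈ M₁ :=
          add_mem (add_mem hn' (M₁.smul_mem _ hf)) (M₁.smul_mem _ hs₁)
        convert this using 1
        have hg1 := hg 1
        rw [← sub_eq_zero] at hg1 E₃ ⊢
        rw [← neg_zero, ← E₃, ← sub_eq_zero, ← neg_zero, ← hg1]
        simp only [← algebraMap_smul (R := k) B, Algebra.smul_def]
        simp only [map_add]
        module
    have heM₁ : e ∈ M₁ := by
      have : e = w • ((D.x : B) • e + D.y • s) - (w * D.y) • s := by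
        rw [smul_add, smul_smul, hx', smul_smul, one_smul, add_sub_cancel_right]
      rw [this]
      exact sub_mem (hwz _ hf) (hzz _ hs₁)
    have hgM₁ : D.y • e - D.l₁ • D.y • s - D.b₂ • (D.x : B) • s ∈ M₁ := by
      have : D.y • e - D.l₁ • D.y • s - D.b₂ • (D.x : B) • s =
          (w * D.y) • ((D.x : B) • e + D.y • s) + D.l₀ • (w * D.y) • s + D.b₀ • w • s +
            D.b₁ • s := by
        have h3 : (w * D.y) • ((D.x : B) • e + D.y • s) = (w * D.x) • (D.y • e) +
            (w * D.y ^ 2) • s := by module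
        have h4 : w * D.x ^ 2 = D.x := by rw [pow_two, ← mul_assoc, hx', one_mul]
        rw [h3, hg w, h4, hx']
        simp only [← algebraMap_smul (R := k) B, Algebra.smul_def]
        module
      rw [this]
      exact add_mem (add_mem (add_mem (hzz _ hf) (M₁.smul_mem _ (hzz _ hs₁)))
        (M₁.smul_mem _ (hwz _ hs₁))) (M₁.smul_mem _ hs₁)
    have hrel : D.y • e - D.l₁ • D.y • s - D.b₂ • (D.x : B) • s + (α + D.l₀) • e +
        (-β) • ((D.x : B) • e + D.y • s) + (-(D.b₁ + γ)) • s = (D.x : B) • (m' - β • e) := by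
      rw [← sub_eq_zero, ← hQ]
      simp only [← algebraMap_smul (R := k) B]
      simp only [map_add, map_neg]
      module
    have hm'e : m' - β • e = 0 := by
      refine h _ (sub_mem hm' (M₀.smul_mem _ he)) ?_
      rw [← hrel]
      exact add_mem (add_mem (add_mem hgM₁ (M₁.smul_mem _ heM₁)) (M₁.smul_mem _ hf))
        (M₁.smul_mem _ hs₁)
    rw [hm'e, smul_zero] at hrel
    exact hs (eq_zero_of_relation h₀ h₁ h hs₀ hs₁ he hf _ _ _ hrel)
  obtain ⟨ν, hν, hPν⟩ := P.exists_le_ker_of_notMem hP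
  let μ : N × N →ₗ[k] k := (ν (D.y • s, 0))⁻¹ • ν
  have hμ : μ (D.y • s, 0) = 1 := inv_mul_cancel₀ hν
  have hμP {n : N × N} (hn : n ∈ P) : μ n = 0 := by
    have : ν n = 0 := hPν hn
    simp [μ, this]
  let μ₂ : N →ₗ[k] k := μ ∘ₗ LinearMap.inl k N N
  let μ₃ : N →ₗ[k] k := μ ∘ₗ LinearMap.inr k N N
  have hμ₂ (m : N) (hm : m ∈ M₀) : μ₂ ((D.x : B) • m) = 0 :=
    hμP (Submodule.mem_sup_left (Submodule.mem_sup_left ⟨⟨m, hm, rfl⟩, zero_mem _⟩))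
  have hμ₃ (m : N) (hm : m ∈ M₀) : μ₃ ((D.x : B) • m) = 0 :=
    hμP (Submodule.mem_sup_left (Submodule.mem_sup_left ⟨zero_mem _, ⟨m, hm, rfl⟩⟩))
  have hμ₃' (m : N) (hm : m ∈ M₁) : μ₃ (w • m) = 0 :=
    hμP (Submodule.mem_sup_left (Submodule.mem_sup_right (Submodule.mem_sup_right
      ⟨_, ⟨m, hm, rfl⟩, rfl⟩)))
  have hμ₂₃ (m : N) (hm : m ∈ M₁) : μ₂ m - μ₃ ((w * D.y) • m) = 0 := by
    have : μ (m, -((w * D.y) • m)) = 0 :=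
      hμP (Submodule.mem_sup_left (Submodule.mem_sup_right (Submodule.mem_sup_left ⟨m, hm, rfl⟩)))
    have h3 : ((m, -((w * D.y) • m)) : N × N) =
        LinearMap.inl k N N m - LinearMap.inr k N N ((w * D.y) • m) := by simp
    rwa [h3, map_sub] at this
  have hμ₂' (m : N) (hm : m ∈ M₁) : μ₂ (w • m) = 0 := by
    have := hμ₂₃ _ (hwz m hm)
    rwa [smul_comm, hμ₃' _ (hzz m hm), sub_zero] at this
  have hμs : μ₃ s = 0 := hμP (Submodule.mem_sup_right (Submodule.subset_span (by simp)))
  have hμys : μ₃ (D.y • s) = 0 := hμP (Submodule.mem_sup_right (Submodule.subset_span (by simp)))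
  have hμzs : μ₃ ((w * D.y) • s) = 0 :=
    hμP (Submodule.mem_sup_right (Submodule.subset_span (by simp)))
  have h₁' : D.swap.IsLattice (M₁.map W) := by
    refine ⟨?_, ?_, fun n => ?_⟩
    · rintro _ ⟨m, hm, rfl⟩
      exact ⟨w • m, hwz m hm, rfl⟩
    · rintro _ ⟨m, hm, rfl⟩
      exact ⟨(w * D.y) • m, hzz m hm, smul_comm _ _ _⟩
    · obtain ⟨i, hi⟩ := h₁.absorb ((D.x : B) • n)
      refine ⟨i, _, hi, ?_⟩
      change w • _ • (D.x : B) • n = _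
      rw [smul_comm w, smul_smul w, hx', one_smul]
  have hW {μ' : N →ₗ[k] k} (hμ' : ∀ m ∈ M₁, μ' (w • m) = 0) : ∀ m ∈ M₁.map W, μ' m = 0 := by
    rintro _ ⟨m, hm, rfl⟩
    exact hμ' m hm
  obtain ⟨ψ₂, hψ₂⟩ := exists_res_comp_eq_of_lattice h₀ h₁' μ₂ hμ₂ (hW hμ₂')
  obtain ⟨ψ₃, hψ₃⟩ := exists_res_comp_eq_of_lattice h₀ h₁' μ₃ hμ₃ (hW hμ₃')
  have hψ₂₀ {m : N} (hm : m ∈ M₀) : ψ₂ m ∈ D.ring := mem_ring_of_res h₀ hμ₂ hψ₂ hm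
  have hψ₃₀ {m : N} (hm : m ∈ M₀) : ψ₃ m ∈ D.ring := mem_ring_of_res h₀ hμ₃ hψ₃ hm
  have hψ₃₁ {m : N} (hm : m ∈ M₁) : w * ψ₃ m ∈ D.swap.ring := by
    rw [← smul_eq_mul, ← map_smul]
    exact mem_swap_ring_of_res h₁' (hW hμ₃') hψ₃ ⟨m, hm, rfl⟩
  have hψ₂₁ {m : N} (hm : m ∈ M₁) : ψ₂ m - w * D.y * ψ₃ m ∈ D.swap.ring := by
    refine mem_swap_ring_of_res (μ := μ₂ - μ₃ ∘ₗ Z) (ψ := ψ₂ - (w * D.y) • ψ₃) h₁ hμ₂₃ (fun n =>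
        ?_) hm
    change D.res (ψ₂ n - (w * D.y) * ψ₃ n) = μ₂ n - μ₃ ((w * D.y) • n)
    rw [map_sub, ← hψ₂, ← hψ₃, map_smul, smul_eq_mul]
  -- the residues of the multiples of `ψ₃ s` that duality leaves open are those in the span in `P`
  have h₃s : ψ₃ s = 0 := by
    have h3 := D.mem_ring_iff.1 (hψ₃₀ hs₀)
    have h4 := D.mem_swap_ring_iff.1 (hψ₃₁ hs₁)
    have hxw (i : ℤ) : (↑(D.x ^ i) : B) * w = ↑(D.x ^ (i - 1)) := by
      rw [zpow_sub_one, Units.val_mul]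
    refine D.eq_zero_of_res (fun i => ?_) fun i => ?_
    · rcases lt_trichotomy i 0 with hi | rfl | hi
      · have := h4.1 (i + 1) (by omega)
        rwa [← mul_assoc, hxw, add_sub_cancel_right] at this
      · simpa [hψ₃] using hμs
      · exact (h3 i hi).1
    · have hxw' : (↑(D.x ^ i) : B) * D.y * ψ₃ s = ↑(D.x ^ (i + 1)) * D.y * (w * ψ₃ s) := by
        rw [zpow_add_one, Units.val_mul]
        linear_combination (-(↑(D.x ^ i) : B) * D.y * ψ₃ s) * hx
      rcases lt_trichotomy i (-1) with hi | rfl | hi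
      · rw [hxw']
        exact h4.2 _ (by omega)
      · rw [← smul_eq_mul, ← map_smul, hψ₃]
        simpa using hμzs
      · rcases (Int.add_one_le_iff.2 hi).eq_or_lt with rfl | hi
        · rw [← smul_eq_mul, ← map_smul, hψ₃]
          simpa using hμys
        · exact (h3 i (by omega)).2
  have h₂s : ψ₂ s = 1 := by
    have h3 := hψ₂₁ hs₁
    rw [h₃s, mul_zero, sub_zero] at h3
    rw [D.eq_algebraMap_of_mem_of_mem (hψ₂₀ hs₀) h3, ← smul_eq_mul, ← map_smul, hψ₂]
    exact (congrArg (algebraMap k B) hμ).trans (map_one _)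
  obtain ⟨c, hc⟩ : ∃ c : k, ψ₃ e = algebraMap k B c := by
    have h3 := hψ₃₁ hf
    rw [map_add, map_smul, map_smul, h₃s, smul_zero, add_zero, smul_eq_mul, ← mul_assoc, hx',
      one_mul] at h3
    exact ⟨_, D.eq_algebraMap_of_mem_of_mem (hψ₃₀ he) h3⟩
  have h3 := hψ₂₁ hf
  simp only [map_add, map_smul, h₃s, h₂s, smul_eq_mul, mul_zero, add_zero, mul_one, hc] at h3
  have h4 : (D.x : B) * ψ₂ e + (1 - c) • D.y ∈ D.swap.ring := by
    convert h3 using 1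
    rw [Algebra.smul_def, map_sub, map_one]
    linear_combination D.y * algebraMap k B c * hx'
  obtain ⟨h5, h6⟩ := D.eq_zero_of_mul_add_mem_swap (hψ₂₀ he) h4
  refine ⟨ψ₂, ψ₃, h₂s, h₃s, h5, ?_, fun m hm => ?_, fun m hm => ?_⟩
  · rw [hc, ← sub_eq_zero.1 h6, map_one]
  · exact add_mem (h₀.smul_mem (hψ₂₀ hm) hs₀) (h₀.smul_mem (hψ₃₀ hm) he)
  · have : ψ₂ m • s + ψ₃ m • e = (ψ₂ m - w * D.y * ψ₃ m) • s +
        (w * ψ₃ m) • ((D.x : B) • e + D.y • s) := by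
      have : (w * ψ₃ m) • (D.x : B) • e = ψ₃ m • e := by
        rw [smul_smul, mul_right_comm, hx', one_mul]
      rw [smul_add, this]
      module
    rw [this]
    exact add_mem (h₁.smul_mem (hψ₂₁ hm) hs₁) (h₁.smul_mem (hψ₃₁ hm) hf)

end ConicRing

/-! ### Idempotent endomorphisms of bundles of rank at least three -/

namespace ConicRing

variable {k : Type u} [Field k] {B : Type u} [CommRing B] [Algebra k B] {D : ConicRing k B}
variable {N : Type u} [AddCommGroup N] [Module k N] [Module B N]

/-- The powers of `x` are the denominators needed for elements of `B` over `k[x, y]`. -/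
theorem mem_ring_of_le (b : B) : ∃ i₀ : ℤ, ∀ i, i₀ ≤ i → ↑(D.x ^ i) * b ∈ D.ring := by
  have h : D.IsLattice (Subalgebra.toSubmodule D.ring) := by
    refine ⟨fun m hm => D.ring.mul_mem D.x_mem hm, fun m hm => D.ring.mul_mem D.y_mem hm, fun n =>
        ?_⟩
    have key : ∃ i₀ : ℕ, ∀ i : ℕ, i₀ ≤ i → (↑(D.x ^ i) : B) * n ∈ D.ring := by
      induction n using D.induction with
      | zpow j =>
        refine ⟨(-j).toNat, fun i hi => ?_⟩
        rw [← zpow_natCast, D.zpow_mul_zpow]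
        exact D.zpow_mem (by omega)
      | zpow_mul_y j =>
        refine ⟨(-j).toNat, fun i hi => ?_⟩
        rw [← zpow_natCast, ← mul_assoc, D.zpow_mul_zpow]
        exact mul_mem (D.zpow_mem (by omega)) D.y_mem
      | add a b ha hb =>
        obtain ⟨i, hi⟩ := ha
        obtain ⟨j, hj⟩ := hb
        refine ⟨max i j, fun l hl => ?_⟩
        rw [mul_add]
        exact add_mem (hi l (by omega)) (hj l (by omega))
      | smul c b hb =>
        obtain ⟨i, hi⟩ := hb
        refine ⟨i, fun l hl => ?_⟩
        rw [mul_smul_comm]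
        exact D.ring.smul_mem (hi l hl) c
    obtain ⟨i, hi⟩ := key
    exact ⟨i, hi i le_rfl⟩
  exact h.exists_forall b

theorem mem_swap_ring_of_le (b : B) : ∃ i₀ : ℤ, ∀ i, i ≤ i₀ → ↑(D.x ^ i) * b ∈ D.swap.ring := by
  obtain ⟨i₀, hi₀⟩ := mem_ring_of_le (D := D.swap) b
  refine ⟨-i₀, fun i hi => ?_⟩
  simpa [swap] using hi₀ (-i) (by omega)

/-- Negative twists of a bundle have no global sections. -/
theorem exists_twist_eq_zero {M₀ M₁ : Submodule k N} {ι κ : Type*} [Finite ι] [Finite κ]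
    (v : Module.Basis ι B N) (hv : ∀ m ∈ M₀, ∀ i, v.repr m i ∈ D.ring)
    (v' : Module.Basis κ B N) (hv' : ∀ m ∈ M₁, ∀ i, v'.repr m i ∈ D.swap.ring) :
    ∃ d₀ : ℤ, ∀ d, d₀ ≤ d → ∀ m ∈ M₀, (↑(D.x ^ d) : B) • m ∈ M₁ → m = 0 := by
  cases nonempty_fintype ι
  cases nonempty_fintype κ
  choose e he using fun p : κ × ι => mem_swap_ring_of_le (D := D) (v.repr (v' p.1) p.2)
  obtain ⟨e₀, he₀⟩ := Finite.bddBelow_range e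
  refine ⟨1 - e₀, fun d hd m hm hmd => v.ext_elem fun i => ?_⟩
  rw [map_zero, Finsupp.zero_apply]
  have h1 : v.repr ((↑(D.x ^ d) : B) • m) i =
      ∑ j, v'.repr ((↑(D.x ^ d) : B) • m) j * v.repr (v' j) i := by
    conv_lhs => rw [← v'.sum_repr ((↑(D.x ^ d) : B) • m)]
    simp
  rw [map_smul, Finsupp.smul_apply, smul_eq_mul] at h1
  refine D.eq_zero_of_mul_mem_swap (hv m hm i) ?_
  have h2 : (D.x : B) * v.repr m i =
      ∑ j, v'.repr ((↑(D.x ^ d) : B) • m) j * (↑(D.x ^ (1 - d)) * v.repr (v' j) i) := by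
    simp only [mul_left_comm _ (↑(D.x ^ (1 - d)) : B)]
    rw [← Finset.mul_sum, ← h1, ← mul_assoc, D.zpow_mul_zpow, sub_add_cancel, zpow_one]
  rw [h2]
  refine sum_mem fun j _ => mul_mem (hv' _ hmd j) (he (j, i) _ ?_)
  have : e₀ ≤ e (j, i) := he₀ ⟨_, rfl⟩
  omega

/-- A bundle of rank at least three is decomposable: it has a nontrivial idempotent
endomorphism. -/
theorem exists_idempotent [IsScalarTower k B N] [Nontrivial B] {M₀ M₁ : Submodule k N}
    (h₀ : D.IsLattice M₀)
    (h₁ : D.swap.IsLattice M₁) {ι κ : Type*} [Finite ι] [Finite κ]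
    (v : Module.Basis ι B N) (hv : ∀ m ∈ M₀, ∀ i, v.repr m i ∈ D.ring)
    (v' : Module.Basis κ B N) (hv' : ∀ m ∈ M₁, ∀ i, v'.repr m i ∈ D.swap.ring)
    (hN : 2 < Module.finrank B N) :
    ∃ e : N →ₗ[B] N, e ∘ₗ e = e ∧ e ≠ 0 ∧ e ≠ LinearMap.id ∧ (∀ m ∈ M₀, e m ∈ M₀) ∧
      ∀ m ∈ M₁, e m ∈ M₁ := by
  have hxx (i j : ℤ) (n : N) : (↑(D.x ^ i) : B) • (↑(D.x ^ j) : B) • n = (↑(D.x ^ (i + j)) : B) • n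
      := by
    rw [smul_smul, D.zpow_mul_zpow]
  have hx0 (i : ℤ) {n : N} (h : (↑(D.x ^ i) : B) • n = 0) : n = 0 :=
    (D.x ^ i).isUnit.smul_eq_zero.1 h
  have : Nontrivial N := Module.nontrivial_of_finrank_pos (R := B) (by omega)
  obtain ⟨d₀, hd₀⟩ := exists_twist_eq_zero v hv v' hv'
  -- the largest twist for which there is a global section
  obtain ⟨d, ⟨s, hs₀, hs₁, hs⟩, hd⟩ : ∃ d : ℤ, (∃ s ∈ M₀, (↑(D.x ^ d) : B) • s ∈ M₁ ∧ s ≠ 0) ∧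
      ∀ d', (∃ s ∈ M₀, (↑(D.x ^ d') : B) • s ∈ M₁ ∧ s ≠ 0) → d' ≤ d := by
    refine Int.exists_greatest_of_bdd ⟨d₀, fun d ⟨s, h1, h2, h3⟩ => ?_⟩ ?_
    · by_contra h
      exact h3 (hd₀ d (by omega) s h1 h2)
    · obtain ⟨n, hn⟩ := exists_ne (0 : N)
      obtain ⟨i, hi⟩ := h₀.exists_forall n
      obtain ⟨j, hj⟩ := h₁.exists_forall_swap n
      refine ⟨j - i, _, hi i le_rfl, ?_, fun h => hn (hx0 _ h)⟩
      rw [hxx, sub_add_cancel]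
      exact hj j le_rfl
  -- `M₀` and `M` are the lattices of the bundle twisted by this multiple of the point `x = ∞`
  let M : Submodule k N := M₁.comap ((LinearMap.lsmul B N (↑(D.x ^ d) : B)).restrictScalars k)
  have hM {n : N} : n ∈ M ↔ (↑(D.x ^ d) : B) • n ∈ M₁ := Iff.rfl
  have hML : D.swap.IsLattice M := by
    refine ⟨fun m hm => ?_, fun m hm => ?_, fun n => ?_⟩
    · rw [hM, smul_comm]
      exact h₁.x_smul _ hm
    · rw [hM, smul_comm]
      exact h₁.y_smul _ hm
    · obtain ⟨i, hi⟩ := h₁.absorb ((↑(D.x ^ d) : B) • n)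
      exact ⟨i, by rwa [hM, smul_comm]⟩
  have hM0 (m : N) (hm : m ∈ M₀) (h : (D.x : B) • m ∈ M) : m = 0 := by
    by_contra hm'
    have := hd (d + 1) ⟨m, hm, by
      rwa [hM, smul_smul, ← Units.val_mul, ← zpow_add_one] at h, hm'⟩
    omega
  have hMM {e : N →ₗ[B] N} (he : ∀ m ∈ M, e m ∈ M) : ∀ m ∈ M₁, e m ∈ M₁ := by
    intro m hm
    have h1 : (↑(D.x ^ (-d)) : B) • m ∈ M := by
      rw [hM, hxx, add_neg_cancel]
      simpa using hm
    have h2 := he _ h1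
    rw [hM, map_smul, hxx, add_neg_cancel] at h2
    simpa using h2
  have hrank {e : N →ₗ[B] N} (s t : N) (h : ∀ n, ∃ a b : B, e n = a • s + b • t) :
      e ≠ LinearMap.id := by
    rintro rfl
    have h1 : Submodule.span B (↑({s, t} : Set N)) = ⊤ := by
      refine eq_top_iff.2 fun n _ => Submodule.mem_span_pair.2 ?_
      obtain ⟨a, b, hab⟩ := h n
      exact ⟨a, b, hab.symm⟩
    classical
    have h2 := finrank_span_finset_le_card (R := B) ({s, t} : Finset N)
    rw [Set.finrank, Finset.coe_pair, h1, finrank_top] at h2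
    exact absurd (h2.trans Finset.card_le_two) (by omega)
  by_cases hys : ∃ m₀ ∈ M₀, ∃ m₁ ∈ M, D.y • s = (D.x : B) • m₀ + m₁
  · obtain ⟨m₀, hm₀, m₁, hm₁, hys⟩ := hys
    obtain ⟨ψ₂, ψ₃, h2s, h3s, h2e, h3e, hψ₀, hψ₁⟩ := exists_projection_of_mem h₀ hML hM0 hs hs₀ hs₁
      (M₀.neg_mem hm₀) (by rwa [hys, smul_neg, neg_add_cancel_left])
    refine ⟨ψ₂.smulRight s + ψ₃.smulRight (-m₀), ?_, fun h => hs ?_, hrank s (-m₀) fun n =>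
      ⟨ψ₂ n, ψ₃ n, rfl⟩, hψ₀, hMM hψ₁⟩
    · ext n
      simp only [LinearMap.comp_apply, LinearMap.add_apply, LinearMap.smulRight_apply, map_add,
        map_smul, h2s, h3s, h2e, h3e]
      simp
    · simpa [h2s, h3s] using LinearMap.congr_fun h s
  · push Not at hys
    obtain ⟨ψ, h1, hψ₀, hψ₁⟩ := exists_projection_of_notMem h₀ hML hs₀ hs₁ hys
    refine ⟨ψ.smulRight s, ?_, fun h => hs ?_, hrank s 0 fun n => ⟨ψ n, 0, by simp⟩, hψ₀, hMM hψ₁⟩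
    · ext n
      simp [h1]
    · simpa [h1] using LinearMap.congr_fun h s

end ConicRing

/-! ### The coordinate rings of the charts are principal ideal rings -/

namespace ConicRing

variable {k : Type u} [Field k] {B : Type u} [CommRing B] [Algebra k B] (D : ConicRing k B)

/-- Every function regular at `x = ∞` is congruent to some `α + β x⁻¹ y` modulo the maximal ideal
generated by `x⁻¹`. -/
theorem exists_leading {b : B} (hb : b ∈ D.swap.ring) :
    ∃ α β : k, D.x * (b - (algebraMap k B α + algebraMap k B β * (↑D.x⁻¹ * D.y))) ∈
      D.swap.ring := by
  have hw : (↑D.x⁻¹ : B) ∈ D.swap.ring := D.swap.x_mem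
  have hz : (↑D.x⁻¹ : B) * D.y ∈ D.swap.ring := D.inv_mul_y_mem_swap
  have hxw : (D.x : B) * ↑D.x⁻¹ = 1 := D.x.mul_inv
  induction hb using Algebra.adjoin_induction with
  | mem b hb =>
    rcases hb with rfl | rfl
    · refine ⟨0, 0, ?_⟩
      simp [swap, one_mem]
    · refine ⟨0, 1, ?_⟩
      simp [swap, zero_mem]
  | algebraMap r => exact ⟨r, 0, by simp [zero_mem]⟩
  | add a b _ _ ha hb =>
    obtain ⟨α, β, h⟩ := ha
    obtain ⟨α', β', h'⟩ := hb
    refine ⟨α + α', β + β', ?_⟩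
    convert add_mem h h' using 1
    simp only [map_add]
    ring
  | mul a b ha' hb' ha hb =>
    obtain ⟨α, β, h⟩ := ha
    obtain ⟨α', β', h'⟩ := hb
    refine ⟨α * α' - β * β' * D.b₂, α * β' + β * α' - β * β' * D.l₁, ?_⟩
    set z : B := ↑D.x⁻¹ * D.y with hzdef
    have hrel : z ^ 2 + algebraMap k B D.l₁ * z + algebraMap k B D.b₂ =
        -(↑D.x⁻¹ * (algebraMap k B D.l₀ * z + algebraMap k B D.b₀ * ↑D.x⁻¹ +
          algebraMap k B D.b₁)) := by
      linear_combination (exp := 1) (↑D.x⁻¹ ^ 2 : B) * D.rel +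
        (-(algebraMap k B D.l₁) * z - algebraMap k B D.b₁ * ↑D.x⁻¹ -
        algebraMap k B D.b₂ * (1 + D.x * ↑D.x⁻¹)) * hxw
    have h1 := add_mem (add_mem (mul_mem h hb') (mul_mem (add_mem (algebraMap_mem _ α)
      (mul_mem (algebraMap_mem _ β) hz)) h')) (mul_mem (algebraMap_mem D.swap.ring (-(β * β')))
        (add_mem (add_mem (mul_mem (algebraMap_mem _ D.l₀) hz) (mul_mem (algebraMap_mem _ D.b₀) hw))
          (algebraMap_mem _ D.b₁)))
    convert h1 using 1
    simp only [map_add, map_sub, map_mul, map_neg]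
    linear_combination (algebraMap k B β * algebraMap k B β' * D.x) * hrel +
      (-algebraMap k B β * algebraMap k B β' * (algebraMap k B D.l₀ * z +
        algebraMap k B D.b₀ * ↑D.x⁻¹ + algebraMap k B D.b₁)) * hxw

theorem zpow_mul_mem_swap_of_le {i j : ℤ} (hij : i ≤ j) {b : B}
    (hb : ↑(D.x ^ j) * b ∈ D.swap.ring) : ↑(D.x ^ i) * b ∈ D.swap.ring := by
  have := mul_mem (D.zpow_mem_swap (i := i - j) (by omega)) hb
  rwa [← mul_assoc, D.zpow_mul_zpow, sub_add_cancel] at this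

/-- A nonzero function has a well-defined order at `x = ∞`. -/
theorem exists_order {b : B} (hb : b ≠ 0) : ∃ d : ℤ, ↑(D.x ^ d) * b ∈ D.swap.ring ∧
    ¬ ↑(D.x ^ (d + 1)) * b ∈ D.swap.ring := by
  obtain ⟨i₀, hi₀⟩ := mem_ring_of_le (D := D) b
  obtain ⟨j₀, hj₀⟩ := mem_swap_ring_of_le (D := D) b
  have hbdd (d : ℤ) (hd : ↑(D.x ^ d) * b ∈ D.swap.ring) : d ≤ i₀ := by
    by_contra hlt
    have h1 : (D.x : B) * (↑(D.x ^ i₀) * b) ∈ D.swap.ring := by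
      rw [← mul_assoc, ← Units.val_mul, ← zpow_one_add, add_comm]
      exact D.zpow_mul_mem_swap_of_le (by omega) hd
    exact hb ((D.x ^ i₀).isUnit.mul_right_eq_zero.1 (D.eq_zero_of_mul_mem_swap (hi₀ _ le_rfl) h1))
  obtain ⟨d, hd, hmax⟩ := Int.exists_greatest_of_bdd
    (P := fun d : ℤ => ↑(D.x ^ d) * b ∈ D.swap.ring) ⟨i₀, hbdd⟩ ⟨j₀, hj₀ j₀ le_rfl⟩
  refine ⟨d, hd, fun h => ?_⟩
  have := hmax _ h
  omega

theorem nontrivial (D : ConicRing k B) : Nontrivial B := by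
  refine ⟨1, 0, fun h => ?_⟩
  have h3 := D.res_zpow_mul_y 0
  rw [← one_mul D.y, h, zero_mul, mul_zero, map_zero, if_pos rfl] at h3
  exact zero_ne_one h3

/-- By anisotropy the residue ring at `x = ∞` is a field. -/
theorem exists_inverse_leading {a : B} (ha : a ∈ D.swap.ring) (ha' : ¬ D.x * a ∈ D.swap.ring) :
    ∃ c ∈ D.swap.ring, D.x * (a * c - 1) ∈ D.swap.ring := by
  have hxw : (D.x : B) * ↑D.x⁻¹ = 1 := D.x.mul_inv
  obtain ⟨α, β, h⟩ := D.exists_leading ha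
  set z : B := ↑D.x⁻¹ * D.y with hzdef
  have hz : z ∈ D.swap.ring := D.inv_mul_y_mem_swap
  have hw : (↑D.x⁻¹ : B) ∈ D.swap.ring := D.swap.x_mem
  let n : k := α ^ 2 - D.l₁ * (α * β) + D.b₂ * β ^ 2
  have hn : n ≠ 0 := by
    intro h0
    obtain ⟨-, h1, h2⟩ := D.anisotropic 0 (-β) α (by linear_combination h0)
    rw [neg_eq_zero.1 h1, h2] at h
    simp only [map_zero, zero_mul, add_zero, sub_zero] at h
    exact ha' h
  have hrel : z ^ 2 + algebraMap k B D.l₁ * z + algebraMap k B D.b₂ =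
      -(↑D.x⁻¹ * (algebraMap k B D.l₀ * z + algebraMap k B D.b₀ * ↑D.x⁻¹ +
        algebraMap k B D.b₁)) := by
    linear_combination (exp := 1) (↑D.x⁻¹ ^ 2 : B) * D.rel +
      (-(algebraMap k B D.l₁) * z - algebraMap k B D.b₁ * ↑D.x⁻¹ -
      algebraMap k B D.b₂ * (1 + D.x * ↑D.x⁻¹)) * hxw
  -- the conjugate of the leading term
  let c : B := algebraMap k B (α - D.l₁ * β) - algebraMap k B β * z
  have hc : c ∈ D.swap.ring := sub_mem (algebraMap_mem _ _) (mul_mem (algebraMap_mem _ _) hz)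
  have hcn : D.x * (a * c - algebraMap k B n) ∈ D.swap.ring := by
    have h1 := add_mem (mul_mem h hc) (mul_mem (algebraMap_mem D.swap.ring (β ^ 2))
        (add_mem (add_mem (mul_mem (algebraMap_mem _ D.l₀) hz) (mul_mem (algebraMap_mem _ D.b₀) hw))
          (algebraMap_mem _ D.b₁)))
    convert h1 using 1
    simp only [n, c, map_add, map_sub, map_mul, map_pow]
    linear_combination (-algebraMap k B β ^ 2 * D.x) * hrel +
      (algebraMap k B β ^ 2 * (algebraMap k B D.l₀ * z +
        algebraMap k B D.b₀ * ↑D.x⁻¹ + algebraMap k B D.b₁)) * hxw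
  refine ⟨c * algebraMap k B n⁻¹, mul_mem hc (algebraMap_mem _ _), ?_⟩
  convert mul_mem hcn (algebraMap_mem D.swap.ring n⁻¹) using 1
  have h3 : algebraMap k B n * algebraMap k B n⁻¹ = 1 := by
    rw [← map_mul, mul_inv_cancel₀ hn, map_one]
  linear_combination (D.x : B) * h3

/-- The order at `x = ∞` is additive. -/
theorem isDomain (D : ConicRing k B) : IsDomain B := by
  have := D.nontrivial
  refine @NoZeroDivisors.to_isDomain B _ _ ⟨fun {a b} hab => ?_⟩
  by_contra! hne
  obtain ⟨d, hd, hd'⟩ := D.exists_order hne.1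
  obtain ⟨e, he, he'⟩ := D.exists_order hne.2
  have hx (i : ℤ) (c : B) : (↑(D.x ^ (i + 1)) : B) * c = D.x * (↑(D.x ^ i) * c) := by
    rw [← mul_assoc, ← Units.val_mul, ← zpow_one_add, add_comm]
  obtain ⟨c, hc, hcn⟩ := D.exists_inverse_leading hd (by rwa [← hx])
  refine he' ?_
  rw [hx]
  convert mul_mem (neg_mem hcn) he using 1
  linear_combination (D.x * ↑(D.x ^ d) * c * ↑(D.x ^ e)) * hab

theorem exists_leading_div {a b : B} (ha : a ∈ D.swap.ring) (ha' : ¬ D.x * a ∈ D.swap.ring)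
    (hb : b ∈ D.swap.ring) : ∃ α β : k,
      D.x * (b - (algebraMap k B α + algebraMap k B β * (↑D.x⁻¹ * D.y)) * a) ∈ D.swap.ring := by
  obtain ⟨c, hc, hcn⟩ := D.exists_inverse_leading ha ha'
  obtain ⟨α, β, h⟩ := D.exists_leading (mul_mem hb hc)
  refine ⟨α, β, ?_⟩
  convert sub_mem (mul_mem ha h) (mul_mem hb hcn) using 1
  ring

theorem coeff_eq_zero {c₀ c₁ c₂ : k}
    (h : algebraMap k B c₀ + algebraMap k B c₁ * D.x + algebraMap k B c₂ * D.y = 0) :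
    c₀ = 0 ∧ c₁ = 0 ∧ c₂ = 0 := by
  have := D.nontrivial
  have h1 : D.x * algebraMap k B c₁ + c₂ • D.y ∈ D.swap.ring := by
    convert neg_mem (algebraMap_mem D.swap.ring c₀) using 1
    rw [Algebra.smul_def]
    linear_combination h
  obtain ⟨h2, rfl⟩ := D.eq_zero_of_mul_add_mem_swap (algebraMap_mem _ _) h1
  rw [h2, map_zero, zero_mul, zero_mul, add_zero, add_zero] at h
  exact ⟨(map_eq_zero _).1 h, (map_eq_zero _).1 h2, rfl⟩

/-- `k`-subspaces of `k[x, y]` stable under `x` and `y` are principal ideals: a nonzero element of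
smallest pole order at `x = ∞` is a generator. The only obstruction would be a pair of elements of
this order with different leading terms, and such a pair gives a rational point of the conic. -/
theorem exists_generator (J : Submodule k B) (hJ : ∀ b ∈ J, b ∈ D.ring)
    (hJx : ∀ b ∈ J, D.x * b ∈ J) (hJy : ∀ b ∈ J, D.y * b ∈ J) :
    ∃ a ∈ J, ∀ b ∈ J, ∃ r ∈ D.ring, b = r * a := by
  have hxw : (D.x : B) * ↑D.x⁻¹ = 1 := D.x.mul_inv
  have := D.isDomain
  by_cases hne : J = ⊥
  · exact ⟨0, zero_mem _, fun b hb => ⟨0, zero_mem _, by simpa [hne] using hb⟩⟩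
  obtain ⟨b₀, hb₀, hb₀'⟩ := J.ne_bot_iff.1 hne
  have hex (b : B) : ∃ n : ℕ, ↑(D.x ^ (-(n : ℤ))) * b ∈ D.swap.ring := by
    obtain ⟨i, hi⟩ := mem_swap_ring_of_le (D := D) b
    exact ⟨(-i).toNat, hi _ (by omega)⟩
  obtain ⟨n, ⟨a, haJ, ha0, ha⟩, hmin⟩ : ∃ n : ℕ, (∃ a ∈ J, a ≠ 0 ∧
      ↑(D.x ^ (-(n : ℤ))) * a ∈ D.swap.ring) ∧ ∀ b ∈ J, D.x * (↑(D.x ^ (-(n : ℤ))) * b) ∈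
        D.swap.ring → b = 0 := by
    classical
    have h : ∃ n : ℕ, ∃ a ∈ J, a ≠ 0 ∧ ↑(D.x ^ (-(n : ℤ))) * a ∈ D.swap.ring := by
      obtain ⟨n, hn⟩ := hex b₀
      exact ⟨n, b₀, hb₀, hb₀', hn⟩
    refine ⟨Nat.find h, Nat.find_spec h, fun b hb hb' => ?_⟩
    rw [← mul_assoc, ← Units.val_mul, ← zpow_one_add] at hb'
    by_contra hb0
    rcases Nat.eq_zero_or_pos (Nat.find h) with h0 | hpos
    · rw [h0, Nat.cast_zero, neg_zero, add_zero, zpow_one] at hb'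
      exact hb0 (D.eq_zero_of_mul_mem_swap (hJ b hb) hb')
    · refine Nat.find_min h (Nat.sub_lt hpos one_pos) ⟨b, hb, hb0, ?_⟩
      convert hb' using 4
      omega
  set X : B := ↑(D.x ^ (-(n : ℤ)))
  set z : B := ↑D.x⁻¹ * D.y with hzdef
  have hz : z ∈ D.swap.ring := D.inv_mul_y_mem_swap
  have hw : (↑D.x⁻¹ : B) ∈ D.swap.ring := D.swap.x_mem
  have ha' : ¬ D.x * (X * a) ∈ D.swap.ring := fun h => ha0 (hmin a haJ h)
  have hJk (c : k) {b : B} (hb : b ∈ J) : algebraMap k B c * b ∈ J := by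
    rw [← Algebra.smul_def]; exact J.smul_mem c hb
  -- elements of the smallest order are multiples of `a`
  have hbase (f : B) (hf : f ∈ J) (hfn : X * f ∈ D.swap.ring) : ∃ r ∈ D.ring, f = r * a := by
    obtain ⟨α, β, h⟩ := D.exists_leading_div ha ha' hfn
    by_cases hβ : β = 0
    · refine ⟨algebraMap k B α, algebraMap_mem _ _, sub_eq_zero.1 (hmin _ (sub_mem hf
        (hJk α haJ)) ?_)⟩
      rw [hβ, map_zero, zero_mul, add_zero] at h
      convert h using 2
      ring
    exfalso
    obtain ⟨g, hg, hgn, hga⟩ : ∃ g ∈ J, X * g ∈ D.swap.ring ∧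
        D.x * (X * g - z * (X * a)) ∈ D.swap.ring := by
      have h3 : algebraMap k B β * algebraMap k B β⁻¹ = 1 := by
        rw [← map_mul, mul_inv_cancel₀ hβ, map_one]
      refine ⟨algebraMap k B β⁻¹ * (f - algebraMap k B α * a), hJk _ (sub_mem hf (hJk _ haJ)), ?_,
          ?_⟩
      · convert mul_mem (algebraMap_mem D.swap.ring β⁻¹)
          (sub_mem hfn (mul_mem (algebraMap_mem _ α) ha)) using 1
        ring
      · convert mul_mem (algebraMap_mem D.swap.ring β⁻¹) h using 1
        linear_combination ((D.x : B) * z * X * a) * h3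
    have hspan (m : B) (hm : m ∈ J) (hmn : X * m ∈ D.swap.ring) : ∃ γ δ : k,
        m = algebraMap k B γ * a + algebraMap k B δ * g := by
      obtain ⟨γ, δ, h⟩ := D.exists_leading_div ha ha' hmn
      refine ⟨γ, δ, sub_eq_zero.1 (hmin _ (sub_mem hm (add_mem (hJk γ haJ) (hJk δ hg))) ?_)⟩
      convert sub_mem h (mul_mem (algebraMap_mem D.swap.ring δ) hga) using 1
      ring
    obtain ⟨γ, δ, h1⟩ := hspan (D.x * g - D.y * a) (sub_mem (hJx _ hg) (hJy _ haJ)) (by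
      convert hga using 1
      linear_combination (X * D.y * a) * hxw)
    obtain ⟨γ', δ', h2⟩ := hspan (D.y * g + algebraMap k B D.l₁ * (D.y * a) +
        algebraMap k B D.b₂ * (D.x * a)) (add_mem (add_mem (hJy _ hg) (hJk _ (hJy _ haJ)))
          (hJk _ (hJx _ haJ))) (by
      convert sub_mem (mul_mem hz hga) (mul_mem (add_mem (add_mem (mul_mem
        (algebraMap_mem D.swap.ring D.l₀) hz) (mul_mem (algebraMap_mem _ D.b₀) hw))
          (algebraMap_mem _ D.b₁)) ha) using 1
      have hrel : z * D.y + algebraMap k B D.l₁ * D.y + algebraMap k B D.b₂ * D.x =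
          -(algebraMap k B D.l₀ * z + algebraMap k B D.b₀ * ↑D.x⁻¹ + algebraMap k B D.b₁) := by
        linear_combination (exp := 1) (↑D.x⁻¹ : B) * D.rel -
          (algebraMap k B D.l₁ * D.y + algebraMap k B D.b₁ + algebraMap k B D.b₂ * D.x) * hxw
      linear_combination X * a * hrel + (-D.y * X * g + z * D.y * X * a) * hxw)
    -- eliminating `a` and `g` shows that `(1 : δ : -γ)` is a rational point
    have h3 : algebraMap k B (D.b₀ + γ * δ' - δ * γ') + algebraMap k B (D.b₁ + γ' + δ * D.b₂) * D.x
        +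
        algebraMap k B (D.l₀ + δ * D.l₁ - γ + δ') * D.y = 0 := by
      refine (mul_eq_zero.1 (?_ : _ * a = 0)).resolve_right ha0
      simp only [map_add, map_sub, map_mul]
      linear_combination a * D.rel + (D.y - algebraMap k B δ') * h1 -
        (D.x - algebraMap k B δ) * h2
    obtain ⟨h4, h5, h6⟩ := D.coeff_eq_zero h3
    have h7 := D.anisotropic 1 δ (-γ) (by linear_combination h4 + δ * h5 - γ * h6)
    exact one_ne_zero h7.1
  -- elements of higher order are reduced to elements of smaller order
  have key (d : ℕ) : ∀ f ∈ J, ↑(D.x ^ (-(n + d : ℤ))) * f ∈ D.swap.ring →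
      ∃ r ∈ D.ring, f = r * a := by
    induction d with
    | zero => exact fun f hf hfn => hbase f hf (by rwa [Nat.cast_zero, add_zero] at hfn)
    | succ d ih =>
      intro f hf hfn
      obtain ⟨α, β, h⟩ := D.exists_leading_div ha ha' hfn
      let r : B := ↑(D.x ^ (d : ℤ)) * (algebraMap k B α * D.x + algebraMap k B β * D.y)
      have hr : r ∈ D.ring := mul_mem (D.zpow_mem (by omega)) (add_mem
        (mul_mem (algebraMap_mem _ _) D.x_mem) (mul_mem (algebraMap_mem _ _) D.y_mem))
      have hra : r * a ∈ J := by
        have hpow (i : ℕ) {b : B} (hb : b ∈ J) : (D.x : B) ^ i * b ∈ J := by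
          induction i with
          | zero => simpa using hb
          | succ i ih => rw [pow_succ', mul_assoc]; exact hJx _ ih
        have : r * a = (D.x : B) ^ d * (algebraMap k B α * (D.x * a) + algebraMap k B β * (D.y *
            a)) := by
          simp only [r, zpow_natCast, Units.val_pow_eq_pow_val]
          ring
        rw [this]
        exact hpow d (add_mem (hJk _ (hJx _ haJ)) (hJk _ (hJy _ haJ)))
      obtain ⟨r', hr', h'⟩ := ih (f - r * a) (sub_mem hf hra) (by
        convert h using 1
        have e1 : (↑(D.x ^ (-(n + d : ℤ))) : B) = D.x * ↑(D.x ^ (-(n + (d + 1 : ℕ) : ℤ))) := by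
          rw [← Units.val_mul, ← zpow_one_add]
          congr 2
          push_cast
          ring
        have e2 : (↑(D.x ^ (-(n + d : ℤ))) : B) * ↑(D.x ^ (d : ℤ)) = X := by
          rw [D.zpow_mul_zpow]
          congr 2
          ring
        rw [mul_sub, mul_sub, ← mul_assoc (D.x : B), ← e1]
        congr 1
        linear_combination (algebraMap k B α * D.x + algebraMap k B β * D.y) * a * e2 -
          (algebraMap k B β * D.y * X * a) * hxw)
      exact ⟨r' + r, add_mem hr' hr, by rw [add_mul, ← h', sub_add_cancel]⟩
  refine ⟨a, haJ, fun f hf => ?_⟩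
  obtain ⟨d, hd⟩ := hex f
  refine key d f hf ?_
  have := mul_mem (D.zpow_mem_swap (i := -(n : ℤ)) (by omega)) hd
  rwa [← mul_assoc, D.zpow_mul_zpow, ← neg_add] at this

theorem isPrincipalIdealRing (D : ConicRing k B) : IsPrincipalIdealRing D.ring := by
  refine ⟨fun I => ?_⟩
  let J : Submodule k B := (I.restrictScalars k).map D.ring.val.toLinearMap
  obtain ⟨_, ⟨a, haI, rfl⟩, ha⟩ := D.exists_generator J (by rintro _ ⟨b, _, rfl⟩; exact b.2)
    (by rintro _ ⟨b, hb, rfl⟩; exact ⟨⟨_, D.x_mem⟩ * b, I.mul_mem_left _ hb, rfl⟩)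
    (by rintro _ ⟨b, hb, rfl⟩; exact ⟨⟨_, D.y_mem⟩ * b, I.mul_mem_left _ hb, rfl⟩)
  refine ⟨a, le_antisymm (fun b hb => ?_) ((Ideal.span_singleton_le_iff_mem I).2 haI)⟩
  obtain ⟨r, hr, h⟩ := ha b ⟨b, hb, rfl⟩
  exact Ideal.mem_span_singleton'.2 ⟨⟨r, hr⟩, Subtype.ext h.symm⟩

end ConicRing

/-! ### Sheaves of modules in terms of the charts of a conic -/

/-- A localization of a free module at the powers of `f` has a basis over the localized ring in
which the elements of the module have coordinates in the ring. -/
theorem exists_basis_of_semilinear {R B M N : Type u} [CommRing R] [IsDomain R]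
    [IsPrincipalIdealRing R] [CommRing B] (φ : R →+* B) (f : R)
    (hf : letI := φ.toAlgebra; IsLocalization.Away f B) [AddCommGroup M] [AddCommGroup N]
    [Module R M] [Module.Finite R M] [Module.IsTorsionFree R M] [Module B N] (ρ : M →ₛₗ[φ] N)
    (h1 : ∀ t : N, ∃ (n : ℕ) (s : M), φ (f ^ n) • t = ρ s)
    (h2 : ∀ s : M, ρ s = 0 → ∃ n : ℕ, f ^ n • s = 0) :
    ∃ v : Module.Basis (Fin (Module.finrank R M)) B N, ∀ m i, v.repr (ρ m) i ∈ φ.range := by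
  let := φ.toAlgebra
  let : Module R N := Module.compHom N φ
  have : IsScalarTower R B N := IsScalarTower.of_algebraMap_smul fun _ _ => rfl
  let ρ' : M →ₗ[R] N := { ρ with map_smul' := ρ.map_smulₛₗ }
  have : IsLocalizedModule.Away f ρ' := isLocalizedModule_of_semilinear (B := B) f ρ' h1 h2
  refine ⟨(Module.finBasis R M).ofIsLocalizedModule B (.powers f) ρ', fun m i => ?_⟩
  exact ⟨_, ((Module.finBasis R M).ofIsLocalizedModule_repr_apply B (.powers f) ρ' m i).symm⟩

theorem isPrincipalIdealRing_of_range {k R B : Type u} [Field k] [CommRing R] [CommRing B]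
    [Algebra k B] (φ : R →+* B) (hφ : Function.Injective φ) {S : Subalgebra k B}
    [IsPrincipalIdealRing S] (hS : ∀ c, c ∈ φ.range ↔ c ∈ S) : IsPrincipalIdealRing R := by
  let ψ : R →+* S := φ.codRestrict S fun r => (hS _).1 ⟨r, rfl⟩
  have hψ : Function.Bijective ψ := by
    refine ⟨fun a b h => hφ (congrArg Subtype.val h), fun c => ?_⟩
    obtain ⟨r, hr⟩ := (hS c).2 c.2
    exact ⟨r, Subtype.ext hr⟩
  exact IsPrincipalIdealRing.of_surjective ((RingEquiv.ofBijective ψ hψ).symm : S →+* R)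
    (RingEquiv.ofBijective ψ hψ).symm.surjective

section Lattice

variable {k R B M N : Type u} [Field k] [CommRing R] [CommRing B] [Algebra k B] (D : ConicRing k B)
  {φ : R →+* B} (hφ : ∀ c, c ∈ φ.range ↔ c ∈ D.ring) [AddCommGroup M] [AddCommGroup N] [Module R M]
  [Module B N] [Module k N] [IsScalarTower k B N] (ρ : M →ₛₗ[φ] N)

/-- The image of a semilinear map as a `k`-subspace, for a ring `R` whose image is `k[x, y]`. -/
def rangeSubspace : Submodule k N where
  carrier := Set.range ρ
  add_mem' := by
    rintro _ _ ⟨a, rfl⟩ ⟨b, rfl⟩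
    exact ⟨a + b, map_add _ _ _⟩
  zero_mem' := ⟨0, map_zero _⟩
  smul_mem' c := by
    rintro _ ⟨a, rfl⟩
    obtain ⟨r, hr⟩ := (hφ (algebraMap k B c)).2 (algebraMap_mem _ _)
    exact ⟨r • a, by rw [map_smulₛₗ, hr, algebraMap_smul]⟩

theorem isLattice_rangeSubspace {f : R} (hf : φ f = D.x)
    (h : ∀ t : N, ∃ (n : ℕ) (s : M), φ (f ^ n) • t = ρ s) :
    D.IsLattice (rangeSubspace D hφ ρ) := by
  have key {c : B} (hc : c ∈ D.ring) {n : N} (hn : n ∈ rangeSubspace D hφ ρ) :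
      c • n ∈ rangeSubspace D hφ ρ := by
    obtain ⟨r, rfl⟩ := (hφ c).2 hc
    obtain ⟨a, rfl⟩ := hn
    exact ⟨r • a, map_smulₛₗ _ _ _⟩
  refine ⟨fun m hm => key D.x_mem hm, fun m hm => key D.y_mem hm, fun n => ?_⟩
  obtain ⟨i, s, hs⟩ := h n
  exact ⟨i, s, by rw [← hs, map_pow, hf, Units.val_pow_eq_pow_val]⟩

end Lattice

/-- An endomorphism preserving the image of an injective semilinear map restricts to an
endomorphism of the source. -/
theorem exists_lift_of_injective {R B M N : Type u} [CommRing R] [CommRing B] {φ : R →+* B}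
    [AddCommGroup M] [AddCommGroup N] [Module R M] [Module B N] (ρ : M →ₛₗ[φ] N)
    (hρ : Function.Injective ρ) (e : N →ₗ[B] N) (he : ∀ m, e (ρ m) ∈ Set.range ρ) :
    ∃ e' : M →ₗ[R] M, ∀ m, e (ρ m) = ρ (e' m) := by
  choose e' he' using he
  exact ⟨{ toFun := e'
           map_add' := fun a b => hρ (by simp only [map_add, he'])
           map_smul' := fun r a => hρ (by simp only [map_smulₛₗ, he', RingHom.id_apply]) },
    fun m => (he' m).symm⟩

/-- Two charts as in `TwoCharts` whose coordinate rings are `k[x, y]` and `k[x⁻¹, x⁻¹ y]`, for an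
anisotropic quadratic relation between `x` and `y`. -/
structure ConicCharts (k : Type u) [Field k] (X : Scheme.{u}) extends TwoCharts X where
  algebra : Algebra k B
  /-- the coordinates on the intersection of the charts -/
  D : ConicRing k B
  injective : ∀ b, Function.Injective (φ b)
  mem_range_false : ∀ c, c ∈ (φ false).hom.range ↔ c ∈ D.ring
  mem_range_true : ∀ c, c ∈ (φ true).hom.range ↔ c ∈ D.swap.ring
  φ_f_false : φ false (f false) = D.x
  φ_f_true : φ true (f true) = D.swap.x

attribute [instance] ConicCharts.algebra

namespace ConicCharts

variable {k : Type u} [Field k] {X : Scheme.{u}} (T : ConicCharts k X)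

theorem isDomain_B : IsDomain T.B := T.D.isDomain

theorem isDomain_R (b : Bool) : IsDomain (T.R b) :=
  have := T.isDomain_B
  (T.injective b).isDomain (T.φ b).hom

theorem isPrincipalIdealRing_R (b : Bool) : IsPrincipalIdealRing (T.R b) := by
  cases b
  · have := T.D.isPrincipalIdealRing
    exact isPrincipalIdealRing_of_range _ (T.injective false) T.mem_range_false
  · have := T.D.swap.isPrincipalIdealRing
    exact isPrincipalIdealRing_of_range _ (T.injective true) T.mem_range_true

/-- Restriction of sections from a chart to the intersection of the charts. -/
abbrev res (V : X.Modules) (b : Bool) :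
    Γ(V.restrict (T.j b), ⊤) →ₛₗ[(T.φ b).hom] Γ(V.restrict T.g, ⊤) :=
  resTopₛₗ (T.φ b) (T.j b) T.g (T.comp_eq b) V

variable {T} {V : X.Modules}

theorem res_injective (hV : T.IsGood V) (b : Bool) : Function.Injective (T.res V b) := by
  have := T.isDomain_B
  have := T.isDomain_R b
  have := (hV b).2.2
  rw [injective_iff_map_eq_zero]
  intro s hs
  obtain ⟨n, hn⟩ := exists_smul_eq_zero_of_resTop_eq_zero (T.φ b) (T.j b) T.g (T.comp_eq b) (T.f b)
    (T.loc b) V (hV b).1 s hs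
  refine (smul_eq_zero.1 hn).resolve_left fun h => ?_
  have := T.isUnit_φ_f b n
  rw [h, map_zero] at this
  exact not_isUnit_zero this

theorem exists_basis (hV : T.IsGood V) (b : Bool) :
    ∃ v : Module.Basis (Fin (Module.finrank (T.R b) Γ(V.restrict (T.j b), ⊤))) T.B
      Γ(V.restrict T.g, ⊤), ∀ m i, v.repr (T.res V b m) i ∈ (T.φ b).hom.range := by
  have := T.isDomain_R b
  have := T.isPrincipalIdealRing_R b
  have := (hV b).2.1
  have := (hV b).2.2
  exact exists_basis_of_semilinear (T.φ b).hom (T.f b) (T.loc b) (T.res V b)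
    (exists_resTop_eq (T.φ b) (T.j b) T.g (T.comp_eq b) (T.f b) (T.loc b) V (hV b).1)
    (exists_smul_eq_zero_of_resTop_eq_zero (T.φ b) (T.j b) T.g (T.comp_eq b) (T.f b)
      (T.loc b) V (hV b).1)

theorem finrank_eq (hV : T.IsGood V) (b : Bool) :
    Module.finrank (T.R b) Γ(V.restrict (T.j b), ⊤) = Module.finrank T.B Γ(V.restrict T.g, ⊤) := by
  have := T.isDomain_B
  obtain ⟨v, -⟩ := exists_basis hV b
  rw [Module.finrank_eq_card_basis v, Fintype.card_fin]

theorem exists_idempotent (hV : T.IsGood V) (b : Bool)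
    (h : 2 < Module.finrank (T.R b) Γ(V.restrict (T.j b), ⊤)) :
    ∃ η : V ⟶ V, η ≫ η = η ∧ η ≠ 0 ∧ η ≠ 𝟙 V := by
  have := T.isDomain_B
  let : Module k Γ(V.restrict T.g, ⊤) := Module.compHom _ (algebraMap k T.B)
  have : IsScalarTower k T.B Γ(V.restrict T.g, ⊤) := IsScalarTower.of_algebraMap_smul fun _ _ => rfl
  rw [finrank_eq hV] at h
  have habs (b : Bool) := exists_resTop_eq (T.φ b) (T.j b) T.g (T.comp_eq b) (T.f b) (T.loc b) V
      (hV b).1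
  obtain ⟨v, hv⟩ := exists_basis hV false
  obtain ⟨v', hv'⟩ := exists_basis hV true
  let M₀ := rangeSubspace T.D T.mem_range_false (T.res V false)
  let M₁ := rangeSubspace T.D.swap T.mem_range_true (T.res V true)
  obtain ⟨e, hee, h0, h1, he₀, he₁⟩ := ConicRing.exists_idempotent (M₀ := M₀) (M₁ := M₁)
    (isLattice_rangeSubspace T.D T.mem_range_false _ T.φ_f_false (habs false))
    (isLattice_rangeSubspace T.D.swap T.mem_range_true _ T.φ_f_true (habs true)) v
    (by rintro _ ⟨m, rfl⟩ i; exact (T.mem_range_false _).1 (hv m i)) v'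
    (by rintro _ ⟨m, rfl⟩ i; exact (T.mem_range_true _).1 (hv' m i)) h
  have hlift (b : Bool) : ∃ e' : Γ(V.restrict (T.j b), ⊤) →ₗ[T.R b] Γ(V.restrict (T.j b), ⊤),
      ∀ m, e (T.res V b m) = T.res V b (e' m) :=
    exists_lift_of_injective _ (res_injective hV b) e
      (by cases b; exacts [fun m => he₀ _ ⟨m, rfl⟩, fun m => he₁ _ ⟨m, rfl⟩])
  choose e' he' using hlift
  obtain ⟨η, hη⟩ := TwoCharts.exists_hom hV e' e he'
  -- identities between endomorphisms can be checked on the intersection of the charts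
  have hext {ε : Γ(V.restrict T.g, ⊤) →ₗ[T.B] Γ(V.restrict T.g, ⊤)} (h : ∀ m, e (T.res V false m) =
      ε (T.res V false m)) : e = ε := by
    ext n
    obtain ⟨i, s, hs⟩ := habs false n
    refine (T.isUnit_φ_f false i).smul_left_cancel.1 ?_
    rw [← map_smul, ← map_smul, hs]
    exact h s
  refine ⟨η, TwoCharts.hom_ext hV fun b => ?_, fun h => h0 (hext fun m => ?_),
    fun h => h1 (hext fun m => ?_)⟩
  · ext m
    refine res_injective hV b ?_
    rw [secMap_comp, LinearMap.comp_apply, hη, ← he', ← he', ← LinearMap.comp_apply, hee]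
  · rw [he', ← hη, h, secMap_zero, LinearMap.zero_apply, LinearMap.zero_apply, map_zero]
  · rw [he', ← hη, h, secMap_id, LinearMap.id_apply, LinearMap.id_apply]

end ConicCharts

/-! ### Decomposition into indecomposable bundles -/

section Category

universe v w
variable {C : Type w} [Category.{v} C]

/-- The direct sum of a disjoint union of finite families. -/
def biproductSumIso [Preadditive C] [HasFiniteBiproducts C] [HasBinaryBiproducts C]
    {ι κ : Type} [Finite ι] [Finite κ] (f : ι ⊕ κ → C) :
    (⨁ fun i => f (.inl i)) ⊞ (⨁ fun i => f (.inr i)) ≅ ⨁ f where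
  hom := biprod.desc (biproduct.desc fun i => biproduct.ι f (.inl i))
    (biproduct.desc fun i => biproduct.ι f (.inr i))
  inv := biproduct.desc fun
    | .inl i => biproduct.ι (fun i => f (.inl i)) i ≫ biprod.inl
    | .inr i => biproduct.ι (fun i => f (.inr i)) i ≫ biprod.inr
  hom_inv_id := by
    apply biprod.hom_ext' <;> apply biproduct.hom_ext' <;> intro i <;> simp
  inv_hom_id := by
    apply biproduct.hom_ext'
    rintro (i | i) <;> simp

/-- A nontrivial idempotent endomorphism decomposes an object. -/
theorem not_indecomposable_of_idempotent [Abelian C] {X : C} (η : X ⟶ X) (h : η ≫ η = η)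
    (h0 : η ≠ 0) (h1 : η ≠ 𝟙 X) : ¬ Indecomposable X := by
  intro hX
  have h' : (𝟙 X - η) ≫ (𝟙 X - η) = 𝟙 X - η := by simp [h]
  obtain ⟨Y, i, e, hie, hei⟩ := IsIdempotentComplete.idempotents_split X η h
  obtain ⟨Z, i', e', hie', hei'⟩ := IsIdempotentComplete.idempotents_split X (𝟙 X - η) h'
  have hz : i ≫ e' = 0 := by
    have : i ≫ (𝟙 X - η) = 0 := by
      rw [← hei, Preadditive.comp_sub, Category.comp_id, ← Category.assoc, hie, Category.id_comp,
        sub_self]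
    calc i ≫ e' = (i ≫ e' ≫ i') ≫ e' := by simp [hie']
      _ = 0 := by rw [hei', this, zero_comp]
  have hz' : i' ≫ e = 0 := by
    have h3 : i' ≫ η = 0 := by
      have : i' ≫ (𝟙 X - η) = i' := by rw [← hei', ← Category.assoc, hie', Category.id_comp]
      rw [Preadditive.comp_sub, Category.comp_id, sub_eq_self] at this
      exact this
    calc i' ≫ e = (i' ≫ e ≫ i) ≫ e := by simp [hie]
      _ = 0 := by rw [hei, h3, zero_comp]
  have iso : X ≅ Y ⊞ Z :=
    { hom := biprod.lift e e'
      inv := biprod.desc i i'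
      hom_inv_id := by rw [biprod.lift_desc, hei, hei', add_sub_cancel]
      inv_hom_id := by
        apply biprod.hom_ext <;> apply biprod.hom_ext' <;> simp [hie, hie', hz, hz'] }
  rcases hX.2 Y Z iso with hY | hZ
  · exact h0 (by rw [← hei, hY.eq_of_tgt e 0, zero_comp])
  · refine h1 (sub_eq_zero.1 ?_).symm
    rw [← hei', hZ.eq_of_tgt e' 0, zero_comp]

end Category

theorem nonempty_restrict_opensRange {X Y : Scheme.{u}} (j : Y ⟶ X) [IsOpenImmersion j]
    {V : X.Modules} {n : ℕ} (e : V.restrict j ≅ freeModule Y n) :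
    Nonempty (V.restrict j.opensRange.ι ≅ freeModule j.opensRange.toScheme n) :=
  ⟨(Scheme.Modules.restrictFunctorCongr j.isoOpensRange_inv_comp).symm.app V ≪≫
    (Scheme.Modules.restrictFunctorComp j.isoOpensRange.inv j).app V ≪≫
    (Scheme.Modules.restrictFunctor j.isoOpensRange.inv).mapIso e ≪≫
    restrictFreeIso j.isoOpensRange.inv n⟩

theorem TwoCharts.IsGood.of_retract {X : Scheme.{u}} {T : TwoCharts X} {V W : X.Modules}
    (hV : T.IsGood V) (r : Retract W V) : T.IsGood W := by
  intro b
  have h1 : secMap (T.j b) r.r ∘ₗ secMap (T.j b) r.i = LinearMap.id := by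
    rw [← secMap_comp, r.retract, secMap_id]
  have h2 (s) : secMap (T.j b) r.r (secMap (T.j b) r.i s) = s := LinearMap.congr_fun h1 s
  obtain ⟨h3, h4, h5⟩ := hV b
  exact ⟨isIso_fromTildeΓ_of_retract (r.map (Scheme.Modules.restrictFunctor (T.j b))) h3,
    Module.Finite.of_surjective (secMap (T.j b) r.r) fun s => ⟨_, h2 s⟩,
    (Function.LeftInverse.injective h2).moduleIsTorsionFree _ (map_smul _)⟩

namespace ConicCharts

variable {k : Type u} [Field k] {X : Scheme.{u}} {T : ConicCharts k X} {V : X.Modules}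

theorem isGood_of_isVectorBundle (hV : IsVectorBundle V) : T.IsGood V := fun b =>
  have := T.isDomain_R b
  ⟨hV.isIso_fromTildeΓ _, finite_of_isVectorBundle _ hV, isTorsionFree_of_isVectorBundle _ hV⟩

variable (T V) in
/-- The rank of a bundle. -/
def rank : ℕ := Module.finrank T.B Γ(V.restrict T.g, ⊤)

theorem free_of_isGood (hV : T.IsGood V) (b : Bool) :
    Module.Free (T.R b) Γ(V.restrict (T.j b), ⊤) := by
  have := T.isDomain_R b
  have := T.isPrincipalIdealRing_R b
  have := (hV b).2.1
  have := (hV b).2.2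
  infer_instance

theorem hasRank (hV : T.IsGood V) : HasRank V (T.rank V) := by
  intro x
  have hx : x ∈ ⨆ b, (T.j b).opensRange := T.cover ▸ trivial
  obtain ⟨b, hb⟩ := TopologicalSpace.Opens.mem_iSup.1 hx
  have := T.isDomain_R b
  have := free_of_isGood hV b
  have := (hV b).2.1
  obtain ⟨e⟩ := nonempty_iso_freeModule (hV b).1
  rw [finrank_eq hV] at e
  exact ⟨_, hb, nonempty_restrict_opensRange (T.j b) e⟩

theorem rank_le_two (hV : T.IsGood V) (hV' : Indecomposable V) : T.rank V ≤ 2 := by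
  by_contra! h
  rw [rank, ← finrank_eq hV true] at h
  obtain ⟨η, h, h0, h1⟩ := exists_idempotent hV true h
  exact not_indecomposable_of_idempotent η h h0 h1 hV'

theorem rank_pos (hV : T.IsGood V) (h0 : ¬ IsZero V) : 0 < T.rank V := by
  by_contra! h
  refine h0 ((IsZero.iff_id_eq_zero V).2 (TwoCharts.hom_ext hV fun b => ?_))
  have := T.isDomain_R b
  have := free_of_isGood hV b
  have := (hV b).2.1
  have h1 : Module.finrank (T.R b) Γ(V.restrict (T.j b), ⊤) = 0 := by
    rw [finrank_eq hV]; exact Nat.le_zero.1 h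
  have := Module.finrank_zero_iff.1 h1
  ext s
  exact Subsingleton.elim _ _

theorem rank_eq_add (hV : T.IsGood V) {Y Z : X.Modules} (e : V ≅ Y ⊞ Z) (hY : T.IsGood Y)
    (hZ : T.IsGood Z) : T.rank V = T.rank Y + T.rank Z := by
  have := T.isDomain_R true
  have := free_of_isGood hY true
  have := free_of_isGood hZ true
  have := (hY true).2.1
  have := (hZ true).2.1
  simp only [rank]
  rw [← finrank_eq hV true, ← finrank_eq hY true, ← finrank_eq hZ true, ← Module.finrank_prod]
  let p : V ⟶ Y := e.hom ≫ biprod.fst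
  let q : V ⟶ Z := e.hom ≫ biprod.snd
  let i : Y ⟶ V := biprod.inl ≫ e.inv
  let j : Z ⟶ V := biprod.inr ≫ e.inv
  have hid {U : X.Modules} (a : U ⟶ U) (h : a = 𝟙 U) (s) : secMap (T.j true) a s = s := by
    rw [h, secMap_id, LinearMap.id_apply]
  have hzero {U U' : X.Modules} (a : U ⟶ U') (h : a = 0) (s) : secMap (T.j true) a s = 0 := by
    rw [h, secMap_zero, LinearMap.zero_apply]
  have h1 (s) : secMap (T.j true) p (secMap (T.j true) i s) = s := hid (i ≫ p) (by simp [i, p]) s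
  have h2 (s) : secMap (T.j true) q (secMap (T.j true) i s) = 0 := hzero (i ≫ q) (by simp [i, q]) s
  have h3 (s) : secMap (T.j true) p (secMap (T.j true) j s) = 0 := hzero (j ≫ p) (by simp [j, p]) s
  have h4 (s) : secMap (T.j true) q (secMap (T.j true) j s) = s := hid (j ≫ q) (by simp [j, q]) s
  refine (LinearEquiv.ofLinearMap ((secMap (T.j true) p).prod (secMap (T.j true) q))
    ((secMap (T.j true) i).coprod (secMap (T.j true) j)) ?_ ?_).finrank_eq
  · ext s <;> simp [h1, h2, h3, h4]
  · rw [LinearMap.coprod_comp_prod, ← secMap_comp, ← secMap_comp, ← secMap_add]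
    refine LinearMap.ext (hid _ ?_)
    rw [← cancel_epi e.inv, ← cancel_mono e.hom]
    simp [p, q, i, j]

theorem exists_decomposition (hV : T.IsGood V) (h0 : ¬ IsZero V) :
    ∃ (ι : Type) (_ : Finite ι) (W : ι → X.Modules),
      (∀ i, Indecomposable (W i) ∧ T.IsGood (W i)) ∧ Nonempty (V ≅ ⨁ W) := by
  induction hn : T.rank V using Nat.strong_induction_on generalizing V with
  | _ n ih =>
    by_cases hI : Indecomposable V
    · exact ⟨Unit, inferInstance, fun _ => V, fun _ => ⟨hI, hV⟩,
        ⟨(biproductUniqueIso fun _ : Unit => V).symm⟩⟩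
    · simp only [Indecomposable, h0, not_false_eq_true, true_and, not_forall, not_or] at hI
      obtain ⟨Y, Z, e, hY0, hZ0⟩ := hI
      have hY : T.IsGood Y := hV.of_retract ⟨biprod.inl ≫ e.inv, e.hom ≫ biprod.fst, by simp⟩
      have hZ : T.IsGood Z := hV.of_retract ⟨biprod.inr ≫ e.inv, e.hom ≫ biprod.snd, by simp⟩
      have hr := rank_eq_add hV e hY hZ
      have hYr := rank_pos hY hY0
      have hZr := rank_pos hZ hZ0
      obtain ⟨ι, _, W, hW, ⟨f⟩⟩ := ih (T.rank Y) (by omega) hY hY0 rfl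
      obtain ⟨κ, _, W', hW', ⟨f'⟩⟩ := ih (T.rank Z) (by omega) hZ hZ0 rfl
      exact ⟨ι ⊕ κ, inferInstance, Sum.elim W W', Sum.rec hW hW',
        ⟨e ≪≫ biprod.mapIso f f' ≪≫ biproductSumIso (Sum.elim W W')⟩⟩

theorem exists_decomposition_of_isVectorBundle (T : ConicCharts k X) (hV : IsVectorBundle V) (h0 :
    ¬ IsZero V) :
    ∃ (n : ℕ) (W : Fin n → X.Modules),
      (∀ i, Indecomposable (W i) ∧ ∃ r ≤ 2, HasRank (W i) r) ∧ Nonempty (V ≅ ⨁ W) := by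
  obtain ⟨ι, _, W, hW, ⟨f⟩⟩ := exists_decomposition (T := T) (isGood_of_isVectorBundle hV) h0
  obtain ⟨n, ⟨e⟩⟩ := Finite.exists_equiv_fin ι
  refine ⟨n, W ∘ e.symm, fun i => ⟨(hW _).1, _, rank_le_two (hW _).2 (hW _).1, hasRank (hW _).2⟩,
    ⟨f ≪≫ biproduct.whiskerEquiv e fun j => eqToIso (by simp)⟩⟩

theorem exists_rank_le_two (T : ConicCharts k X) (hV : IsVectorBundle V) (h : Indecomposable V) :
    ∃ r ≤ 2, HasRank V r :=
  have hV' : T.IsGood V := isGood_of_isVectorBundle hV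
  ⟨_, rank_le_two hV' h, hasRank hV'⟩

end ConicCharts

/-! ### Ternary quadratic forms -/

section Polynomial

variable {k : Type u} [Field k]

/-- The coefficients of a ternary quadratic form. -/
theorem exists_eq_of_isHomogeneous_two {q : MvPolynomial (Fin 3) k} (hq : q.IsHomogeneous 2) :
    ∃ a₀₀ a₀₁ a₁₁ a₀₂ a₁₂ a₂₂ : k, q =
      MvPolynomial.C a₀₀ * (MvPolynomial.X 0 * MvPolynomial.X 0) +
      MvPolynomial.C a₀₁ * (MvPolynomial.X 0 * MvPolynomial.X 1) +
      MvPolynomial.C a₁₁ * (MvPolynomial.X 1 * MvPolynomial.X 1) +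
      MvPolynomial.C a₀₂ * (MvPolynomial.X 0 * MvPolynomial.X 2) +
      MvPolynomial.C a₁₂ * (MvPolynomial.X 1 * MvPolynomial.X 2) +
      MvPolynomial.C a₂₂ * (MvPolynomial.X 2 * MvPolynomial.X 2) := by
  have hq' : q ∈ Submodule.span k ((fun d => MvPolynomial.monomial d (1 : k)) ''
      {d : Fin 3 →₀ ℕ | d.degree = 2}) := by
    rw [q.as_sum]
    refine sum_mem fun d hd => ?_
    rw [← mul_one (q.coeff d), ← smul_eq_mul, ← MvPolynomial.smul_monomial]
    refine Submodule.smul_mem _ _ (Submodule.subset_span ⟨d, ?_, rfl⟩)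
    rw [Set.mem_ofPred_eq, Finsupp.degree_eq_weight_one]
    exact hq (MvPolynomial.mem_support_iff.1 hd)
  clear hq
  induction hq' using Submodule.span_induction with
  | mem q h =>
    obtain ⟨d, hd, rfl⟩ := h
    have hmon : MvPolynomial.monomial d (1 : k) =
        MvPolynomial.X 0 ^ d 0 * MvPolynomial.X 1 ^ d 1 * MvPolynomial.X 2 ^ d 2 := by
      rw [MvPolynomial.monomial_eq, Finsupp.prod_fintype _ _ (fun _ => pow_zero _),
        Fin.prod_univ_three, map_one, one_mul]
    have hd' : d 0 + d 1 + d 2 = 2 := by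
      rw [← Fin.sum_univ_three, ← hd]
      exact (Finsupp.degree_eq_sum d).symm
    dsimp only
    rw [hmon]
    obtain ⟨h0, h1, h2⟩ | ⟨h0, h1, h2⟩ | ⟨h0, h1, h2⟩ | ⟨h0, h1, h2⟩ | ⟨h0, h1, h2⟩ | ⟨h0, h1, h2⟩ :
        (d 0 = 2 ∧ d 1 = 0 ∧ d 2 = 0) ∨ (d 0 = 1 ∧ d 1 = 1 ∧ d 2 = 0) ∨
        (d 0 = 0 ∧ d 1 = 2 ∧ d 2 = 0) ∨ (d 0 = 1 ∧ d 1 = 0 ∧ d 2 = 1) ∨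
        (d 0 = 0 ∧ d 1 = 1 ∧ d 2 = 1) ∨ (d 0 = 0 ∧ d 1 = 0 ∧ d 2 = 2) := by omega
    · exact ⟨1, 0, 0, 0, 0, 0, by simp [h0, h1, h2, pow_two]⟩
    · exact ⟨0, 1, 0, 0, 0, 0, by simp [h0, h1, h2]⟩
    · exact ⟨0, 0, 1, 0, 0, 0, by simp [h0, h1, h2, pow_two]⟩
    · exact ⟨0, 0, 0, 1, 0, 0, by simp [h0, h1, h2]⟩
    · exact ⟨0, 0, 0, 0, 1, 0, by simp [h0, h1, h2]⟩
    · exact ⟨0, 0, 0, 0, 0, 1, by simp [h0, h1, h2, pow_two]⟩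
  | zero => exact ⟨0, 0, 0, 0, 0, 0, by simp⟩
  | add p r _ _ hp hr =>
    obtain ⟨a₁, a₂, a₃, a₄, a₅, a₆, rfl⟩ := hp
    obtain ⟨c₁, c₂, c₃, c₄, c₅, c₆, rfl⟩ := hr
    refine ⟨a₁ + c₁, a₂ + c₂, a₃ + c₃, a₄ + c₄, a₅ + c₅, a₆ + c₆, ?_⟩
    simp only [map_add]
    ring
  | smul c p _ hp =>
    obtain ⟨a₁, a₂, a₃, a₄, a₅, a₆, rfl⟩ := hp
    refine ⟨c * a₁, c * a₂, c * a₃, c * a₄, c * a₅, c * a₆, ?_⟩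
    simp only [map_mul, MvPolynomial.smul_eq_C_mul]
    ring

theorem aeval_mul_of_isHomogeneous {S : Type u} [CommRing S] [Algebra k S]
    {p : MvPolynomial (Fin 3) k} {n : ℕ} (hp : p.IsHomogeneous n) (c : S) (v : Fin 3 → S) :
    MvPolynomial.aeval (fun i => c * v i) p = c ^ n * MvPolynomial.aeval v p := by
  rw [MvPolynomial.aeval_eq_eval₂Hom, MvPolynomial.aeval_eq_eval₂Hom, MvPolynomial.coe_eval₂Hom,
      MvPolynomial.coe_eval₂Hom, MvPolynomial.eval₂_eq', MvPolynomial.eval₂_eq', Finset.mul_sum]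
  refine Finset.sum_congr rfl fun d hd => ?_
  have hd' : ∑ i, d i = n := by
    rw [← Finsupp.degree_eq_sum d, Finsupp.degree_eq_weight_one]
    exact hp (MvPolynomial.mem_support_iff.1 hd)
  simp only [mul_pow, Finset.prod_mul_distrib, Finset.prod_pow_eq_pow_sum, hd']
  ring

/-- An algebra generated by `X` and an element `Y` that is integral of degree two over `k[X]`. -/
theorem exists_eq_aeval_add_aeval_mul {S : Type u} [CommRing S] [Algebra k S] {X Y : S}
    {v : Fin 3 → S} (hv : ∀ i, v i = 1 ∨ v i = X ∨ v i = Y) {P₀ Q₀ : Polynomial k}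
    (hY : Y * Y = Polynomial.aeval X P₀ + Polynomial.aeval X Q₀ * Y) (p : MvPolynomial (Fin 3) k) :
    ∃ P Q : Polynomial k, MvPolynomial.aeval v p =
      Polynomial.aeval X P + Polynomial.aeval X Q * Y := by
  induction p using MvPolynomial.induction_on with
  | C a => exact ⟨Polynomial.C a, 0, by simp⟩
  | add p r hp hr =>
    obtain ⟨P, Q, h⟩ := hp
    obtain ⟨P', Q', h'⟩ := hr
    refine ⟨P + P', Q + Q', ?_⟩
    simp only [map_add, h, h']
    ring
  | mul_X p i hp =>
    obtain ⟨P, Q, h⟩ := hp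
    rw [map_mul, MvPolynomial.aeval_X, h]
    rcases hv i with h | h | h <;> rw [h]
    · exact ⟨P, Q, mul_one _⟩
    · refine ⟨P * Polynomial.X, Q * Polynomial.X, ?_⟩
      simp only [map_mul, Polynomial.aeval_X]
      ring
    · refine ⟨Q * P₀, P + Q * Q₀, ?_⟩
      simp only [map_mul, map_add]
      linear_combination Polynomial.aeval X Q * hY

end Polynomial

/-! ### The charts where one coordinate does not vanish -/

section Charts

open HomogeneousLocalization

variable {k : Type u} [Field k] (q : MvPolynomial (Fin 3) k)

variable {q} in
/-- The homogeneous coordinates. -/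
abbrev coord (i : Fin 3) : CoordinateRing q := Ideal.Quotient.mk _ (MvPolynomial.X i)

theorem coord_mem (i : Fin 3) : coord i ∈ grading q 1 :=
  mk_mem_grading q (MvPolynomial.isHomogeneous_X k i)

variable [GradedAlgebra (grading q)]

/-- The structure of a `k`-algebra on the functions on a chart; its scalar multiplication is the one
that homogeneous localizations already have. -/
instance awayAlgebra (f : CoordinateRing q) : Algebra k (Away (grading q) f) where
  algebraMap := (fromZeroRingHom (grading q) (.powers f)).comp (algebraMap k (grading q 0))
  commutes' _ _ := mul_comm _ _
  smul_def' c r := by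
    apply val_injective
    rw [val_smul, val_mul, Algebra.smul_def,
      IsScalarTower.algebraMap_apply k (CoordinateRing q) (Localization.Away f)]
    rfl

instance (f : CoordinateRing q) : IsScalarTower k (Away (grading q) f) (Localization.Away f) :=
  .of_algebraMap_eq (R := k) (S := Away (grading q) f) (A := Localization.Away f) fun c => by
    rw [IsScalarTower.algebraMap_apply k (CoordinateRing q) (Localization.Away f)]
    rfl

/-- The quotient of two homogeneous coordinates, as a function on an affine chart. -/
def frac (i j : Fin 3) : Away (grading q) (coord (q := q) i) :=
  Away.mk (grading q) (coord_mem q i) 1 (coord j) (by simpa using coord_mem q j)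

theorem val_frac_mul (i j : Fin 3) : algebraMap _ (Localization.Away (coord (q := q) i)) (frac q i
    j) *
    algebraMap _ _ (coord (q := q) i) = algebraMap _ _ (coord (q := q) j) := by
  rw [HomogeneousLocalization.algebraMap_apply, frac, Away.val_mk, Localization.mk_eq_mk']
  simpa only [pow_one] using IsLocalization.mk'_spec (Localization.Away (coord (q := q) i)) (coord
      j)
    (⟨coord i ^ 1, ⟨1, rfl⟩⟩ : Submonoid.powers (coord i))

theorem frac_self (i : Fin 3) : frac q i i = 1 := by
  apply val_injective
  rw [frac, Away.val_mk, val_one, Localization.mk_eq_mk', IsLocalization.mk'_eq_iff_eq_mul]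
  simp

theorem val_aeval_frac_mul (i : Fin 3) {p : MvPolynomial (Fin 3) k} {n : ℕ}
    (hp : p.IsHomogeneous n) :
    algebraMap _ (Localization.Away (coord (q := q) i)) (MvPolynomial.aeval (frac q i) p) *
      algebraMap _ _ (coord (q := q) i) ^ n =
        algebraMap _ _ (Ideal.Quotient.mk (Ideal.span {q}) p) := by
  have h1 : algebraMap _ (Localization.Away (coord (q := q) i)) (MvPolynomial.aeval (frac q i) p) =
      MvPolynomial.aeval (fun j => algebraMap _ (Localization.Away (coord (q := q) i)) (frac q i
          j)) p :=
    (MvPolynomial.aeval_algebraMap_apply _ _ _).symm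
  have h2 : algebraMap (CoordinateRing q) (Localization.Away (coord (q := q) i))
      (Ideal.Quotient.mk (Ideal.span {q}) p) = MvPolynomial.aeval (fun j => algebraMap
        (CoordinateRing q) (Localization.Away (coord (q := q) i)) (coord j)) p := by
    refine (congrArg _ ?_).trans (MvPolynomial.aeval_algebraMap_apply _ _ _).symm
    have : Ideal.Quotient.mkₐ k (Ideal.span {q}) = MvPolynomial.aeval coord :=
      MvPolynomial.algHom_ext fun j => by simp
    exact congr($this p)
  rw [h1, h2, mul_comm, ← aeval_mul_of_isHomogeneous hp]
  congr 2
  ext j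
  rw [mul_comm, val_frac_mul]

/-- The functions on the chart `xᵢ ≠ 0` are the polynomials in the quotients of coordinates. -/
theorem exists_eq_aeval_frac (i : Fin 3) (r : Away (grading q) (coord (q := q) i)) :
    ∃ p : MvPolynomial (Fin 3) k, r = MvPolynomial.aeval (frac q i) p := by
  obtain ⟨n, a, ha, rfl⟩ := Away.mk_surjective _ (coord_mem q i) r
  obtain ⟨p, hp, hpa⟩ := id ha
  replace hp : p.IsHomogeneous n := by simpa using hp
  replace hpa : Ideal.Quotient.mk (Ideal.span {q}) p = a := hpa
  refine ⟨p, val_injective _ ?_⟩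
  have h := val_aeval_frac_mul q i hp
  have hu : IsUnit (algebraMap (CoordinateRing q) (Localization.Away (coord (q := q) i)) (coord i))
      :=
    IsLocalization.Away.algebraMap_isUnit _
  rw [← (hu.pow n).mul_left_inj, ← HomogeneousLocalization.algebraMap_apply,
    ← HomogeneousLocalization.algebraMap_apply, h, hpa, HomogeneousLocalization.algebraMap_apply,
    Away.val_mk, Localization.mk_eq_mk']
  refine Eq.trans (congrArg _ (map_pow _ _ _).symm) (IsLocalization.mk'_spec _ _ _)

theorem aeval_frac_self (hq : q.IsHomogeneous 2) (i : Fin 3) :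
    MvPolynomial.aeval (frac q i) q = 0 := by
  apply val_injective
  have h := val_aeval_frac_mul q i hq
  have hu : IsUnit (algebraMap (CoordinateRing q) (Localization.Away (coord (q := q) i)) (coord i))
      :=
    IsLocalization.Away.algebraMap_isUnit _
  rw [Ideal.Quotient.eq_zero_iff_mem.2 (Ideal.mem_span_singleton_self q), map_zero] at h
  rw [val_zero]
  exact (hu.pow 2).mul_left_eq_zero.1 h

end Charts

/-! ### An explicit model for the functions on the intersection of two charts -/

section MonicForm

variable {k : Type u} [Field k]

/-- The ternary quadratic form with the given coefficients that is monic in `x₂`. -/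
def monicForm (l₀ l₁ b₀ b₁ b₂ : k) : MvPolynomial (Fin 3) k :=
  MvPolynomial.X 2 ^ 2 +
    (MvPolynomial.C l₀ * MvPolynomial.X 0 + MvPolynomial.C l₁ * MvPolynomial.X 1) *
      MvPolynomial.X 2 +
    (MvPolynomial.C b₀ * MvPolynomial.X 0 ^ 2 +
      MvPolynomial.C b₁ * (MvPolynomial.X 0 * MvPolynomial.X 1) +
      MvPolynomial.C b₂ * MvPolynomial.X 1 ^ 2)

theorem aeval_monicForm {S : Type u} [CommRing S] [Algebra k S] (l₀ l₁ b₀ b₁ b₂ : k)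
    (w : Fin 3 → S) : MvPolynomial.aeval w (monicForm l₀ l₁ b₀ b₁ b₂) =
      w 2 ^ 2 + (algebraMap k S l₀ * w 0 + algebraMap k S l₁ * w 1) * w 2 +
        (algebraMap k S b₀ * w 0 ^ 2 + algebraMap k S b₁ * (w 0 * w 1) +
          algebraMap k S b₂ * w 1 ^ 2) := by
  simp [monicForm]

theorem IsAnisotropic.exists_eq_monicForm {q : MvPolynomial (Fin 3) k} (hq : q.IsHomogeneous 2)
    (hani : IsAnisotropic q) : ∃ (c : k) (l₀ l₁ b₀ b₁ b₂ : k), c ≠ 0 ∧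
      q = MvPolynomial.C c * monicForm l₀ l₁ b₀ b₁ b₂ := by
  obtain ⟨a₀₀, a₀₁, a₁₁, a₀₂, a₁₂, c, rfl⟩ := exists_eq_of_isHomogeneous_two hq
  have hc : c ≠ 0 := by
    rintro rfl
    have h := congrFun (hani ![0, 0, 1] (by simp)) 2
    exact one_ne_zero h
  refine ⟨c, c⁻¹ * a₀₂, c⁻¹ * a₁₂, c⁻¹ * a₀₀, c⁻¹ * a₀₁, c⁻¹ * a₁₁, hc, ?_⟩
  have h1 : MvPolynomial.C c * MvPolynomial.C c⁻¹ = (1 : MvPolynomial (Fin 3) k) := by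
    rw [← map_mul, mul_inv_cancel₀ hc, map_one]
  simp only [monicForm, map_mul]
  linear_combination (-(MvPolynomial.C a₀₀ * MvPolynomial.X 0 ^ 2 +
      MvPolynomial.C a₀₁ * (MvPolynomial.X 0 * MvPolynomial.X 1) +
      MvPolynomial.C a₁₁ * MvPolynomial.X 1 ^ 2 +
      MvPolynomial.C a₀₂ * (MvPolynomial.X 0 * MvPolynomial.X 2) +
      MvPolynomial.C a₁₂ * (MvPolynomial.X 1 * MvPolynomial.X 2))) * h1

theorem aeval_C_mul_eq_zero {S : Type u} [CommRing S] [Algebra k S] {c : k} (hc : c ≠ 0)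
    {p : MvPolynomial (Fin 3) k} {w : Fin 3 → S} :
    MvPolynomial.aeval w (MvPolynomial.C c * p) = 0 ↔ MvPolynomial.aeval w p = 0 := by
  rw [map_mul, MvPolynomial.aeval_C]
  exact ((IsUnit.mk0 c hc).map (algebraMap k S)).mul_right_eq_zero

end MonicForm

section Model

variable {k : Type u} [Field k] (l₀ l₁ b₀ b₁ b₂ : k)

/-- The explicit model for the functions on the intersection of two charts of the conic: the free
module with the basis `1, ω` over the Laurent polynomials in `T`, where `ω` is the third
coordinate. -/
abbrev Model : Type u := QuadraticAlgebra (LaurentPolynomial k)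
  (-(LaurentPolynomial.C b₀ + LaurentPolynomial.C b₁ * LaurentPolynomial.T 1 +
    LaurentPolynomial.C b₂ * LaurentPolynomial.T 1 ^ 2))
  (-(LaurentPolynomial.C l₀ + LaurentPolynomial.C l₁ * LaurentPolynomial.T 1))

/-- The point with the coordinates `(1 : T : ω)` over the explicit model. -/
def Model.point : Fin 3 → Model l₀ l₁ b₀ b₁ b₂ :=
  ![1, ⟨LaurentPolynomial.T 1, 0⟩, ⟨0, 1⟩]

theorem Model.aeval_point :
    MvPolynomial.aeval (Model.point l₀ l₁ b₀ b₁ b₂) (monicForm l₀ l₁ b₀ b₁ b₂) = 0 := by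
  have h (c : k) : algebraMap k (Model l₀ l₁ b₀ b₁ b₂) c = ⟨LaurentPolynomial.C c, 0⟩ := rfl
  have h1 : (1 : Model l₀ l₁ b₀ b₁ b₂) = ⟨1, 0⟩ := rfl
  rw [aeval_monicForm]
  simp only [h, Model.point, Matrix.cons_val_zero, Matrix.cons_val_one, Matrix.cons_val, pow_two,
      h1,
    QuadraticAlgebra.mk_mul_mk]
  ext1
  · simp; ring
  · simp

variable {l₀ l₁ b₀ b₁ b₂}

theorem Model.aeval_point_eq_zero {q : MvPolynomial (Fin 3) k} {c : k} (hc : c ≠ 0)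
    (hq : q = MvPolynomial.C c * monicForm l₀ l₁ b₀ b₁ b₂) :
    MvPolynomial.aeval (Model.point l₀ l₁ b₀ b₁ b₂) q = 0 := by
  rw [hq, aeval_C_mul_eq_zero hc]
  exact Model.aeval_point ..

theorem Model.mk_mul_mk (s t : LaurentPolynomial k) :
    (⟨s, 0⟩ * ⟨t, 0⟩ : Model l₀ l₁ b₀ b₁ b₂) = ⟨s * t, 0⟩ := by
  ext1 <;> simp

theorem Model.aeval_mk (t : LaurentPolynomial k) (P : Polynomial k) :
    Polynomial.aeval (⟨t, 0⟩ : Model l₀ l₁ b₀ b₁ b₂) P = ⟨Polynomial.aeval t P, 0⟩ :=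
  Polynomial.aeval_algebraMap_apply (Model l₀ l₁ b₀ b₁ b₂) t P

/-- A homomorphism to the explicit model is injective if it takes `X` to a transcendental Laurent
polynomial and `Y` to a nonzero multiple of `ω`, and all elements have the form `P(X) + Q(X) Y`. -/
theorem Model.injective {A : Type u} [CommRing A] [Algebra k A]
    (ψ : A →ₐ[k] Model l₀ l₁ b₀ b₁ b₂) {X Y : A} {t s : LaurentPolynomial k}
    (hX : ψ X = ⟨t, 0⟩) (hY : ψ Y = ⟨0, s⟩) (hs : s ≠ 0)
    (ht : Function.Injective (Polynomial.aeval (R := k) t))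
    (hA : ∀ r : A, ∃ P Q : Polynomial k, r = Polynomial.aeval X P + Polynomial.aeval X Q * Y) :
    Function.Injective ψ := by
  rw [injective_iff_map_eq_zero]
  intro r hr
  obtain ⟨P, Q, rfl⟩ := hA r
  rw [map_add, map_mul, ← Polynomial.aeval_algHom_apply, ← Polynomial.aeval_algHom_apply, hX, hY,
    Model.aeval_mk, Model.aeval_mk, QuadraticAlgebra.ext_iff] at hr
  obtain ⟨h1, h2⟩ := hr
  simp at h1 h2
  rw [or_iff_left hs] at h2
  rw [ht (h1.trans (map_zero _).symm), ht (h2.trans (map_zero _).symm)]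
  simp

theorem aeval_T_one_injective :
    Function.Injective (Polynomial.aeval (R := k) (LaurentPolynomial.T 1 : LaurentPolynomial k)) :=
        by
  have : Polynomial.aeval (R := k) (LaurentPolynomial.T 1 : LaurentPolynomial k) =
      Polynomial.toLaurentAlg := Polynomial.algHom_ext (by simp)
  rw [this]
  exact Polynomial.toLaurent_injective

theorem aeval_T_neg_one_injective : Function.Injective
    (Polynomial.aeval (R := k) (LaurentPolynomial.T (-1) : LaurentPolynomial k)) := by
  have : Polynomial.aeval (R := k) (LaurentPolynomial.T (-1) : LaurentPolynomial k) =
      (LaurentPolynomial.invert (R := k)).toAlgHom.comp Polynomial.toLaurentAlg :=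
    Polynomial.algHom_ext (by simp)
  rw [this]
  exact LaurentPolynomial.invert.injective.comp Polynomial.toLaurent_injective

end Model

/-! ### Functions on the intersection of two charts -/

section EvalCoord

variable {k : Type u} [Field k] {q : MvPolynomial (Fin 3) k}
variable {S : Type u} [CommRing S] [Algebra k S]

/-- The value of an element of the homogeneous coordinate ring at a zero `w` of `q` in a
`k`-algebra. -/
def evalCoord (w : Fin 3 → S) (hw : MvPolynomial.aeval w q = 0) : CoordinateRing q →ₐ[k] S :=
  Ideal.Quotient.liftₐ (Ideal.span {q}) (MvPolynomial.aeval w) fun a ha => by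
    obtain ⟨c, rfl⟩ := Ideal.mem_span_singleton'.mp ha
    rw [map_mul, hw, mul_zero]

theorem evalCoord_coord (w : Fin 3 → S) (hw : MvPolynomial.aeval w q = 0) (i : Fin 3) :
    evalCoord w hw (coord i) = w i :=
  MvPolynomial.aeval_X w i

theorem isUnit_coord_left {i j : Fin 3} {f : CoordinateRing q} (hf : f = coord i * coord j) :
    IsUnit (algebraMap _ (Localization.Away f) (coord (q := q) i)) := by
  have h : IsUnit (algebraMap (CoordinateRing q) (Localization.Away f) f) :=
    IsLocalization.Away.algebraMap_isUnit _
  rw [congrArg (algebraMap (CoordinateRing q) (Localization.Away f)) hf, map_mul] at h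
  exact isUnit_of_mul_isUnit_left h

end EvalCoord

section Intersection

open HomogeneousLocalization

variable {k : Type u} [Field k] {q : MvPolynomial (Fin 3) k} [GradedAlgebra (grading q)]

/-- The restriction of functions from the chart `xᵢ ≠ 0` to the chart `xᵢ xⱼ ≠ 0`. -/
def toAway {i j : Fin 3} {f : CoordinateRing q} (hf : f = coord i * coord j) :
    Away (grading q) (coord (q := q) i) →ₐ[k] Away (grading q) f :=
  { awayMap (grading q) (coord_mem q j) hf with
    commutes' := fun c => awayMap_fromZeroRingHom (grading q) (coord_mem q j) hf
      (algebraMap k (grading q 0) c) }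

theorem val_toAway_frac_mul {i j : Fin 3} {f : CoordinateRing q} (hf : f = coord i * coord j)
    (l : Fin 3) : algebraMap _ (Localization.Away f) (toAway hf (frac q i l)) *
      algebraMap _ _ (coord (q := q) i) = algebraMap _ _ (coord (q := q) l) := by
  have h := congrArg (Localization.awayLift (algebraMap (CoordinateRing q) (Localization.Away f))
    (coord i) (isUnit_coord_left hf)) (val_frac_mul q i l)
  rw [map_mul, IsLocalization.Away.lift_eq, IsLocalization.Away.lift_eq] at h
  rw [← h, HomogeneousLocalization.algebraMap_apply]
  congr 1
  exact val_awayMap (grading q) (coord_mem q j) hf (frac q i l)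

/-- The relation `xₗ / xᵢ = (xⱼ / xᵢ) (xₗ / xⱼ)`. -/
theorem toAway_frac_eq {i j : Fin 3} {f : CoordinateRing q} (hf : f = coord i * coord j)
    (hf' : f = coord j * coord i) (l : Fin 3) :
    toAway hf (frac q i l) = toAway hf (frac q i j) * toAway hf' (frac q j l) := by
  apply val_injective
  rw [val_mul, ← (isUnit_coord_left hf).mul_left_inj]
  rw [← HomogeneousLocalization.algebraMap_apply, ← HomogeneousLocalization.algebraMap_apply,
    ← HomogeneousLocalization.algebraMap_apply, val_toAway_frac_mul hf l, mul_right_comm,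
    val_toAway_frac_mul hf j, mul_comm, val_toAway_frac_mul hf' l]

theorem toAway_frac_mul_toAway_frac {i j : Fin 3} {f : CoordinateRing q}
    (hf : f = coord i * coord j) (hf' : f = coord j * coord i) :
    toAway hf (frac q i j) * toAway hf' (frac q j i) = 1 := by
  rw [← toAway_frac_eq hf hf' i, frac_self, map_one]

theorem range_toAway {i j : Fin 3} {f : CoordinateRing q} (hf : f = coord i * coord j) :
    (toAway hf).range = Algebra.adjoin k (Set.range fun l => toAway hf (frac q i l)) := by
  rw [Algebra.adjoin_range_eq_range_aeval]
  have h : MvPolynomial.aeval (fun l => toAway hf (frac q i l)) =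
      (toAway hf).comp (MvPolynomial.aeval (frac q i)) :=
    MvPolynomial.algHom_ext fun l => by simp
  rw [h]
  refine le_antisymm ?_ (AlgHom.range_comp_le_range _ _)
  rintro _ ⟨r, rfl⟩
  obtain ⟨p, rfl⟩ := exists_eq_aeval_frac q i r
  exact ⟨p, rfl⟩

theorem isLocalization_toAway {i j : Fin 3} {f : CoordinateRing q} (hf : f = coord i * coord j) :
    letI := (toAway hf).toRingHom.toAlgebra
    IsLocalization.Away (frac q i j) (Away (grading q) f) := by
  have h : Away.isLocalizationElem (coord_mem q i) (coord_mem q j) = frac q i j :=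
    val_injective _ (by rw [Away.val_mk, frac, Away.val_mk]; simp only [pow_one])
  rw [← h]
  exact Away.isLocalization_mul (coord_mem q i) (coord_mem q j) hf one_ne_zero

variable {S : Type u} [CommRing S] [Algebra k S]

/-- The value of a function on the chart `f ≠ 0` at a point of the conic whose coordinates `w` lie
in a `k`-algebra and make `f` invertible. -/
def evalAt (w : Fin 3 → S) (hw : MvPolynomial.aeval w q = 0) {f : CoordinateRing q}
    (hu : IsUnit (evalCoord w hw f)) : Away (grading q) f →ₐ[k] S :=
  (IsLocalization.liftAlgHom (M := .powers f) (S := Localization.Away f) (f := evalCoord w hw) (by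
    rintro ⟨_, n, rfl⟩
    rw [map_pow]
    exact hu.pow n)).comp (IsScalarTower.toAlgHom k (Away (grading q) f) (Localization.Away f))

theorem evalAt_toAway_frac_mul (w : Fin 3 → S) (hw : MvPolynomial.aeval w q = 0)
    {f : CoordinateRing q} (hu : IsUnit (evalCoord w hw f)) {i j : Fin 3}
    (hf : f = coord i * coord j) (l : Fin 3) :
    evalAt w hw hu (toAway hf (frac q i l)) * w i = w l := by
  have h := congrArg (IsLocalization.liftAlgHom (M := .powers f) (S := Localization.Away f)
    (f := evalCoord w hw) (by
    rintro ⟨_, n, rfl⟩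
    rw [map_pow]
    exact hu.pow n)) (val_toAway_frac_mul hf l)
  rw [map_mul, IsLocalization.liftAlgHom_apply, IsLocalization.liftAlgHom_apply,
    IsLocalization.liftAlgHom_apply, IsLocalization.lift_eq, IsLocalization.lift_eq] at h
  exact (congrArg _ (evalCoord_coord w hw i).symm).trans (h.trans (evalCoord_coord w hw l))

end Intersection

/-! ### Coordinates on the intersection of two charts -/

section Coordinates

open HomogeneousLocalization

variable {k : Type u} [Field k] {q : MvPolynomial (Fin 3) k} [GradedAlgebra (grading q)]
  {c l₀ l₁ b₀ b₁ b₂ : k}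

/-- The functions on the chart `x₀ ≠ 0` are the `P(x) + Q(x) y` with polynomials `P` and `Q`. -/
theorem exists_eq_aeval_frac_zero (hhom : q.IsHomogeneous 2) (hc : c ≠ 0)
    (hq : q = MvPolynomial.C c * monicForm l₀ l₁ b₀ b₁ b₂)
    (r : Away (grading q) (coord (q := q) 0)) : ∃ P Q : Polynomial k,
      r = Polynomial.aeval (frac q 0 1) P + Polynomial.aeval (frac q 0 1) Q * frac q 0 2 := by
  obtain ⟨p, rfl⟩ := exists_eq_aeval_frac q 0 r
  have h : MvPolynomial.aeval (frac q 0) (MvPolynomial.C c * monicForm l₀ l₁ b₀ b₁ b₂) = 0 :=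
    (congrArg _ hq.symm).trans (aeval_frac_self q hhom 0)
  rw [aeval_C_mul_eq_zero hc, aeval_monicForm, frac_self] at h
  refine exists_eq_aeval_add_aeval_mul (v := frac q 0) (X := frac q 0 1) (Y := frac q 0 2) ?_
    (P₀ := -(Polynomial.C b₀ + Polynomial.C b₁ * Polynomial.X + Polynomial.C b₂ * Polynomial.X ^ 2))
    (Q₀ := -(Polynomial.C l₀ + Polynomial.C l₁ * Polynomial.X)) ?_ p
  · intro i
    fin_cases i
    · exact .inl (frac_self q 0)
    · exact .inr (.inl rfl)
    · exact .inr (.inr rfl)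
  · simp only [map_neg, map_add, map_mul, map_pow, Polynomial.aeval_C, Polynomial.aeval_X]
    linear_combination h

/-- The functions on the chart `x₁ ≠ 0` are the `P(x⁻¹) + Q(x⁻¹) x⁻¹ y` with polynomials `P` and
`Q`. -/
theorem exists_eq_aeval_frac_one (hhom : q.IsHomogeneous 2) (hc : c ≠ 0)
    (hq : q = MvPolynomial.C c * monicForm l₀ l₁ b₀ b₁ b₂)
    (r : Away (grading q) (coord (q := q) 1)) : ∃ P Q : Polynomial k,
      r = Polynomial.aeval (frac q 1 0) P + Polynomial.aeval (frac q 1 0) Q * frac q 1 2 := by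
  obtain ⟨p, rfl⟩ := exists_eq_aeval_frac q 1 r
  have h : MvPolynomial.aeval (frac q 1) (MvPolynomial.C c * monicForm l₀ l₁ b₀ b₁ b₂) = 0 :=
    (congrArg _ hq.symm).trans (aeval_frac_self q hhom 1)
  rw [aeval_C_mul_eq_zero hc, aeval_monicForm, frac_self] at h
  refine exists_eq_aeval_add_aeval_mul (v := frac q 1) (X := frac q 1 0) (Y := frac q 1 2) ?_
    (P₀ := -(Polynomial.C b₂ + Polynomial.C b₁ * Polynomial.X + Polynomial.C b₀ * Polynomial.X ^ 2))
    (Q₀ := -(Polynomial.C l₁ + Polynomial.C l₀ * Polynomial.X)) ?_ p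
  · intro i
    fin_cases i
    · exact .inr (.inl rfl)
    · exact .inl (frac_self q 1)
    · exact .inr (.inr rfl)
  · simp only [map_neg, map_add, map_mul, map_pow, Polynomial.aeval_C, Polynomial.aeval_X]
    linear_combination h

/-- The functions on the intersection of the charts `x₀ ≠ 0` and `x₁ ≠ 0` of the conic. -/
abbrev Overlap (q : MvPolynomial (Fin 3) k) [GradedAlgebra (grading q)] : Type u :=
  Away (grading q) (coord (q := q) 0 * coord (q := q) 1)

/-- The restriction of functions from the chart `x₀ ≠ 0`. -/
abbrev ofChartZero : Away (grading q) (coord (q := q) 0) →ₐ[k] Overlap q := toAway rfl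

/-- The restriction of functions from the chart `x₁ ≠ 0`. -/
abbrev ofChartOne : Away (grading q) (coord (q := q) 1) →ₐ[k] Overlap q := toAway (mul_comm _ _)

variable (q) in
/-- The unit `x₁ / x₀`. -/
def overlapX : (Overlap q)ˣ where
  val := ofChartZero (frac q 0 1)
  inv := ofChartOne (frac q 1 0)
  val_inv := toAway_frac_mul_toAway_frac _ _
  inv_val := toAway_frac_mul_toAway_frac _ _

variable (q) in
/-- The function `x₂ / x₀`. -/
def overlapY : Overlap q := ofChartZero (frac q 0 2)

theorem ofChartOne_frac_two :
    ofChartOne (frac q 1 2) = (↑(overlapX q)⁻¹ * overlapY q : Overlap q) :=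
  toAway_frac_eq _ _ _

theorem range_ofChartZero : (ofChartZero (q := q)).range =
    Algebra.adjoin k {(overlapX q : Overlap q), overlapY q} := by
  rw [range_toAway]
  refine le_antisymm (Algebra.adjoin_le ?_) (Algebra.adjoin_mono ?_)
  · rintro _ ⟨l, rfl⟩
    fin_cases l
    · dsimp only [Fin.zero_eta]
      rw [frac_self, map_one]
      exact one_mem _
    · exact Algebra.subset_adjoin (.inl rfl)
    · exact Algebra.subset_adjoin (.inr rfl)
  · rintro _ (rfl | rfl)
    · exact ⟨1, rfl⟩
    · exact ⟨2, rfl⟩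

theorem range_ofChartOne : (ofChartOne (q := q)).range =
    Algebra.adjoin k {(↑(overlapX q)⁻¹ : Overlap q), ↑(overlapX q)⁻¹ * overlapY q} := by
  rw [range_toAway]
  refine le_antisymm (Algebra.adjoin_le ?_) (Algebra.adjoin_mono ?_)
  · rintro _ ⟨l, rfl⟩
    fin_cases l
    · exact Algebra.subset_adjoin (.inl rfl)
    · dsimp only [Fin.mk_one]
      rw [frac_self, map_one]
      exact one_mem _
    · exact Algebra.subset_adjoin (.inr ofChartOne_frac_two)
  · rintro _ (rfl | rfl)
    · exact ⟨0, rfl⟩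
    · exact ⟨2, ofChartOne_frac_two⟩

theorem isUnit_mk_T (i : ℤ) :
    IsUnit (⟨LaurentPolynomial.T i, 0⟩ : Model l₀ l₁ b₀ b₁ b₂) :=
  (LaurentPolynomial.isUnit_T i).map (algebraMap (LaurentPolynomial k) (Model l₀ l₁ b₀ b₁ b₂))

/-- The map from the functions on the intersection to the explicit model. -/
def toModel (hc : c ≠ 0) (hq : q = MvPolynomial.C c * monicForm l₀ l₁ b₀ b₁ b₂) :
    Overlap q →ₐ[k] Model l₀ l₁ b₀ b₁ b₂ :=
  evalAt (Model.point l₀ l₁ b₀ b₁ b₂) (Model.aeval_point_eq_zero hc hq) (by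
    rw [map_mul, evalCoord_coord, evalCoord_coord]
    exact isUnit_one.mul (isUnit_mk_T 1))

variable (hc : c ≠ 0) (hq : q = MvPolynomial.C c * monicForm l₀ l₁ b₀ b₁ b₂)

theorem toModel_x : toModel hc hq (overlapX q : Overlap q) = ⟨LaurentPolynomial.T 1, 0⟩ := by
  have h := evalAt_toAway_frac_mul (Model.point l₀ l₁ b₀ b₁ b₂) (Model.aeval_point_eq_zero hc hq)
    (f := coord 0 * coord 1) (by
    rw [map_mul, evalCoord_coord, evalCoord_coord]
    exact isUnit_one.mul (isUnit_mk_T 1)) rfl 1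
  exact (mul_one _).symm.trans h

theorem toModel_y : toModel hc hq (overlapY q) = ⟨0, 1⟩ := by
  have h := evalAt_toAway_frac_mul (Model.point l₀ l₁ b₀ b₁ b₂) (Model.aeval_point_eq_zero hc hq)
    (f := coord 0 * coord 1) (by
    rw [map_mul, evalCoord_coord, evalCoord_coord]
    exact isUnit_one.mul (isUnit_mk_T 1)) rfl 2
  exact (mul_one _).symm.trans h

theorem toModel_x_zpow (i : ℤ) :
    toModel hc hq (↑(overlapX q ^ i) : Overlap q) = ⟨LaurentPolynomial.T i, 0⟩ := by
  let t (n : ℤ) : (Model l₀ l₁ b₀ b₁ b₂)ˣ :=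
    ⟨⟨LaurentPolynomial.T n, 0⟩, ⟨LaurentPolynomial.T (-n), 0⟩,
      by rw [Model.mk_mul_mk, ← LaurentPolynomial.T_add, add_neg_cancel]; rfl,
      by rw [Model.mk_mul_mk, ← LaurentPolynomial.T_add, neg_add_cancel]; rfl⟩
  have ht (m n : ℤ) : t (m + n) = t m * t n := Units.ext <| by
    rw [Units.val_mul, Model.mk_mul_mk, ← LaurentPolynomial.T_add]
  let τ : Multiplicative ℤ →* (Model l₀ l₁ b₀ b₁ b₂)ˣ := MonoidHom.mk' (fun n => t n.toAdd)
    fun m n => ht _ _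
  have h1 : Units.map (toModel hc hq : Overlap q →* _) (overlapX q) = τ (.ofAdd 1) :=
    Units.ext (toModel_x hc hq)
  have h2 : Units.map (toModel hc hq : Overlap q →* _) (overlapX q ^ i) = τ (.ofAdd i) := by
    rw [map_zpow, h1, ← map_zpow, ← ofAdd_zsmul, smul_eq_mul, mul_one]
  exact congrArg Units.val h2

theorem ofChartZero_injective (hhom : q.IsHomogeneous 2) (hc : c ≠ 0)
    (hq : q = MvPolynomial.C c * monicForm l₀ l₁ b₀ b₁ b₂) :
    Function.Injective (ofChartZero (q := q)) := by
  refine Function.Injective.of_comp (f := toModel hc hq)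
    (Model.injective ((toModel hc hq).comp ofChartZero) (X := frac q 0 1) (Y := frac q 0 2)
      (toModel_x hc hq) (toModel_y hc hq) one_ne_zero aeval_T_one_injective
      (exists_eq_aeval_frac_zero hhom hc hq))

theorem ofChartOne_injective (hhom : q.IsHomogeneous 2) (hc : c ≠ 0)
    (hq : q = MvPolynomial.C c * monicForm l₀ l₁ b₀ b₁ b₂) :
    Function.Injective (ofChartOne (q := q)) := by
  have hX : toModel hc hq (ofChartOne (frac q 1 0)) = ⟨LaurentPolynomial.T (-1), 0⟩ := by
    rw [← toModel_x_zpow hc hq, zpow_neg_one]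
    rfl
  refine Function.Injective.of_comp (f := toModel hc hq)
    (Model.injective ((toModel hc hq).comp ofChartOne) (X := frac q 1 0) (Y := frac q 1 2)
      (t := LaurentPolynomial.T (-1)) (s := LaurentPolynomial.T (-1)) hX ?_
      (LaurentPolynomial.isUnit_T _).ne_zero aeval_T_neg_one_injective
      (exists_eq_aeval_frac_one hhom hc hq))
  rw [AlgHom.comp_apply, ofChartOne_frac_two, map_mul, toModel_y]
  refine (congrArg (· * _) hX).trans ?_
  ext1 <;> simp

theorem overlap_rel (hhom : q.IsHomogeneous 2) (hc : c ≠ 0)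
    (hq : q = MvPolynomial.C c * monicForm l₀ l₁ b₀ b₁ b₂) :
    (overlapY q ^ 2 + (algebraMap k _ l₀ + algebraMap k _ l₁ * ↑(overlapX q)) * overlapY q +
      (algebraMap k _ b₀ + algebraMap k _ b₁ * ↑(overlapX q) +
        algebraMap k _ b₂ * ↑(overlapX q) ^ 2) : Overlap q) = 0 := by
  have h : MvPolynomial.aeval (frac q 0) (MvPolynomial.C c * monicForm l₀ l₁ b₀ b₁ b₂) = 0 :=
    (congrArg _ hq.symm).trans (aeval_frac_self q hhom 0)
  rw [aeval_C_mul_eq_zero hc, aeval_monicForm, frac_self] at h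
  have h' := congrArg ofChartZero h
  simp only [map_add, map_mul, map_pow, map_zero, AlgHom.commutes, one_pow, mul_one,
    one_mul] at h'
  exact h'

theorem overlap_span (hhom : q.IsHomogeneous 2) (hc : c ≠ 0)
    (hq : q = MvPolynomial.C c * monicForm l₀ l₁ b₀ b₁ b₂) :
    Submodule.span k ((Set.range fun i : ℤ => (↑(overlapX q ^ i) : Overlap q)) ∪
      Set.range fun i : ℤ => (↑(overlapX q ^ i) * overlapY q : Overlap q)) = ⊤ := by
  set N := Submodule.span k ((Set.range fun i : ℤ => (↑(overlapX q ^ i) : Overlap q)) ∪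
      Set.range fun i : ℤ => (↑(overlapX q ^ i) * overlapY q : Overlap q))
  have h1 (P : Polynomial k) (i : ℤ) :
      (↑(overlapX q ^ i) * Polynomial.aeval (overlapX q : Overlap q) P : Overlap q) ∈ N ∧
      (↑(overlapX q ^ i) * Polynomial.aeval (overlapX q : Overlap q) P * overlapY q : Overlap q) ∈
          N := by
    induction P using Polynomial.induction_on' with
    | add P Q hP hQ =>
      rw [map_add, mul_add, add_mul]
      exact ⟨add_mem hP.1 hQ.1, add_mem hP.2 hQ.2⟩
    | monomial n a =>
      have h : (↑(overlapX q ^ i) * Polynomial.aeval (overlapX q : Overlap q)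
          (Polynomial.monomial n a) : Overlap q) =
            algebraMap k _ a * ↑(overlapX q ^ (i + n)) := by
        rw [Polynomial.aeval_monomial, zpow_add, zpow_natCast, Units.val_mul,
          Units.val_pow_eq_pow_val, mul_left_comm]
      rw [h, mul_assoc, ← Algebra.smul_def, ← Algebra.smul_def]
      exact ⟨N.smul_mem _ (Submodule.subset_span (.inl ⟨_, rfl⟩)),
        N.smul_mem _ (Submodule.subset_span (.inr ⟨_, rfl⟩))⟩
  refine eq_top_iff.2 fun b _ => ?_
  let := (ofChartZero (q := q)).toRingHom.toAlgebra
  have := isLocalization_toAway (q := q) (i := 0) (j := 1) rfl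
  obtain ⟨n, r, hr⟩ := IsLocalization.Away.surj (frac q 0 1) b
  replace hr : b * ↑((overlapX q) ^ n) = ofChartZero r := hr
  obtain ⟨P, Q, rfl⟩ := exists_eq_aeval_frac_zero hhom hc hq r
  rw [map_add, map_mul, ← Polynomial.aeval_algHom_apply, ← Polynomial.aeval_algHom_apply] at hr
  have hb : b = ↑((overlapX q) ^ (-n : ℤ)) * Polynomial.aeval (overlapX q : Overlap q) P +
      ↑((overlapX q) ^ (-n : ℤ)) * Polynomial.aeval (overlapX q : Overlap q) Q * overlapY q := by
    rw [mul_assoc, ← mul_add, zpow_neg, zpow_natCast, Units.eq_inv_mul_iff_mul_eq, mul_comm]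
    exact hr
  rw [hb]
  exact add_mem (h1 P _).1 (h1 Q _).2

/-- The coordinates on the intersection of the charts `x₀ ≠ 0` and `x₁ ≠ 0` of an anisotropic
conic. -/
def conicRing (hhom : q.IsHomogeneous 2) (hani : IsAnisotropic q) (hc : c ≠ 0)
    (hq : q = MvPolynomial.C c * monicForm l₀ l₁ b₀ b₁ b₂) : ConicRing k (Overlap q) where
  x := overlapX q
  y := overlapY q
  l₀ := l₀
  l₁ := l₁
  b₀ := b₀
  b₁ := b₁
  b₂ := b₂
  rel := overlap_rel hhom hc hq
  res := Finsupp.lapply 0 ∘ₗ (AddMonoidAlgebra.coeffLinearEquiv k).toLinearMap ∘ₗ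
    (QuadraticAlgebra.imₗ _ _).restrictScalars k ∘ₗ (toModel hc hq).toLinearMap
  res_zpow i := by
    rw [LinearMap.comp_apply, LinearMap.comp_apply, LinearMap.comp_apply, AlgHom.toLinearMap_apply,
      toModel_x_zpow]
    rfl
  res_zpow_mul_y i := by
    have h : (⟨LaurentPolynomial.T i, 0⟩ * ⟨0, 1⟩ : Model l₀ l₁ b₀ b₁ b₂) =
        ⟨0, LaurentPolynomial.T i⟩ := by ext1 <;> simp
    rw [LinearMap.comp_apply, LinearMap.comp_apply, LinearMap.comp_apply, AlgHom.toLinearMap_apply,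
      map_mul, toModel_x_zpow, toModel_y, h]
    exact Finsupp.single_apply
  span_eq_top := overlap_span hhom hc hq
  anisotropic u v t h := by
    have h0 : MvPolynomial.eval ![u, v, t] q = 0 := by
      have := aeval_monicForm l₀ l₁ b₀ b₁ b₂ ![u, v, t]
      rw [hq, map_mul, ← MvPolynomial.coe_aeval_eq_eval, RingHom.coe_coe, this]
      refine mul_eq_zero_of_right _ ?_
      simp
      linear_combination h
    have h1 := hani _ h0
    exact ⟨congrFun h1 0, congrFun h1 1, congrFun h1 2⟩

end Coordinates

/-! ### The conic as a scheme covered by two charts -/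

section Charts

open HomogeneousLocalization

variable {k : Type u} [Field k] {q : MvPolynomial (Fin 3) k} [GradedAlgebra (grading q)]
  {c l₀ l₁ b₀ b₁ b₂ : k}

theorem iSup_basicOpen_coord :
    ⨆ i : Fin 3, Proj.basicOpen (grading q) (coord i) = ⊤ := by
  refine Proj.iSup_basicOpen_eq_top' (grading q) _ (fun i => ⟨1, coord_mem q i⟩) ?_
  refine eq_top_iff.2 fun a _ => ?_
  obtain ⟨p, rfl⟩ := Ideal.Quotient.mk_surjective a
  induction p using MvPolynomial.induction_on with
  | C a => exact Subalgebra.algebraMap_mem _ (algebraMap k (grading q 0) a)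
  | add p r hp hr =>
    rw [map_add]
    exact add_mem (hp trivial) (hr trivial)
  | mul_X p i hp =>
    rw [map_mul]
    exact mul_mem (hp trivial) (Algebra.subset_adjoin ⟨i, rfl⟩)

/-- The point `(0 : 0 : 1)` does not lie on the conic. -/
theorem basicOpen_sup_basicOpen (hc : c ≠ 0)
    (hq : q = MvPolynomial.C c * monicForm l₀ l₁ b₀ b₁ b₂) :
    Proj.basicOpen (grading q) (coord 0) ⊔ Proj.basicOpen (grading q) (coord 1) = ⊤ := by
  refine eq_top_iff.2 ?_
  rw [← iSup_basicOpen_coord]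
  have h2 : Proj.basicOpen (grading q) (coord 2) ≤
      Proj.basicOpen (grading q) (coord 0) ⊔ Proj.basicOpen (grading q) (coord 1) := by
    intro z hz
    by_contra hn
    have h0 : coord 0 ∈ z.asHomogeneousIdeal := by
      by_contra h
      exact hn (.inl ((Proj.mem_basicOpen _ _ _).2 h))
    have h1 : coord 1 ∈ z.asHomogeneousIdeal := by
      by_contra h
      exact hn (.inr ((Proj.mem_basicOpen _ _ _).2 h))
    refine (Proj.mem_basicOpen _ _ _).1 hz (z.isPrime.mem_of_pow_mem 2 ?_)
    have h : MvPolynomial.aeval (coord (q := q)) (MvPolynomial.C c * monicForm l₀ l₁ b₀ b₁ b₂) = 0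
        := by
      have : Ideal.Quotient.mkₐ k (Ideal.span {q}) = MvPolynomial.aeval coord :=
        MvPolynomial.algHom_ext fun j => by simp
      rw [← hq, ← this]
      exact Ideal.Quotient.eq_zero_iff_mem.2 (Ideal.mem_span_singleton_self q)
    rw [aeval_C_mul_eq_zero hc, aeval_monicForm, add_assoc] at h
    rw [eq_neg_of_add_eq_zero_left h]
    refine neg_mem (add_mem ?_ (add_mem (add_mem ?_ ?_) ?_))
    · exact Ideal.mul_mem_right _ _ (add_mem (Ideal.mul_mem_left _ _ h0) (Ideal.mul_mem_left _ _
        h1))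
    · exact Ideal.mul_mem_left _ _ (Ideal.pow_mem_of_mem _ h0 2 two_pos)
    · exact Ideal.mul_mem_left _ _ (Ideal.mul_mem_left _ _ h1)
    · exact Ideal.mul_mem_left _ _ (Ideal.pow_mem_of_mem _ h1 2 two_pos)
  refine iSup_le fun i => ?_
  fin_cases i
  · exact le_sup_left
  · exact le_sup_right
  · exact h2

/-- The charts `x₀ ≠ 0` and `x₁ ≠ 0` of the conic. -/
def twoCharts (hc : c ≠ 0) (hq : q = MvPolynomial.C c * monicForm l₀ l₁ b₀ b₁ b₂) :
    TwoCharts (Proj (grading q)) where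
  R
    | false => .of (Away (grading q) (coord (q := q) 0))
    | true => .of (Away (grading q) (coord (q := q) 1))
  B := .of (Overlap q)
  φ
    | false => CommRingCat.ofHom (ofChartZero (q := q)).toRingHom
    | true => CommRingCat.ofHom (ofChartOne (q := q)).toRingHom
  j
    | false => Proj.awayι (grading q) (coord 0) (coord_mem q 0) one_pos
    | true => Proj.awayι (grading q) (coord 1) (coord_mem q 1) one_pos
  g := Proj.awayι (grading q) (coord 0 * coord 1)
    (SetLike.mul_mem_graded (coord_mem q 0) (coord_mem q 1)) two_pos
  open_j
    | false => inferInstanceAs (IsOpenImmersion (Proj.awayι _ _ _ _))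
    | true => inferInstanceAs (IsOpenImmersion (Proj.awayι _ _ _ _))
  open_g := inferInstance
  comp_eq
    | false => Proj.SpecMap_awayMap_awayι (grading q) (coord_mem q 0) one_pos (coord_mem q 1) rfl
    | true => Proj.SpecMap_awayMap_awayι (grading q) (coord_mem q 1) one_pos (coord_mem q 0)
        (mul_comm _ _)
  cover := by
    rw [iSup_bool_eq]
    change Scheme.Hom.opensRange (Proj.awayι _ _ _ _) ⊔ Scheme.Hom.opensRange (Proj.awayι _ _ _ _)
        = _
    rw [Proj.opensRange_awayι, Proj.opensRange_awayι, sup_comm]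
    exact basicOpen_sup_basicOpen hc hq
  inter := by
    change Scheme.Hom.opensRange (Proj.awayι _ _ _ _) ⊓ Scheme.Hom.opensRange (Proj.awayι _ _ _ _)
        ≤ _
    rw [Proj.opensRange_awayι, Proj.opensRange_awayι, Proj.opensRange_awayι, Proj.basicOpen_mul]
  f
    | false => frac q 0 1
    | true => frac q 1 0
  loc
    | false => isLocalization_toAway rfl
    | true => isLocalization_toAway (mul_comm _ _)

/-- The charts `x₀ ≠ 0` and `x₁ ≠ 0` of an anisotropic conic, with coordinates. -/
def conicCharts (hhom : q.IsHomogeneous 2) (hani : IsAnisotropic q) (hc : c ≠ 0)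
    (hq : q = MvPolynomial.C c * monicForm l₀ l₁ b₀ b₁ b₂) : ConicCharts k (Proj (grading q)) where
  toTwoCharts := twoCharts hc hq
  algebra := inferInstanceAs (Algebra k (Overlap q))
  D := conicRing hhom hani hc hq
  injective
    | false => ofChartZero_injective hhom hc hq
    | true => ofChartOne_injective hhom hc hq
  mem_range_false r := SetLike.ext_iff.1 range_ofChartZero r
  mem_range_true r := SetLike.ext_iff.1 range_ofChartOne r
  φ_f_false := rfl
  φ_f_true := rfl

theorem IsAnisotropic.nonempty_conicCharts (hhom : q.IsHomogeneous 2) (hani : IsAnisotropic q) :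
    Nonempty (ConicCharts k (Proj (grading q))) := by
  obtain ⟨c, l₀, l₁, b₀, b₁, b₂, hc, hq⟩ := hani.exists_eq_monicForm hhom
  exact ⟨conicCharts hhom hani hc hq⟩

end Charts

end PlaneConic

end

theorem proposition3p1 {k : Type u} [Field k] (q : MvPolynomial (Fin 3) k)
    (hq : q.IsHomogeneous 2) (hani : PlaneConic.IsAnisotropic q) :
    (∀ V : (PlaneConic.conic q hq).Modules, PlaneConic.IsVectorBundle V → ¬ IsZero V →
      ∃ (n : ℕ) (W : Fin n → (PlaneConic.conic q hq).Modules),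
        (∀ i, Indecomposable (W i) ∧ ∃ r ≤ 2, PlaneConic.HasRank (W i) r) ∧
        Nonempty (V ≅ ⨁ W)) ∧
    (∀ V : (PlaneConic.conic q hq).Modules, PlaneConic.IsVectorBundle V → Indecomposable V →
      ∃ r ≤ 2, PlaneConic.HasRank V r) := by
  let := PlaneConic.gradedAlgebra q hq
  obtain ⟨T⟩ := hani.nonempty_conicCharts hq
  exact ⟨fun V hV h0 => T.exists_decomposition_of_isVectorBundle hV h0,
    fun V hV h => T.exists_rank_le_two hV h⟩
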